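/- **Notation.** Let $q=e^{\eta}$ with $\operatorname{Re}\eta<0$ (so $q\ne 0$, $|q|<1$), $q^x=e^{x\eta}$ and $[x]=\frac{q^x-q^{-x}}{q-q^{-1}}$ for $x\in\mathbb R$. Let $(a_{ij})_{1\le i,j\le N-1}$ be the Cartan matrix of $sl_N$, and let $r,c\in\mathbb R$ with $r>0$, $r^*=r-c>0$, $p=q^{2r}$, $p^*=q^{2r^*}=pq^{-2c}$. For $|t|<1$ put $(x;t)_\infty=\prod_{n\ge0}(1-xt^n)$ and $\Theta_t(x)=(x;t)_\infty(tx^{-1};t)_\infty(t;t)_\infty$; put $\delta(x)=\sum_{n\in\mathbb Z}x^n$ and $[A,B]_x=AB-xBA$. $U_q(\widehat{sl}_N)$ at level $c$ is the associative unital $\mathbb C$-algebra generated by $h_i$, $q^{\pm h_i}$, $H^i_n$ $(n\in\mathbb Z\setminus\{0\})$, $e^{\pm,i}_n$ $(n\in\mathbb Z)$, $1\le i\le N-1$, with the relations: $q^{h_i}q^{-h_i}=q^{-h_i}q^{h_i}=1$; the $h_i,q^{\pm h_i}$ commute with each other and with all $H^j_n$; $[h_i,e^{\pm,j}_n]=\pm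 a_{ij}e^{\pm,j}_n$ and $q^{h_i}e^{\pm,j}_nq^{-h_i}=q^{\pm a_{ij}}e^{\pm,j}_n$; $$[H^i_n,H^j_m]=\tfrac{[a_{ij}n][cn]}{n}\delta_{n+m,0},\qquad [H^i_n,e^{\pm,j}_m]=\pm\tfrac{[a_{ij}n]}{n}q^{\mp c|n|/2}e^{\pm,j}_{n+m},$$ $$[e^{+,i}_n,e^{-,j}_m]=\tfrac{\delta_{ij}}{q-q^{-1}}\big(q^{\frac c2(n-m)}\psi^i_{+,n+m}-q^{-\frac c2(n-m)}\psi^i_{-,n+m}\big),\qquad [e^{\pm,i}_{n+1},e^{\pm,j}_m]_{q^{\pm a_{ij}}}+[e^{\pm,j}_{m+1},e^{\pm,i}_n]_{q^{\pm a_{ij}}}=0,$$ $[e^{\pm,i}_n,e^{\pm,j}_m]=0$ if $a_{ij}=0$, and $[e^{\pm,i}_n,[e^{\pm,i}_m,e^{\pm,j}_l]_{q^{\mp1}}]_{q^{\pm1}}+(n\leftrightarrow m)=0$ if $a_{ij}=-1$, where $\psi_\pm^i(z)=\sum_n\psi^i_{\pm,n}z^{-n}=q^{\pm h_i}\exp\big(\pm(q-q^{-1})\sum_{\pm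 n>0}H^i_nz^{-n}\big)$. Put $e^{\pm,i}(z)=\sum_ne^{\pm,i}_nz^{-n-1}$. Let $\deg H^i_n=\deg e^{\pm,i}_n=n$, $\deg h_i=\deg q^{\pm h_i}=0$, let $I_n$ be the left ideal generated by all monomials in the generators of degree at least $n$, and let $\widehat U=\varprojlim_n U_q(\widehat{sl}_N)/I_n$, a complete topological algebra. Put $$D_i^+(z)=\exp\Big(\sum_{n>0}\tfrac{1}{[r^*n]}H^i_{-n}q^{(r^*+\frac c2)n}z^n\Big),\qquad D_i^-(z)=\exp\Big(-\sum_{n>0}\tfrac1{[rn]}H^i_nq^{(r-\frac c2)n}z^{-n}\Big).$$ **Proposition 1.** The coefficients of the dressed currents $$\Psi_i^\pm(z)=D_i^+(q^{\pm\frac c2}z)\,\psi^i_\pm(z)\,D_i^-(q^{\mp\frac c2}z),\qquad e_i(z)=D_i^+(z)e^{+,i}(z),\qquad f_i(z)=e^{-,i}(z)D_i^-(z)$$ are given by convergent series in $\widehat U$, and for all $1\le i,j\le N-1$: 1. $\Psi_i^{\pm}(z)\Psi_j^{\pm}(w)=\dfrac{\Theta_p(q^{-a_{ij}}\frac zw)\Theta_{p^*}(q^{a_{ij}}\frac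 zw)}{\Theta_p(q^{a_{ij}}\frac zw)\Theta_{p^*}(q^{-a_{ij}}\frac zw)}\Psi_j^{\pm}(w)\Psi_i^{\pm}(z)$; 2. $\Psi_i^{+}(z)\Psi_j^{-}(w)=\dfrac{\Theta_p(pq^{-a_{ij}-c}\frac zw)\Theta_{p^*}(p^*q^{a_{ij}+c}\frac zw)}{\Theta_p(pq^{a_{ij}-c}\frac zw)\Theta_{p^*}(p^*q^{-a_{ij}+c}\frac zw)}\Psi_j^{-}(w)\Psi_i^{+}(z)$; 3. $\Psi_i^{\pm}(z)e_j(w)=q^{-a_{ij}}\dfrac{\Theta_{p^*}(q^{\pm\frac c2+a_{ij}}\frac zw)}{\Theta_{p^*}(q^{\pm\frac c2-a_{ij}}\frac zw)}e_j(w)\Psi_i^{\pm}(z)$; 4. $\Psi_i^{\pm}(z)f_j(w)=q^{a_{ij}}\dfrac{\Theta_p(q^{\mp\frac c2-a_{ij}}\frac zw)}{\Theta_p(q^{\mp\frac c2+a_{ij}}\frac zw)}f_j(w)\Psi_i^{\pm}(z)$; 5. $[e_i(z),f_j(w)]=\dfrac{\delta_{ij}}{(q-q^{-1})zw}\Big(\delta(q^{-c}\tfrac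 zw)\Psi_i^+(q^{\frac c2}w)-\delta(q^{c}\tfrac zw)\Psi_i^-(q^{-\frac c2}w)\Big)$; 6. $e_i(z)e_j(w)=q^{-a_{ij}}\dfrac{\Theta_{p^*}(q^{a_{ij}}\frac zw)}{\Theta_{p^*}(q^{-a_{ij}}\frac zw)}e_j(w)e_i(z)$; 7. $f_i(z)f_j(w)=q^{a_{ij}}\dfrac{\Theta_p(q^{-a_{ij}}\frac zw)}{\Theta_p(q^{a_{ij}}\frac zw)}f_j(w)f_i(z)$; 8. if $|i-j|=1$, with $\alpha(x)=\frac{(p^*qx;p^*)_\infty}{(p^*q^{-1}x;p^*)_\infty}$ and $\beta(x)=\frac{(p^*q^2x;p^*)_\infty}{(p^*q^{-2}x;p^*)_\infty}$, $$\beta(\tfrac{z_2}{z_1})\Big\{e_j(w)e_i(z_1)e_i(z_2)-[2]\tfrac{\alpha(z_1/w)}{\alpha(w/z_1)}e_i(z_1)e_j(w)e_i(z_2)+\tfrac{\alpha(z_1/w)}{\alpha(w/z_1)}\tfrac{\alpha(z_2/w)}{\alpha(w/z_2)}e_i(z_1)e_i(z_2)e_j(w)\Big\}+(z_1\leftrightarrow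 z_2)=0;$$ 9. if $|i-j|=1$, the relation of item 8 with $e$ replaced by $f$, $\alpha(x)=\frac{(pq^{-1}x;p)_\infty}{(pqx;p)_\infty}$ and $\beta(x)=\frac{(pq^{-2}x;p)_\infty}{(pq^{2}x;p)_\infty}$. These are identities of formal series with coefficients in $\widehat U$, in the following sense. Item 5 is a coefficientwise identity. In items 1-4, 6, 7, each $\Theta_t(ux)$ is written as $(t;t)_\infty(1-ux)\,(tux;t)_\infty\,(tu^{-1}x^{-1};t)_\infty$, so the quotient of theta functions becomes $g(x)=\frac{n(x)}{d(x)}\frac{B(x)}{A(x^{-1})}$, where $n/d$ is the rational function in lowest terms that comes from the prefactor and the factors $(t;t)_\infty(1-ux)$, $B$ comes from the factors $(tux;t)_\infty$, and $A(x^{-1})^{-1}$ comes from the factors $(tu^{-1}x^{-1};t)_\infty$; $X(z)Y(w)=g(\frac zw)Y(w)X(z)$ means $d(\frac zw)A(\frac wz)X(z)Y(w)=n(\frac zw)B(\frac zw)Y(w)X(z)$ with $A$, $B$ expanded as power series (all coefficients converge in $\widehat U$). In items 8 and 9 the common factor $\alpha(\frac{z_1}w)\alpha(\frac{z_2}w)$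 is divided out, and then the coefficient functions are expanded as power series in $\frac{z_2}{z_1},\frac{z_1}{w},\frac{w}{z_1},\frac{z_2}{w},\frac{w}{z_2}$, and in the exchanged term in $\frac{z_1}{z_2}$ in place of $\frac{z_2}{z_1}$ (again with convergence in $\widehat U$). -/

import Mathlib

open scoped PowerSeries.WithPiTopology

noncomputable section

namespace EllipticSlN

/-! ### Powers of `q`, `q`-integers, infinite products, theta functions

The complex number `q` with `q ≠ 0`, `|q| < 1` is given through a logarithm `η`, that is
`q = exp η` with `Re η < 0`; this fixes the meaning of `q ^ x` for real `x`. -/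

/-- `q ^ x = exp (x η)`. -/
def qpow (η : ℂ) (x : ℝ) : ℂ := Complex.exp ((x : ℂ) * η)

/-- `[x] = (q ^ x - q ^ (-x)) / (q - q⁻¹)`. -/
def qint (η : ℂ) (x : ℝ) : ℂ := (qpow η x - qpow η (-x)) / (qpow η 1 - qpow η (-1))

/-- The infinite product `(x; t)_∞ = ∏_{n ≥ 0} (1 - x t ^ n)`. -/
def qPoch (t x : ℂ) : ℂ := ∏' n : ℕ, (1 - x * t ^ n)

/-- The elliptic theta function `Θ_t(x) = (x; t)_∞ (t x⁻¹; t)_∞ (t; t)_∞`. -/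
def theta (t x : ℂ) : ℂ := qPoch t x * qPoch t (t * x⁻¹) * qPoch t t

/-- The formal power series `(u X; t)_∞ = ∏_{n ≥ 0} (1 - u t ^ n X)` (infinite product in the
topology of coefficientwise convergence, with the usual topology on `ℂ`). -/
def qPochSeries (t u : ℂ) : PowerSeries ℂ :=
  ∏' n : ℕ, (1 - PowerSeries.C (u * t ^ n) * PowerSeries.X)

/-- `Θ_t(x) = (t; t)_∞ (1 - x) · (t x; t)_∞ · (t x⁻¹; t)_∞`. -/
theorem theta_split {t : ℂ} (ht : ‖t‖ < 1) (x : ℂ) :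
    theta t x = qPoch t t * (1 - x) * qPoch t (t * x) * qPoch t (t * x⁻¹) := by
  have hs : Summable fun n : ℕ => ‖-(x * t ^ n)‖ := by
    simp only [norm_neg, norm_mul, norm_pow]
    exact (summable_geometric_of_lt_one (norm_nonneg t) ht).mul_left _
  have hs1 : Summable fun n : ℕ => ‖-(t * x * t ^ n)‖ := by
    simp only [norm_neg, norm_mul, norm_pow]
    exact (summable_geometric_of_lt_one (norm_nonneg t) ht).mul_left _
  have h1 := multipliable_one_add_of_summable hs1
  have key : qPoch t x = (1 - x) * qPoch t (t * x) := by
    unfold qPoch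
    rw [tprod_eq_zero_mul']
    · congr 1
      · simp
      · refine tprod_congr fun n => ?_
        ring
    · refine h1.congr fun n => ?_
      ring
  unfold theta
  rw [key]
  ring

/-! ### The quantum affine algebra at level `c` -/

/-- The entries `a_{ij}` of the Cartan matrix of `sl_N`. -/
abbrev cartan {N : ℕ} (i j : Fin (N - 1)) : ℤ := CartanMatrix.A (N - 1) i j

/-- The Drinfeld generators: `h_i`, `q ^ (± h_i)`, `H_n^i` for `n ≠ 0`, and `e_n^{±, i}`.
A sign `±` is an element of `ℤˣ`. The element `q ^ (± h_i)` is not a polynomial in `h_i` and is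
adjoined as a generator. -/
inductive Gen (N : ℕ) : Type
  | h (i : Fin (N - 1)) : Gen N
  | K (s : ℤˣ) (i : Fin (N - 1)) : Gen N
  | H (i : Fin (N - 1)) (n : ℤ) (hn : n ≠ 0) : Gen N
  | e (s : ℤˣ) (i : Fin (N - 1)) (n : ℤ) : Gen N

/-- The sign `s = ±1` as a real number. -/
abbrev sgn (s : ℤˣ) : ℝ := ((s : ℤ) : ℝ)

/-- The formal exponential `exp S = ∑ S ^ k / k!` of a power series `S` without constant term
(so that `S ^ k` contributes to the coefficient of `X ^ n` only for `k ≤ n`). -/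
def fexp {A : Type*} [Ring A] [Algebra ℂ A] (S : PowerSeries A) : PowerSeries A :=
  PowerSeries.mk fun n =>
    ∑ k ∈ Finset.range (n + 1), ((k.factorial : ℂ)⁻¹) • PowerSeries.coeff n (S ^ k)

/-- `h_i` in the free algebra. -/
def hF {N : ℕ} (i : Fin (N - 1)) : FreeAlgebra ℂ (Gen N) := FreeAlgebra.ι ℂ (Gen.h i)

/-- `q ^ (± h_i)` in the free algebra. -/
def KF {N : ℕ} (s : ℤˣ) (i : Fin (N - 1)) : FreeAlgebra ℂ (Gen N) := FreeAlgebra.ι ℂ (Gen.K s i)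

/-- `H_n^i` in the free algebra (and `0` for `n = 0`, a value that is never used). -/
def HF {N : ℕ} (i : Fin (N - 1)) (n : ℤ) : FreeAlgebra ℂ (Gen N) :=
  if hn : n ≠ 0 then FreeAlgebra.ι ℂ (Gen.H i n hn) else 0

/-- `e_n^{±, i}` in the free algebra. -/
def eF {N : ℕ} (s : ℤˣ) (i : Fin (N - 1)) (n : ℤ) : FreeAlgebra ℂ (Gen N) :=
  FreeAlgebra.ι ℂ (Gen.e s i n)

/-- `∑_n ψ_{±, n}^i z ^ (-n) = q ^ (± h_i) exp (± (q - q⁻¹) ∑_{± n > 0} H_n^i z ^ (-n))`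
as a power series in `z ^ (∓ 1)`. -/
def psiSeriesF {N : ℕ} (η : ℂ) (s : ℤˣ) (i : Fin (N - 1)) :
    PowerSeries (FreeAlgebra ℂ (Gen N)) :=
  PowerSeries.C (KF s i) *
    fexp (PowerSeries.mk fun n : ℕ => if n = 0 then 0 else
      ((sgn s : ℂ) * (qpow η 1 - qpow η (-1))) • HF i ((s : ℤ) * n))

/-- The modes `ψ_{±, n}^i`, `n ∈ ℤ`. -/
def psiF {N : ℕ} (η : ℂ) (s : ℤˣ) (i : Fin (N - 1)) (n : ℤ) : FreeAlgebra ℂ (Gen N) :=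
  if 0 ≤ (s : ℤ) * n then PowerSeries.coeff ((s : ℤ) * n).toNat (psiSeriesF η s i) else 0

/-- `[A, B]_x = A B - x B A`. -/
def qbr {A : Type*} [Ring A] [Algebra ℂ A] (x : ℂ) (a b : A) : A := a * b - x • (b * a)

/-- The defining relations of `U_q(ŝl_N)`, the central element being the real number `c`. -/
inductive Rel (N : ℕ) (η : ℂ) (c : ℝ) :
    FreeAlgebra ℂ (Gen N) → FreeAlgebra ℂ (Gen N) → Prop
  -- `q ^ (h_i)` and `q ^ (- h_i)` are inverse to each other, and the Cartan part is commutative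
  | K_inv (s : ℤˣ) (i : Fin (N - 1)) : Rel N η c (KF s i * KF (-s) i) 1
  | K_K (s t : ℤˣ) (i j : Fin (N - 1)) : Rel N η c (KF s i * KF t j) (KF t j * KF s i)
  | h_h (i j : Fin (N - 1)) : Rel N η c (hF i * hF j) (hF j * hF i)
  | h_K (s : ℤˣ) (i j : Fin (N - 1)) : Rel N η c (hF i * KF s j) (KF s j * hF i)
  -- `[h_i, H_n^j] = 0`, `[h_i, e_n^{±, j}] = ± a_{ij} e_n^{±, j}`, and the same for `q ^ (± h_i)`
  | h_H (i j : Fin (N - 1)) (n : ℤ) : Rel N η c (hF i * HF j n) (HF j n * hF i)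
  | K_H (s : ℤˣ) (i j : Fin (N - 1)) (n : ℤ) : Rel N η c (KF s i * HF j n) (HF j n * KF s i)
  | h_e (s : ℤˣ) (i j : Fin (N - 1)) (n : ℤ) :
      Rel N η c (hF i * eF s j n - eF s j n * hF i)
        (((sgn s * (cartan i j : ℝ) : ℝ) : ℂ) • eF s j n)
  | K_e (s t : ℤˣ) (i j : Fin (N - 1)) (n : ℤ) :
      Rel N η c (KF s i * eF t j n)
        (qpow η (sgn s * sgn t * (cartan i j : ℝ)) • (eF t j n * KF s i))
  -- `[H_n^i, H_m^j] = δ_{n+m,0} [a_{ij} n] [c n] / n`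
  | H_H (i j : Fin (N - 1)) (n m : ℤ) (hn : n ≠ 0) (hm : m ≠ 0) :
      Rel N η c (HF i n * HF j m - HF j m * HF i n)
        (if n + m = 0 then
          algebraMap ℂ _ (qint η ((cartan i j : ℝ) * n) * qint η (c * n) / (n : ℂ)) else 0)
  -- `[H_n^i, e_m^{±, j}] = ± ([a_{ij} n] / n) q ^ (∓ c |n| / 2) e_{n+m}^{±, j}`
  | H_e (s : ℤˣ) (i j : Fin (N - 1)) (n m : ℤ) (hn : n ≠ 0) :
      Rel N η c (HF i n * eF s j m - eF s j m * HF i n)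
        (((sgn s : ℂ) * (qint η ((cartan i j : ℝ) * n) / (n : ℂ)) *
          qpow η (-(sgn s * (c / 2 * |(n : ℝ)|)))) • eF s j (n + m))
  -- `[e_n^{+, i}, e_m^{-, j}]`
  | e_e (i j : Fin (N - 1)) (n m : ℤ) :
      Rel N η c (eF 1 i n * eF (-1) j m - eF (-1) j m * eF 1 i n)
        (if i = j then
          ((qpow η 1 - qpow η (-1))⁻¹) •
            (qpow η (c / 2 * ((n : ℝ) - m)) • psiF η 1 i (n + m) -
              qpow η (-(c / 2 * ((n : ℝ) - m))) • psiF η (-1) i (n + m)) else 0)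
  -- `[e_{n+1}^{±, i}, e_m^{±, j}]_{q ^ (± a_{ij})} + [e_{m+1}^{±, j}, e_n^{±, i}]_{q ^ (± a_{ij})} = 0`
  | e_quad (s : ℤˣ) (i j : Fin (N - 1)) (n m : ℤ) :
      Rel N η c
        (qbr (qpow η (sgn s * (cartan i j : ℝ))) (eF s i (n + 1)) (eF s j m) +
          qbr (qpow η (sgn s * (cartan i j : ℝ))) (eF s j (m + 1)) (eF s i n)) 0
  -- `[e_n^{±, i}, e_m^{±, j}] = 0` for `a_{ij} = 0`
  | e_comm (s : ℤˣ) (i j : Fin (N - 1)) (n m : ℤ) (hij : cartan i j = 0) :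
      Rel N η c (eF s i n * eF s j m) (eF s j m * eF s i n)
  -- the Serre relations, for `a_{ij} = -1`
  | e_serre (s : ℤˣ) (i j : Fin (N - 1)) (n m l : ℤ) (hij : cartan i j = -1) :
      Rel N η c
        (qbr (qpow η (sgn s)) (eF s i n) (qbr (qpow η (-sgn s)) (eF s i m) (eF s j l)) +
          qbr (qpow η (sgn s)) (eF s i m) (qbr (qpow η (-sgn s)) (eF s i n) (eF s j l))) 0

/-- The quantum affine algebra `U_q(ŝl_N)` at level `c`. -/
def Uq (N : ℕ) (η : ℂ) (c : ℝ) : Type := RingQuot (Rel N η c)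

section Uq

variable {N : ℕ} {η : ℂ} {c : ℝ}

instance : Ring (Uq N η c) := inferInstanceAs (Ring (RingQuot (Rel N η c)))

instance : Algebra ℂ (Uq N η c) := inferInstanceAs (Algebra ℂ (RingQuot (Rel N η c)))

/-- The projection of the free algebra onto `U_q(ŝl_N)`. -/
def Uq.proj : FreeAlgebra ℂ (Gen N) →ₐ[ℂ] Uq N η c := RingQuot.mkAlgHom ℂ (Rel N η c)

theorem Uq.proj_surjective : Function.Surjective (Uq.proj (N := N) (η := η) (c := c)) :=
  RingQuot.mkAlgHom_surjective ℂ (Rel N η c)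

/-! ### The completion -/

/-- The degree of the generators: `deg H_n^i = deg e_n^{±, i} = n`, `deg h_i = 0`. -/
def Gen.deg : Gen N → ℤ
  | Gen.h _ => 0
  | Gen.K _ _ => 0
  | Gen.H _ n _ => n
  | Gen.e _ _ n => n

/-- The product of a word in the generators, in `U_q(ŝl_N)`. -/
def word (l : List (Gen N)) : Uq N η c := (l.map fun g => Uq.proj (FreeAlgebra.ι ℂ g)).prod

/-- The degree of a word. -/
def wdeg (l : List (Gen N)) : ℤ := (l.map Gen.deg).sum

/-- The left ideal `I_n` generated by all monomials of degree at least `n`. -/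
def degIdeal (N : ℕ) (η : ℂ) (c : ℝ) (n : ℤ) : Ideal (Uq N η c) :=
  Ideal.span {x | ∃ l : List (Gen N), n ≤ wdeg l ∧ x = word l}

theorem degIdeal_anti {m n : ℤ} (h : m ≤ n) : degIdeal N η c n ≤ degIdeal N η c m := by
  refine Ideal.span_mono ?_
  rintro x ⟨l, hl, rfl⟩
  exact ⟨l, h.trans hl, rfl⟩

theorem degIdeal_mul_right (x : Uq N η c) (n : ℤ) :
    ∃ m : ℤ, ∀ y ∈ degIdeal N η c m, y * x ∈ degIdeal N η c n := by
  obtain ⟨f, rfl⟩ := Uq.proj_surjective x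
  revert n
  induction f using FreeAlgebra.induction with
  | grade0 a =>
    intro n
    refine ⟨n, fun y hy => ?_⟩
    rw [AlgHom.commutes, ← Algebra.commutes]
    exact Ideal.mul_mem_left _ _ hy
  | grade1 g =>
    intro n
    refine ⟨n - g.deg, fun y hy => ?_⟩
    induction hy using Submodule.span_induction with
    | mem y hy =>
      obtain ⟨l, hl, rfl⟩ := hy
      refine Ideal.subset_span ⟨l ++ [g], ?_, ?_⟩
      · simp only [wdeg, List.map_append, List.sum_append, List.map_cons, List.map_nil,
          List.sum_cons, List.sum_nil] at hl ⊢
        omega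
      · simp [word]
    | zero => simp
    | add a b _ _ ha hb => rw [add_mul]; exact Ideal.add_mem _ ha hb
    | smul a b _ hb => rw [smul_eq_mul, mul_assoc]; exact Ideal.mul_mem_left _ _ hb
  | mul a b ha hb =>
    intro n
    obtain ⟨m, hm⟩ := hb n
    obtain ⟨m2, hm2⟩ := ha m
    refine ⟨m2, fun y hy => ?_⟩
    rw [map_mul, ← mul_assoc]
    exact hm _ (hm2 _ hy)
  | add a b ha hb =>
    intro n
    obtain ⟨m, hm⟩ := ha n
    obtain ⟨m2, hm2⟩ := hb n
    refine ⟨max m m2, fun y hy => ?_⟩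
    rw [map_add, mul_add]
    exact Ideal.add_mem _ (hm _ (degIdeal_anti (le_max_left _ _) hy))
      (hm2 _ (degIdeal_anti (le_max_right _ _) hy))

theorem degIdeal_basis :
    RingSubgroupsBasis fun n : ℤ => (degIdeal N η c n).toAddSubgroup where
  inter i j := ⟨max i j, le_inf (degIdeal_anti (le_max_left _ _))
    (degIdeal_anti (le_max_right _ _))⟩
  mul i := ⟨i, by
    rintro _ ⟨a, _, b, hb, rfl⟩
    exact Ideal.mul_mem_left _ _ hb⟩
  leftMul x i := ⟨i, fun _ hb => Ideal.mul_mem_left _ _ hb⟩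
  rightMul x i := (degIdeal_mul_right x i).imp fun _ hm _ hb => hm _ hb

/-- The topology on `U_q(ŝl_N)` in which the left ideals `I_n` are a basis of neighbourhoods
of `0`. -/
instance : TopologicalSpace (Uq N η c) := degIdeal_basis.topology

instance : IsTopologicalRing (Uq N η c) :=
  (degIdeal_basis (N := N) (η := η) (c := c)).toRingFilterBasis.isTopologicalRing

instance : UniformSpace (Uq N η c) := IsTopologicalAddGroup.rightUniformSpace (Uq N η c)

instance : IsUniformAddGroup (Uq N η c) := isUniformAddGroup_of_addCommGroup

instance : ContinuousConstSMul ℂ (Uq N η c) where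
  continuous_const_smul a := by
    simp only [Algebra.smul_def]
    exact continuous_const.mul continuous_id

instance : UniformContinuousConstSMul ℂ (Uq N η c) :=
  uniformContinuousConstSMul_of_continuousConstSMul ℂ (Uq N η c)

end Uq

/-- The completion `lim U_q(ŝl_N) / I_n`, a complete Hausdorff topological algebra over `ℂ`. -/
abbrev UqHat (N : ℕ) (η : ℂ) (c : ℝ) : Type := UniformSpace.Completion (Uq N η c)

/-! ### Currents

A current `X(z) = ∑_{k ∈ ℤ} X k z ^ k` is given by its coefficients. -/

/-- Formal series `X(z) = ∑_{k ∈ ℤ} X k z ^ k` with coefficients in the completed algebra. -/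
abbrev Current (N : ℕ) (η : ℂ) (c : ℝ) : Type := ℤ → UqHat N η c

section Currents

variable {N : ℕ} {η : ℂ} {c : ℝ}

/-- `X(a z)`. -/
def Current.scale (a : ℂ) (X : Current N η c) : Current N η c := fun k => a ^ k • X k

/-- The product `X(z) Y(z)`: the coefficient of `z ^ k` is `∑_a X a * Y (k - a)`, summed in the
completed algebra. -/
def Current.mul (X Y : Current N η c) : Current N η c := fun k => ∑' a : ℤ, X a * Y (k - a)

/-- The series that define the product `X(z) Y(z)` converge. -/
def Current.MulConverges (X Y : Current N η c) : Prop :=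
  ∀ k : ℤ, Summable fun a : ℤ => X a * Y (k - a)

/-- The Drinfeld current `ψ_±^i(z) = ∑_n ψ_{±, n}^i z ^ (-n)`. -/
def psi (s : ℤˣ) (i : Fin (N - 1)) : Current N η c :=
  fun k => ((Uq.proj (psiF η s i (-k)) : Uq N η c) : UqHat N η c)

/-- The Drinfeld current `e^{±, i}(z) = ∑_n e_n^{±, i} z ^ (-n-1)`. -/
def eDrinfeld (s : ℤˣ) (i : Fin (N - 1)) : Current N η c :=
  fun k => ((Uq.proj (eF s i (-k - 1)) : Uq N η c) : UqHat N η c)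

/-- `D_i^+(z; r, r^*) = exp (∑_{n > 0} (1 / [r^* n]) H_{-n}^i q ^ ((r^* + c/2) n) z ^ n)`,
`r^* = r - c`. -/
def Dplus (r : ℝ) (i : Fin (N - 1)) : Current N η c := fun k =>
  if 0 ≤ k then
    ((PowerSeries.coeff k.toNat (fexp (PowerSeries.mk fun n : ℕ => if n = 0 then 0 else
      ((qint η ((r - c) * n))⁻¹ * qpow η ((r - c + c / 2) * n)) •
        (Uq.proj (HF i (-(n : ℤ))) : Uq N η c))) : Uq N η c) : UqHat N η c)
  else 0

/-- `D_i^-(z; r, r^*) = exp (- ∑_{n > 0} (1 / [r n]) H_n^i q ^ ((r - c/2) n) z ^ (-n))`. -/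
def Dminus (r : ℝ) (i : Fin (N - 1)) : Current N η c := fun k =>
  if k ≤ 0 then
    ((PowerSeries.coeff (-k).toNat (fexp (PowerSeries.mk fun n : ℕ => if n = 0 then 0 else
      (-((qint η (r * n))⁻¹ * qpow η ((r - c / 2) * n))) •
        (Uq.proj (HF i (n : ℤ)) : Uq N η c))) : Uq N η c) : UqHat N η c)
  else 0

/-- The dressed currents
`Ψ_i^±(z) = D_i^+(q ^ (± c/2) z; r, r^*) ψ_±^i(z) D_i^-(q ^ (∓ c/2) z; r, r^*)`. -/
def Psi (r : ℝ) (s : ℤˣ) (i : Fin (N - 1)) : Current N η c :=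
  Current.mul (Current.scale (qpow η (sgn s * (c / 2))) (Dplus r i))
    (Current.mul (psi s i) (Current.scale (qpow η (-(sgn s * (c / 2)))) (Dminus r i)))

/-- The dressed current `e_i(z) = D_i^+(z; r, r^*) e^{+, i}(z)`. -/
def eDressed (r : ℝ) (i : Fin (N - 1)) : Current N η c :=
  Current.mul (Dplus r i) (eDrinfeld 1 i)

/-- The dressed current `f_i(z) = e^{-, i}(z) D_i^-(z; r, r^*)`. -/
def fDressed (r : ℝ) (i : Fin (N - 1)) : Current N η c :=
  Current.mul (eDrinfeld (-1) i) (Dminus r i)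

/-- All the series that define the dressed currents converge in the completed algebra. -/
def DressedConverge (N : ℕ) (η : ℂ) (r c : ℝ) : Prop :=
  ∀ i : Fin (N - 1),
    (∀ s : ℤˣ,
      Current.MulConverges (η := η) (c := c) (psi s i)
        (Current.scale (qpow η (-(sgn s * (c / 2)))) (Dminus r i)) ∧
      Current.MulConverges (η := η) (c := c)
        (Current.scale (qpow η (sgn s * (c / 2))) (Dplus r i))
        (Current.mul (psi s i) (Current.scale (qpow η (-(sgn s * (c / 2)))) (Dminus r i)))) ∧
    Current.MulConverges (η := η) (c := c) (Dplus r i) (eDrinfeld 1 i) ∧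
    Current.MulConverges (η := η) (c := c) (eDrinfeld (-1) i) (Dminus r i)

/-! ### Exchange relations -/

/-- The coefficient of `z ^ k w ^ l` in `A(w / z) X(z) Y(w)`, for a formal power series `A`. -/
def seriesMul (A : PowerSeries ℂ) (X Y : Current N η c) (k l : ℤ) : UqHat N η c :=
  ∑' m : ℕ, PowerSeries.coeff m A • (X (k + m) * Y (l - m))

/-- The series of `seriesMul` converge. -/
def SeriesMulConverges (A : PowerSeries ℂ) (X Y : Current N η c) : Prop :=
  ∀ k l : ℤ, Summable fun m : ℕ => PowerSeries.coeff m A • (X (k + m) * Y (l - m))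

/-- The coefficient of `z ^ k w ^ l` in `d(z / w) F(z, w)`, for a polynomial `d` and a formal
series `F(z, w) = ∑ F k l z ^ k w ^ l`. -/
def polyMul (d : Polynomial ℂ) (F : ℤ → ℤ → UqHat N η c) (k l : ℤ) : UqHat N η c :=
  d.sum fun j a => a • F (k - j) (l + j)

/-- The quotient of theta functions
`g(x) = κ ∏_{(t, u) ∈ num} Θ_t(u x) / ∏_{(t, u) ∈ den} Θ_t(u x)`. -/
structure ThetaQuot where
  κ : ℂ
  num : List (ℂ × ℂ)
  den : List (ℂ × ℂ)

/-- The function of `x` that a quotient of theta functions stands for. -/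
def ThetaQuot.eval (g : ThetaQuot) (x : ℂ) : ℂ :=
  g.κ * (g.num.map fun a => theta a.1 (a.2 * x)).prod /
    (g.den.map fun a => theta a.1 (a.2 * x)).prod

/-- The product of the linear factors `(t; t)_∞ (1 - u x)` of the `Θ_t(u x)`. -/
def linPart (L : List (ℂ × ℂ)) : Polynomial ℂ :=
  (L.map fun a => Polynomial.C (qPoch a.1 a.1) * (1 - Polynomial.C a.2 * Polynomial.X)).prod

/-- The product of the factors `(t u x; t)_∞` of the `Θ_t(u x)`, a power series in `x`. -/
def plusPart (L : List (ℂ × ℂ)) : PowerSeries ℂ :=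
  (L.map fun a => qPochSeries a.1 (a.1 * a.2)).prod

/-- The product of the factors `(t u⁻¹ x⁻¹; t)_∞` of the `Θ_t(u x)`, a power series in `x⁻¹`. -/
def minusPart (L : List (ℂ × ℂ)) : PowerSeries ℂ :=
  (L.map fun a => qPochSeries a.1 (a.1 * a.2⁻¹)).prod

/-- Splitting of a product of theta functions into the three kinds of factors. -/
theorem theta_prod_split (L : List (ℂ × ℂ)) (hL : ∀ a ∈ L, ‖a.1‖ < 1) (x : ℂ) :
    (L.map fun a => theta a.1 (a.2 * x)).prod =
      (linPart L).eval x * (L.map fun a => qPoch a.1 (a.1 * a.2 * x)).prod *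
        (L.map fun a => qPoch a.1 (a.1 * a.2⁻¹ * x⁻¹)).prod := by
  induction L with
  | nil => simp [linPart]
  | cons a L ih =>
    have h := ih fun b hb => hL b (List.mem_cons_of_mem _ hb)
    simp only [linPart, List.map_cons, List.prod_cons, Polynomial.eval_mul] at h ⊢
    rw [h, theta_split (hL a (List.mem_cons_self ..)), mul_inv, mul_assoc a.1 a.2⁻¹ x⁻¹,
      mul_assoc a.1 a.2 x]
    simp only [Polynomial.eval_C, Polynomial.eval_sub, Polynomial.eval_one, Polynomial.eval_mul,
      Polynomial.eval_X]
    ring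

/-- The exchange relation `X(z) Y(w) = g(z / w) Y(w) X(z)` between currents, as an identity of
formal series in `z` and `w`. By `Θ_t(u x) = (t; t)_∞ (1 - u x) (t u x; t)_∞ (t u⁻¹ x⁻¹; t)_∞` one
has `g(x) = (n(x) / d(x)) B(x) / A(x⁻¹)`, where `n / d` is the rational function
`κ · linPart num / linPart den` in lowest terms, and `A = minusPart den / minusPart num` and
`B = plusPart num / plusPart den` are power series with constant term `1`. As
`X(z) Y(w)` can be multiplied by power series in `w / z` and `Y(w) X(z)` by power series in
`z / w`, the relation reads
`d(z / w) A(w / z) X(z) Y(w) = n(z / w) B(z / w) Y(w) X(z)`. -/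
def Exchange (g : ThetaQuot) (X Y : Current N η c) : Prop :=
  SeriesMulConverges (minusPart g.den * (minusPart g.num)⁻¹) X Y ∧
  SeriesMulConverges (plusPart g.num * (plusPart g.den)⁻¹) Y X ∧
  ∃ n d : Polynomial ℂ, IsCoprime n d ∧
    n * linPart g.den = d * (Polynomial.C g.κ * linPart g.num) ∧
    ∀ k l : ℤ,
      polyMul d (seriesMul (minusPart g.den * (minusPart g.num)⁻¹) X Y) k l =
        polyMul n (fun k l => seriesMul (plusPart g.num * (plusPart g.den)⁻¹) Y X l k) k l

/-- The coefficient of `z ^ k w ^ l` in `δ(a z / w) X(w)`, where `δ(x) = ∑_{n ∈ ℤ} x ^ n`. -/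
def deltaMul (a : ℂ) (X : Current N η c) (k l : ℤ) : UqHat N η c := a ^ k • X (k + l)

/-! ### Serre relations -/

/-- The terms of the coefficient of `z₁ ^ k₁ z₂ ^ k₂ z₃ ^ k₃` in
`A(z₂ / z₁) B(z₃ / z₁) C(z₃ / z₂) X(z₁) Y(z₂) Z(z₃)`. -/
def tripleTerm (A B C : PowerSeries ℂ) (X Y Z : Current N η c) (k₁ k₂ k₃ : ℤ)
    (m : ℕ × ℕ × ℕ) : UqHat N η c :=
  (PowerSeries.coeff m.1 A * PowerSeries.coeff m.2.1 B * PowerSeries.coeff m.2.2 C) •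
    (X (k₁ + m.1 + m.2.1) * Y (k₂ - m.1 + m.2.2) * Z (k₃ - m.2.1 - m.2.2))

/-- The coefficient of `z₁ ^ k₁ z₂ ^ k₂ z₃ ^ k₃` in
`A(z₂ / z₁) B(z₃ / z₁) C(z₃ / z₂) X(z₁) Y(z₂) Z(z₃)`. -/
def tripleMul (A B C : PowerSeries ℂ) (X Y Z : Current N η c) (k₁ k₂ k₃ : ℤ) : UqHat N η c :=
  ∑' m : ℕ × ℕ × ℕ, tripleTerm A B C X Y Z k₁ k₂ k₃ m

/-- The series of `tripleMul` converge. -/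
def TripleMulConverges (A B C : PowerSeries ℂ) (X Y Z : Current N η c) : Prop :=
  ∀ k₁ k₂ k₃ : ℤ, Summable (tripleTerm A B C X Y Z k₁ k₂ k₃)

/-- The coefficient of `z₁ ^ k₁ z₂ ^ k₂ w ^ l` in the formal series
`β(z₂/z₁) { α(z₁/w)⁻¹ α(z₂/w)⁻¹ Y(w) X(z₁) X(z₂) - [2] α(w/z₁)⁻¹ α(z₂/w)⁻¹ X(z₁) Y(w) X(z₂)
  + α(w/z₁)⁻¹ α(w/z₂)⁻¹ X(z₁) X(z₂) Y(w) }`. -/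
def serreHalf (α β : PowerSeries ℂ) (X Y : Current N η c) (k₁ k₂ l : ℤ) : UqHat N η c :=
  tripleMul α⁻¹ α⁻¹ β Y X X l k₁ k₂ -
    qint η 2 • tripleMul α⁻¹ β α⁻¹ X Y X k₁ l k₂ +
    tripleMul β α⁻¹ α⁻¹ X X Y k₁ k₂ l

/-- The Serre-type relation
`β(z₂/z₁) { Y(w) X(z₁) X(z₂) - [2] (α(z₁/w) / α(w/z₁)) X(z₁) Y(w) X(z₂)
  + (α(z₁/w) / α(w/z₁)) (α(z₂/w) / α(w/z₂)) X(z₁) X(z₂) Y(w) } + (z₁ ↔ z₂) = 0`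
as an identity of formal series: the common symmetric factor `α(z₁/w) α(z₂/w)` is divided out, so
that every product of three currents is multiplied by power series in the ratios
(argument of a later current) / (argument of an earlier current). -/
def SerreRelation (α β : PowerSeries ℂ) (X Y : Current N η c) : Prop :=
  TripleMulConverges α⁻¹ α⁻¹ β Y X X ∧
  TripleMulConverges α⁻¹ β α⁻¹ X Y X ∧
  TripleMulConverges β α⁻¹ α⁻¹ X X Y ∧
  ∀ k₁ k₂ l : ℤ, serreHalf α β X Y k₁ k₂ l + serreHalf α β X Y k₂ k₁ l = 0

end Currents

end EllipticSlN

end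

open EllipticSlN

open scoped PowerSeries.WithPiTopology

noncomputable section

namespace EllipticSlN

open Finset.HasAntidiagonal (antidiagonal mem_antidiagonal sigmaAntidiagonalEquivProd)

/-! Every dressed current has the shape exp(creation part) · X(z) · exp(annihilation part). The
exponents are combinations of Heisenberg modes H_n of a single node. The bare current X is e^{+,i},
e^{-,i} or the constant q^{±h_i}, and [H_n, X(z)] is a scalar times z^n X(z). For Ψ this works
because ψ_± is itself q^{±h_i} times an exponential in the H_n, whose exponents merge with those of
D^± (`Psi_eq`).

In a product of two dressed currents, moving all creation exponentials to the left and all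
annihilation exponentials to the right costs one scalar power series in w/z, the contraction
(`IsHeisenberg.dressed_mul`). Its logarithm is an explicit quotient of q-integers. The logarithm of
(uX; t)_∞ is -∑ u^n X^n / (n (1 - t^n)), and comparing the two shows that the contractions in the
two orders cancel the infinite products of the theta functions, up to at most a rational factor
(`qPochSeries_div`, `thetaLog_sub`). What remains is a relation between the bare currents whose
coefficients are linear in z/w. It is a Drinfeld relation, and it passes through the dressing
coefficient by coefficient (`IsHeisenberg.normalOrder_exchange`, `exchange_of_core`).

For e_i and f_j both contractions equal 1. The commutator is therefore the dressing of the Drinfeld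
commutator, and on the support of each delta function D^+(z) and D^-(w) become the two dressings of
Ψ (`commutator_dressed`). In the Serre relations the prefactors are exactly the inverses of the
pairwise contractions, so the relation reduces to a dressing of the Drinfeld Serre relation
(`serre_lop`, `serre_rop`).

Convergence rests on the topology being given by left ideals: a family is summable as soon as its
terms tend to 0, and arbitrary left multipliers do no harm. Coefficients of a bare current tend to 0
as the exponent of z tends to -∞, so power series in z can act on it from the left. Annihilation
exponentials have coefficients tending to 0 and can act from the right on anything. Products of two
or three currents decay along a cone whose elements have only finitely many decompositions, which
justifies every rearrangement (`adm_coneTwo_mul`, `Salient.tendsto_add`). -/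

/-- The Euler derivation `X d/dX` of a ring of power series. -/
def eulerD {A : Type*} [Ring A] (f : PowerSeries A) : PowerSeries A :=
  PowerSeries.mk fun n => (n : A) * PowerSeries.coeff n f

/-! ### Formal exponentials and the Euler derivation -/

section Euler

variable {A : Type*} [Ring A]

@[simp]
theorem coeff_eulerD (f : PowerSeries A) (n : ℕ) :
    PowerSeries.coeff n (eulerD f) = (n : A) * PowerSeries.coeff n f := by
  simp [eulerD]

theorem eulerD_add (f g : PowerSeries A) : eulerD (f + g) = eulerD f + eulerD g := by
  ext n; simp [mul_add]

theorem eulerD_sub (f g : PowerSeries A) : eulerD (f - g) = eulerD f - eulerD g := by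
  ext n; simp [mul_sub]

theorem eulerD_mul (f g : PowerSeries A) : eulerD (f * g) = eulerD f * g + f * eulerD g := by
  ext n
  simp only [coeff_eulerD, map_add, PowerSeries.coeff_mul, Finset.mul_sum, ← Finset.sum_add_distrib]
  refine Finset.sum_congr rfl fun p hp => ?_
  rw [← mem_antidiagonal.mp hp, (Nat.cast_commute p.2 (PowerSeries.coeff p.1 f)).symm.left_comm,
    Nat.cast_add]
  noncomm_ring

@[simp]
theorem eulerD_C (a : A) : eulerD (PowerSeries.C a) = 0 := by
  ext n
  rcases Nat.eq_zero_or_pos n with rfl | h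
  · simp
  · simp [PowerSeries.coeff_C, h.ne']

@[simp]
theorem eulerD_one : eulerD (1 : PowerSeries A) = 0 := by
  simpa using eulerD_C (1 : A)

theorem eulerD_pow {S : PowerSeries A} (h : Commute (eulerD S) S) (k : ℕ) :
    eulerD (S ^ (k + 1)) = ((k + 1 : ℕ) : PowerSeries A) * (eulerD S * S ^ k) := by
  induction k with
  | zero => simp
  | succ k ih =>
    rw [pow_succ, eulerD_mul, ih, ← (h.pow_right (k + 1)).eq, mul_assoc, mul_assoc, ← pow_succ]
    push_cast
    noncomm_ring

theorem coeff_pow_eq_zero {S : PowerSeries A} (h0 : PowerSeries.coeff 0 S = 0) {n k : ℕ}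
    (h : n < k) : PowerSeries.coeff n (S ^ k) = 0 := by
  induction k generalizing n with
  | zero => omega
  | succ k ih =>
    rw [pow_succ, PowerSeries.coeff_mul]
    refine Finset.sum_eq_zero fun p hp => ?_
    have := mem_antidiagonal.mp hp
    rcases Nat.eq_zero_or_pos p.2 with h3 | h3
    · rw [h3, h0, mul_zero]
    · rw [ih (by omega), zero_mul]

theorem sum_antidiagonal_assoc (f : ℕ → ℕ → ℕ → A) (n : ℕ) :
    ∑ p ∈ antidiagonal n, ∑ q ∈ antidiagonal p.2, f p.1 q.1 q.2 =
      ∑ p ∈ antidiagonal n, ∑ q ∈ antidiagonal p.1, f q.1 q.2 p.2 := by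
  rw [Finset.sum_sigma', Finset.sum_sigma']
  refine Finset.sum_nbij' (fun x => ⟨(x.1.1 + x.2.1, x.2.2), (x.1.1, x.2.1)⟩)
    (fun x => ⟨(x.2.1, x.2.2 + x.1.2), (x.2.2, x.1.2)⟩) ?_ ?_ ?_ ?_ (fun _ _ => rfl) <;>
  · rintro ⟨⟨a, b⟩, ⟨c, d⟩⟩ h
    simp only [Finset.mem_sigma, mem_antidiagonal] at h ⊢
    obtain ⟨h1, h2⟩ := h
    subst h1 h2
    simp [add_assoc]

/-- Power series all of whose coefficients commute. -/
theorem commute_of_coeff {S T : PowerSeries A}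
    (h : ∀ m n, Commute (PowerSeries.coeff m S) (PowerSeries.coeff n T)) : Commute S T := by
  ext n
  rw [PowerSeries.coeff_mul, PowerSeries.coeff_mul, ← Finset.Nat.sum_antidiagonal_swap]
  exact Finset.sum_congr rfl fun p _ => h _ _

theorem commute_coeff_mul {a : A} {S T : PowerSeries A}
    (hS : ∀ n, Commute a (PowerSeries.coeff n S)) (hT : ∀ n, Commute a (PowerSeries.coeff n T))
    (n : ℕ) : Commute a (PowerSeries.coeff n (S * T)) := by
  rw [PowerSeries.coeff_mul]
  exact Commute.sum_right _ _ _ fun p _ => (hS _).mul_right (hT _)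

/-- The series `∑_{n > 0} s n X ^ n`. -/
def posSeries (s : ℕ → A) : PowerSeries A := PowerSeries.mk fun n => if n = 0 then 0 else s n

@[simp]
theorem coeff_posSeries (s : ℕ → A) (n : ℕ) :
    PowerSeries.coeff n (posSeries s) = if n = 0 then 0 else s n := by
  simp [posSeries]

theorem commute_posSeries {s t : ℕ → A} (h : ∀ m n, m ≠ 0 → n ≠ 0 → Commute (s m) (t n))
    (m n : ℕ) :
    Commute (PowerSeries.coeff m (posSeries s)) (PowerSeries.coeff n (posSeries t)) := by
  simp only [coeff_posSeries]
  split_ifs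
  · exact Commute.zero_left _
  · exact Commute.zero_left _
  · exact Commute.zero_right _
  · exact h _ _ ‹_› ‹_›

variable [Algebra ℂ A]

/-- A solution of `X Y' = L Y` is determined by its constant term if `L` has none. -/
theorem eq_zero_of_eulerD {L Y : PowerSeries A} (hL : PowerSeries.coeff 0 L = 0)
    (h : eulerD Y = L * Y) (h0 : PowerSeries.coeff 0 Y = 0) : Y = 0 := by
  ext n
  induction n using Nat.strong_induction_on with
  | _ n ih =>
    rcases Nat.eq_zero_or_pos n with rfl | hn
    · simpa using h0
    have h1 := congrArg (PowerSeries.coeff n) h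
    rw [coeff_eulerD, PowerSeries.coeff_mul, Finset.sum_eq_zero] at h1
    · have h2 : ((n : ℂ)⁻¹) • ((n : A) * PowerSeries.coeff n Y) = PowerSeries.coeff n Y := by
        rw [← smul_mul_assoc, ← map_natCast (algebraMap ℂ A), Algebra.smul_def, ← map_mul,
          inv_mul_cancel₀ (by exact_mod_cast hn.ne'), map_one, one_mul]
      rw [← h2, h1]; simp
    · intro p hp
      -- The term with `p.1 = 0` dies because `L` has no constant term; every other term involves a
      -- lower coefficient of `Y`, which vanishes by induction.
      have := mem_antidiagonal.mp hp
      rcases Nat.eq_zero_or_pos p.1 with h3 | h3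
      · rw [h3, hL, zero_mul]
      · rw [ih p.2 (by omega)]; simp

/-- The difference solves the same homogeneous first order equation with zero initial value. This is
how formal exponentials are identified below without expanding them. -/
theorem eq_of_eulerD {L Y Z : PowerSeries A} (hL : PowerSeries.coeff 0 L = 0)
    (hY : eulerD Y = L * Y) (hZ : eulerD Z = L * Z)
    (h0 : PowerSeries.coeff 0 Y = PowerSeries.coeff 0 Z) : Y = Z := by
  rw [← sub_eq_zero]
  refine eq_zero_of_eulerD hL ?_ ?_
  · rw [eulerD_sub, hY, hZ, mul_sub]
  · rw [map_sub, h0, sub_self]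

/-- High powers of `S` do not reach degree `n`, so the truncation point in the definition may be
raised at will. This allows exponential sums of different lengths to be compared. -/
theorem coeff_fexp {S : PowerSeries A} (h0 : PowerSeries.coeff 0 S = 0) {n N : ℕ} (h : n < N) :
    PowerSeries.coeff n (fexp S) =
      ∑ k ∈ Finset.range N, ((k.factorial : ℂ)⁻¹) • PowerSeries.coeff n (S ^ k) := by
  rw [fexp, PowerSeries.coeff_mk]
  refine Finset.sum_subset (by simpa using h) fun k _ hk => ?_
  rw [coeff_pow_eq_zero h0 (by simpa using hk), smul_zero]

@[simp]
theorem coeff_zero_fexp (S : PowerSeries A) : PowerSeries.coeff 0 (fexp S) = 1 := by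
  simp [fexp]

/-- Since `S` commutes with its derivative, the derivative of `S ^ (k + 1)` is `k + 1` times `eulerD
S * S ^ k`, and the factor `k + 1` turns 1/(k+1)! into 1/k!. -/
theorem eulerD_fexp {S : PowerSeries A} (h0 : PowerSeries.coeff 0 S = 0)
    (hS : Commute (eulerD S) S) : eulerD (fexp S) = eulerD S * fexp S := by
  ext n
  rw [coeff_eulerD, coeff_fexp h0 (show n < n + 2 by omega), Finset.mul_sum,
    Finset.sum_range_succ', PowerSeries.coeff_mul]
  have h1 : ∀ k : ℕ, (n : A) * ((((k + 1).factorial : ℂ)⁻¹) • PowerSeries.coeff n (S ^ (k + 1))) =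
      ((k.factorial : ℂ)⁻¹) • PowerSeries.coeff n (eulerD S * S ^ k) := by
    intro k
    rw [mul_smul_comm, ← coeff_eulerD, eulerD_pow hS, ← nsmul_eq_mul, map_nsmul,
      ← Nat.cast_smul_eq_nsmul ℂ, smul_smul, Nat.factorial_succ]
    congr 1
    have : ((k : ℂ) + 1) ≠ 0 := by exact_mod_cast Nat.succ_ne_zero k
    push_cast
    field_simp
  simp only [h1]
  have h2 : (n : A) * (((Nat.factorial 0 : ℂ)⁻¹) • PowerSeries.coeff n (S ^ 0)) = 0 := by
    rw [mul_smul_comm, ← coeff_eulerD]; simp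
  rw [h2, add_zero]
  simp only [PowerSeries.coeff_mul, Finset.smul_sum]
  rw [Finset.sum_comm]
  refine Finset.sum_congr rfl fun p hp => ?_
  have := mem_antidiagonal.mp hp
  rw [coeff_fexp h0 (show p.2 < n + 1 by omega), Finset.mul_sum]
  simp only [mul_smul_comm]

theorem map_fexp {B : Type*} [Ring B] [Algebra ℂ B] (f : A →ₐ[ℂ] B) (S : PowerSeries A) :
    PowerSeries.map (f : A →+* B) (fexp S) = fexp (PowerSeries.map (f : A →+* B) S) := by
  ext n
  simp only [fexp, PowerSeries.coeff_map, PowerSeries.coeff_mk, ← map_pow, RingHom.coe_coe,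
    map_sum, map_smul]

theorem commute_coeff_fexp {a : A} {S : PowerSeries A}
    (h : ∀ n, Commute a (PowerSeries.coeff n S)) (n : ℕ) :
    Commute a (PowerSeries.coeff n (fexp S)) := by
  have hpow : ∀ k n, Commute a (PowerSeries.coeff n (S ^ k)) := by
    intro k
    induction k with
    | zero => intro n; rw [pow_zero, PowerSeries.coeff_one]; split_ifs <;> simp
    | succ k ih => intro n; rw [pow_succ]; exact commute_coeff_mul ih h n
  rw [fexp, PowerSeries.coeff_mk]
  exact Commute.sum_right _ _ _ fun k _ => (hpow k n).smul_right _

/-- `exp (∑_{n > 0} s n X ^ n)`. -/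
def expSeries (s : ℕ → A) : PowerSeries A := fexp (posSeries s)

@[simp]
theorem coeff_zero_expSeries (s : ℕ → A) : PowerSeries.coeff 0 (expSeries s) = 1 :=
  coeff_zero_fexp _

theorem eulerD_expSeries {s : ℕ → A} (h : ∀ m n, m ≠ 0 → n ≠ 0 → Commute (s m) (s n)) :
    eulerD (expSeries s) = eulerD (posSeries s) * expSeries s := by
  refine eulerD_fexp (by simp) (commute_of_coeff fun m n => ?_)
  rw [coeff_eulerD]
  exact (Nat.cast_commute _ _).mul_left (commute_posSeries h m n)

theorem commute_expSeries {s t : ℕ → A} (h : ∀ m n, m ≠ 0 → n ≠ 0 → Commute (s m) (t n))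
    (m n : ℕ) :
    Commute (PowerSeries.coeff m (expSeries s)) (PowerSeries.coeff n (expSeries t)) :=
  commute_coeff_fexp (fun n =>
    (commute_coeff_fexp (fun m => (commute_posSeries h m n).symm) m).symm) n

theorem commute_coeff_expSeries {a : A} {s : ℕ → A} (h : ∀ n, n ≠ 0 → Commute a (s n)) (n : ℕ) :
    Commute a (PowerSeries.coeff n (expSeries s)) := by
  refine commute_coeff_fexp (fun n => ?_) n
  rw [coeff_posSeries]
  split_ifs with h0
  · exact Commute.zero_right _
  · exact h n h0

/-- Both sides have constant term 1 and solve the Euler equation whose coefficient is the derivative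
of the sum of the exponents; commutativity lets the second logarithmic derivative pass the first
exponential. -/
theorem expSeries_mul {s t : ℕ → A} (hs : ∀ m n, m ≠ 0 → n ≠ 0 → Commute (s m) (s n))
    (ht : ∀ m n, m ≠ 0 → n ≠ 0 → Commute (t m) (t n))
    (hst : ∀ m n, m ≠ 0 → n ≠ 0 → Commute (s m) (t n)) :
    expSeries s * expSeries t = expSeries (fun n => s n + t n) := by
  have hadd : posSeries (fun n => s n + t n) = posSeries s + posSeries t := by
    ext n; simp only [coeff_posSeries, map_add]; split_ifs <;> simp
  have hsum : ∀ m n, m ≠ 0 → n ≠ 0 → Commute (s m + t m) (s n + t n) := fun m n hm hn =>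
    ((hs m n hm hn).add_left (hst n m hn hm).symm).add_right
      ((hst m n hm hn).add_left (ht m n hm hn))
  refine eq_of_eulerD (L := eulerD (posSeries fun n => s n + t n)) (by simp) ?_
    (eulerD_expSeries hsum) (by simp [PowerSeries.coeff_mul])
  have hc : Commute (expSeries s) (eulerD (posSeries t)) := commute_of_coeff fun m n => by
    rw [coeff_eulerD]
    refine (Nat.cast_commute _ _).symm.mul_right ?_
    refine (commute_coeff_fexp (fun m => (commute_posSeries hst m n).symm) m).symm
  rw [eulerD_mul, eulerD_expSeries hs, eulerD_expSeries ht, hadd, eulerD_add, ← mul_assoc, hc.eq]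
  noncomm_ring

/-- The derivation `[x, ·]` acts on an exponential by a shift if it acts by a scalar on one of
the exponents and by zero on the others. -/
theorem commutator_expSeries {s : ℕ → A} (h : ∀ m n, m ≠ 0 → n ≠ 0 → Commute (s m) (s n))
    {x : A} {κ : ℂ} {p : ℕ} (hp : p ≠ 0)
    (hx : ∀ n, n ≠ 0 → x * s n - s n * x = if n = p then algebraMap ℂ A κ else 0) :
    PowerSeries.C x * expSeries s - expSeries s * PowerSeries.C x =
      PowerSeries.C (algebraMap ℂ A κ) * PowerSeries.X ^ p * expSeries s := by
  set E := expSeries s with hE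
  set L := eulerD (posSeries s) with hL
  have hθE : eulerD E = L * E := eulerD_expSeries h
  have hθX : eulerD (PowerSeries.X ^ p : PowerSeries A) = (p : PowerSeries A) * PowerSeries.X ^ p := by
    ext n
    rw [← nsmul_eq_mul, map_nsmul, nsmul_eq_mul, coeff_eulerD, PowerSeries.coeff_X_pow]
    split_ifs with h1
    · rw [h1]
    · simp
  have hcL : PowerSeries.C x * L - L * PowerSeries.C x =
      (p : PowerSeries A) * (PowerSeries.C (algebraMap ℂ A κ) * PowerSeries.X ^ p) := by
    ext n
    rw [← nsmul_eq_mul, map_nsmul, nsmul_eq_mul, map_sub, PowerSeries.coeff_C_mul,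
      PowerSeries.coeff_mul_C, PowerSeries.coeff_C_mul, PowerSeries.coeff_X_pow, hL, coeff_eulerD,
      (Nat.cast_commute n x).symm.left_comm, mul_assoc, ← mul_sub, coeff_posSeries]
    rcases Nat.eq_zero_or_pos n with rfl | hn
    · simp [hp.symm]
    · rw [if_neg hn.ne', hx n hn.ne']
      split_ifs with h1
      · rw [h1, mul_one]
      · simp
  have hκ : ∀ T : PowerSeries A, Commute (PowerSeries.C (algebraMap ℂ A κ) * PowerSeries.X ^ p) T := by
    intro T
    refine Commute.mul_left (commute_of_coeff fun m n => ?_) (PowerSeries.commute_X_pow T p).symm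
    rw [PowerSeries.coeff_C]
    split_ifs
    · exact Algebra.commutes _ _
    · exact Commute.zero_left _
  -- The bracket [x, E] satisfies the equation of E with the extra source [x, L] E = p κ X^p E, and
  -- κ X^p E has the same source by the product rule. So their difference solves the homogeneous
  -- equation. It has no constant term because `p ≠ 0`.
  rw [← sub_eq_zero]
  refine eq_zero_of_eulerD (L := L) (by simp [hL]) ?_ ?_
  · have e1 : PowerSeries.C x * (L * E) = L * (PowerSeries.C x * E) +
        (p : PowerSeries A) * (PowerSeries.C (algebraMap ℂ A κ) * PowerSeries.X ^ p) * E := by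
      rw [← hcL]; noncomm_ring
    have e2 : (PowerSeries.C (algebraMap ℂ A κ) * PowerSeries.X ^ p) * (L * E) =
        L * (PowerSeries.C (algebraMap ℂ A κ) * PowerSeries.X ^ p * E) := by
      rw [← mul_assoc, (hκ L).eq, mul_assoc]
    have e3 : PowerSeries.C (algebraMap ℂ A κ) * ((p : PowerSeries A) * PowerSeries.X ^ p) =
        (p : PowerSeries A) * (PowerSeries.C (algebraMap ℂ A κ) * PowerSeries.X ^ p) :=
      (Nat.cast_commute p _).symm.left_comm _
    rw [eulerD_sub, eulerD_sub, eulerD_mul, eulerD_mul, eulerD_mul, eulerD_mul, eulerD_C, eulerD_C,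
      hθX, hθE, e1, zero_mul, zero_add, zero_mul, zero_add, e3, e2]
    noncomm_ring
  · have h0 : PowerSeries.constantCoeff E = 1 := by
      rw [← PowerSeries.coeff_zero_eq_constantCoeff_apply, hE, coeff_zero_expSeries]
    simp [h0, hp]

/-- A family `X` on which the exponents act by shifts is moved to the right past an exponential. -/
theorem mul_coeff_expSeries {Γ : Type*} [AddCommMonoid Γ] {s : ℕ → A}
    (h : ∀ m n, m ≠ 0 → n ≠ 0 → Commute (s m) (s n)) {X : Γ → A} {w : Γ} {χ : ℕ → ℂ}
    (hX : ∀ n, n ≠ 0 → ∀ k, s n * X k - X k * s n = χ n • X (k + n • w)) (n : ℕ) (k : Γ) :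
    X k * PowerSeries.coeff n (expSeries s) =
      ∑ p ∈ antidiagonal n, PowerSeries.coeff p.2 (expSeries fun n => -χ n) •
        (PowerSeries.coeff p.1 (expSeries s) * X (k + p.2 • w)) := by
  set E := expSeries s
  set g : PowerSeries ℂ := expSeries fun n => -χ n with hg
  have hE : ∀ n : ℕ, (n : ℂ) • PowerSeries.coeff n E = ∑ p ∈ antidiagonal n,
      (p.1 : ℂ) • (PowerSeries.coeff p.1 (posSeries s) * PowerSeries.coeff p.2 E) := fun n => by
    have := congrArg (PowerSeries.coeff n) (eulerD_expSeries h)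
    simpa only [coeff_eulerD, PowerSeries.coeff_mul, ← nsmul_eq_mul, ← Nat.cast_smul_eq_nsmul ℂ,
      smul_mul_assoc] using this
  have hg : ∀ n : ℕ, (n : ℂ) * PowerSeries.coeff n g = -∑ p ∈ antidiagonal n,
      (p.1 : ℂ) * (PowerSeries.coeff p.1 (posSeries χ) * PowerSeries.coeff p.2 g) := fun n => by
    have := congrArg (PowerSeries.coeff n)
      (eulerD_expSeries (s := fun n => -χ n) fun _ _ _ _ => Commute.all _ _)
    rw [coeff_eulerD, PowerSeries.coeff_mul] at this
    rw [hg, this, ← Finset.sum_neg_distrib]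
    refine Finset.sum_congr rfl fun p _ => ?_
    simp only [coeff_eulerD, coeff_posSeries]
    split_ifs <;> ring
  have hX' : ∀ m k, X k * PowerSeries.coeff m (posSeries s) =
      PowerSeries.coeff m (posSeries s) * X k - PowerSeries.coeff m (posSeries χ) • X (k + m • w) := by
    intro m k
    simp only [coeff_posSeries]
    split_ifs with hm
    · simp
    · rw [← hX m hm k]; noncomm_ring
  -- Both exponentials satisfy Euler recursions. Expanding n E_n, moving X past each exponent and
  -- using the induction hypothesis gives two triple sums (`e1`). Regrouped by associativity, the
  -- inner sum of one is the recursion of `E` (`e3`), that of the other the recursion of `g` (`e2`).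
  -- The resulting factors p.1 and p.2 add up to n.
  induction n using Nat.strong_induction_on generalizing k with
  | _ n ih =>
    rcases Nat.eq_zero_or_pos n with rfl | hn
    · simp [E, g]
    have hn' : (n : ℂ) ≠ 0 := by exact_mod_cast hn.ne'
    refine smul_right_injective A hn' ?_
    have e1 : (n : ℂ) • (X k * PowerSeries.coeff n E) =
        (∑ p ∈ antidiagonal n, ∑ q ∈ antidiagonal p.2, ((p.1 : ℂ) * PowerSeries.coeff q.2 g) •
          (PowerSeries.coeff p.1 (posSeries s) * PowerSeries.coeff q.1 E * X (k + q.2 • w))) -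
        ∑ p ∈ antidiagonal n, ∑ q ∈ antidiagonal p.2,
          ((p.1 : ℂ) * (PowerSeries.coeff p.1 (posSeries χ) * PowerSeries.coeff q.1 g)) •
          (PowerSeries.coeff q.2 E * X (k + (p.1 + q.1) • w)) := by
      rw [← mul_smul_comm, hE, Finset.mul_sum, ← Finset.sum_sub_distrib]
      refine Finset.sum_congr rfl fun p hp => ?_
      have hpn := mem_antidiagonal.mp hp
      rcases Nat.eq_zero_or_pos p.1 with h0 | h0
      · simp [h0]
      rw [← Finset.Nat.sum_antidiagonal_swap (n := p.2) (f := fun q : ℕ × ℕ =>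
        ((p.1 : ℂ) * (PowerSeries.coeff p.1 (posSeries χ) * PowerSeries.coeff q.1 g)) •
          (PowerSeries.coeff q.2 E * X (k + (p.1 + q.1) • w)))]
      rw [mul_smul_comm, ← mul_assoc, hX', sub_mul, mul_assoc, ih p.2 (by omega), smul_mul_assoc,
        ih p.2 (by omega), Finset.mul_sum, smul_sub, Finset.smul_sum, Finset.smul_sum,
        Finset.smul_sum]
      congr 1
      · refine Finset.sum_congr rfl fun q _ => ?_
        rw [mul_smul_comm, smul_smul, mul_assoc]
      · refine Finset.sum_congr rfl fun q _ => ?_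
        simp only [Prod.fst_swap, Prod.snd_swap]
        rw [smul_smul, smul_smul, add_smul, add_assoc, mul_assoc]
    have e2 : ∀ J a : ℕ, ∑ q ∈ antidiagonal J,
        ((q.1 : ℂ) * (PowerSeries.coeff q.1 (posSeries χ) * PowerSeries.coeff q.2 g)) •
          (PowerSeries.coeff a E * X (k + (q.1 + q.2) • w)) =
        -(((J : ℂ) * PowerSeries.coeff J g) • (PowerSeries.coeff a E * X (k + J • w))) := by
      intro J a
      rw [hg, neg_smul, neg_neg, Finset.sum_smul]
      refine Finset.sum_congr rfl fun q hq => ?_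
      rw [mem_antidiagonal.mp hq]
    have e3 : ∀ b j : ℕ, ∑ q ∈ antidiagonal b, ((q.1 : ℂ) * PowerSeries.coeff j g) •
          (PowerSeries.coeff q.1 (posSeries s) * PowerSeries.coeff q.2 E * X (k + j • w)) =
        ((b : ℂ) * PowerSeries.coeff j g) • (PowerSeries.coeff b E * X (k + j • w)) := by
      intro b j
      rw [mul_comm, ← smul_smul, ← smul_mul_assoc, hE, Finset.sum_mul, Finset.smul_sum]
      refine Finset.sum_congr rfl fun q hq => ?_
      rw [mul_comm, ← smul_smul, smul_mul_assoc]
    simp only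
    rw [e1, sum_antidiagonal_assoc (fun m a j => ((m : ℂ) * PowerSeries.coeff j g) •
          (PowerSeries.coeff m (posSeries s) * PowerSeries.coeff a E * X (k + j • w))),
      sum_antidiagonal_assoc (fun m j a =>
        ((m : ℂ) * (PowerSeries.coeff m (posSeries χ) * PowerSeries.coeff j g)) •
          (PowerSeries.coeff a E * X (k + (m + j) • w)))]
    simp only [e2, e3]
    rw [← Finset.Nat.sum_antidiagonal_swap (n := n) (f := fun p : ℕ × ℕ =>
      -(((p.1 : ℂ) * PowerSeries.coeff p.1 g) • (PowerSeries.coeff p.2 E * X (k + p.1 • w)))),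
      ← Finset.sum_sub_distrib, Finset.smul_sum]
    refine Finset.sum_congr rfl fun p hp => ?_
    simp only [Prod.fst_swap, Prod.snd_swap]
    rw [sub_neg_eq_add, ← add_smul, smul_smul, ← mem_antidiagonal.mp hp]
    push_cast
    ring_nf

/-- An exponential is moved to the right past a family `X` on which its exponents act by shifts. -/
theorem coeff_expSeries_mul {Γ : Type*} [AddCommMonoid Γ] {s : ℕ → A}
    (h : ∀ m n, m ≠ 0 → n ≠ 0 → Commute (s m) (s n)) {X : Γ → A} {w : Γ} {χ : ℕ → ℂ}
    (hX : ∀ n, n ≠ 0 → ∀ k, s n * X k - X k * s n = χ n • X (k + n • w)) (n : ℕ) (k : Γ) :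
    PowerSeries.coeff n (expSeries s) * X k =
      ∑ p ∈ antidiagonal n, PowerSeries.coeff p.2 (expSeries χ) •
        (X (k + p.2 • w) * PowerSeries.coeff p.1 (expSeries s)) := by
  -- The formula for moving X to the right past the exponential has the coefficients of exp(-χ);
  -- convolving it with exp(χ) inverts it.
  have hinv : expSeries (fun n => -χ n) * expSeries χ = 1 := by
    rw [expSeries_mul (fun _ _ _ _ => Commute.all _ _) (fun _ _ _ _ => Commute.all _ _)
      fun _ _ _ _ => Commute.all _ _]
    refine eq_of_eulerD (L := 0) (by simp) ?_ (by simp) (by simp)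
    rw [eulerD_expSeries fun _ _ _ _ => Commute.all _ _]
    have : posSeries (fun n => -χ n + χ n) = 0 := by ext n; simp
    rw [this]; ext n; rw [PowerSeries.coeff_mul]; simp
  have e1 : ∀ J a : ℕ, ∑ q ∈ antidiagonal J,
      (PowerSeries.coeff q.1 (expSeries χ) * PowerSeries.coeff q.2 (expSeries fun n => -χ n)) •
        (PowerSeries.coeff a (expSeries s) * X (k + (q.1 + q.2) • w)) =
      if J = 0 then PowerSeries.coeff a (expSeries s) * X k else 0 := by
    intro J a
    have : ∑ q ∈ antidiagonal J,
        (PowerSeries.coeff q.1 (expSeries χ) * PowerSeries.coeff q.2 (expSeries fun n => -χ n)) •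
          (PowerSeries.coeff a (expSeries s) * X (k + (q.1 + q.2) • w)) =
        PowerSeries.coeff J (expSeries (fun n => -χ n) * expSeries χ) •
          (PowerSeries.coeff a (expSeries s) * X (k + J • w)) := by
      rw [mul_comm, PowerSeries.coeff_mul, Finset.sum_smul]
      refine Finset.sum_congr rfl fun q hq => ?_
      rw [mem_antidiagonal.mp hq]
    rw [this, hinv, PowerSeries.coeff_one]
    split_ifs with hJ
    · simp [hJ]
    · simp
  have e2 : ∀ p ∈ antidiagonal n, PowerSeries.coeff p.1 (expSeries χ) •
        (X (k + p.1 • w) * PowerSeries.coeff p.2 (expSeries s)) = ∑ q ∈ antidiagonal p.2,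
      (PowerSeries.coeff p.1 (expSeries χ) * PowerSeries.coeff q.1 (expSeries fun n => -χ n)) •
        (PowerSeries.coeff q.2 (expSeries s) * X (k + (p.1 + q.1) • w)) := by
    intro p _
    rw [mul_coeff_expSeries h hX, ← Finset.Nat.sum_antidiagonal_swap, Finset.smul_sum]
    simp only [Prod.fst_swap, Prod.snd_swap, smul_smul, add_smul, add_assoc]
  rw [← Finset.Nat.sum_antidiagonal_swap]
  simp only [Prod.fst_swap, Prod.snd_swap]
  rw [Finset.sum_congr rfl e2, sum_antidiagonal_assoc (fun m j a =>
      (PowerSeries.coeff m (expSeries χ) * PowerSeries.coeff j (expSeries fun n => -χ n)) •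
        (PowerSeries.coeff a (expSeries s) * X (k + (m + j) • w)))]
  simp only [e1]
  rw [Finset.Nat.sum_antidiagonal_eq_sum_range_succ
    (fun i j => if i = 0 then PowerSeries.coeff j (expSeries s) * X k else 0)]
  simp

end Euler

/-! ### Summation in linearly topologized rings -/

section LinearTopology

open Filter Topology

variable {R : Type*} [Ring R] [UniformSpace R] [IsUniformAddGroup R] [IsLinearTopology R R]

theorem nonarchimedeanAddGroup_of_isLinearTopology : NonarchimedeanAddGroup R where
  is_nonarchimedean U hU := by
    obtain ⟨J, hJ, hJU⟩ := (IsLinearTopology.hasBasis_open_ideal (R := R)).mem_iff.mp hU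
    exact ⟨⟨J.toAddSubgroup, hJ⟩, hJU⟩

variable [CompleteSpace R]

/-- In a complete nonarchimedean group summability means that the terms tend to 0, and the open left
ideals are a basis of neighbourhoods of 0. All convergence questions become finiteness questions. -/
theorem summable_iff_finite {ι : Type*} {f : ι → R} :
    Summable f ↔ ∀ J : Ideal R, IsOpen (J : Set R) → {i | f i ∉ J}.Finite := by
  have := nonarchimedeanAddGroup_of_isLinearTopology (R := R)
  rw [NonarchimedeanAddGroup.summable_iff_tendsto_cofinite_zero,
    (IsLinearTopology.hasBasis_open_ideal (R := R)).tendsto_right_iff]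
  simp only [Filter.eventually_cofinite, SetLike.mem_coe]

/-- Left ideals absorb left factors, so the multipliers `a` need no bound. The argument has no
counterpart for variable right factors, which is why left and right dressings are treated under
different hypotheses. -/
theorem summable_mul_left {ι : Type*} {f : ι → R} (a : ι → R) (hf : Summable f) :
    Summable fun i => a i * f i :=
  summable_iff_finite.mpr fun J hJ => (summable_iff_finite.mp hf J hJ).subset
    fun _ hi h => hi (J.mul_mem_left _ h)

theorem summable_prod_of_finite {ι κ : Type*} {f : ι × κ → R}
    (h1 : ∀ J : Ideal R, IsOpen (J : Set R) → {m | ∃ i, f (i, m) ∉ J}.Finite)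
    (h2 : ∀ m, Summable fun i => f (i, m)) : Summable f := by
  refine summable_iff_finite.mpr fun J hJ => ?_
  refine ((h1 J hJ).biUnion fun m _ =>
    ((summable_iff_finite.mp (h2 m) J hJ).image fun i => (i, m))).subset ?_
  rintro ⟨i, m⟩ h
  simp only [Set.mem_iUnion]
  exact ⟨m, ⟨i, h⟩, i, h, rfl⟩

/-- A right factor tending to 0 handles all but finitely many `m`, uniformly in `i`, because left
ideals absorb `f i m`; the finitely many remaining rows are summable by assumption. -/
theorem summable_prod_of_null {ι κ : Type*} {f : ι → κ → R} {g : κ → R} (hg : Summable g)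
    (h2 : ∀ m, Summable fun i => f i m * g m) : Summable fun p : ι × κ => f p.1 p.2 * g p.2 :=
  summable_prod_of_finite (fun J hJ => (summable_iff_finite.mp hg J hJ).subset
    fun _ ⟨_, hi⟩ h => hi (J.mul_mem_left _ h)) h2

omit [IsLinearTopology R R] in
/-- The antidiagonal form of a double series. -/
theorem tsum_antidiagonal [T2Space R] {f : ℕ × ℕ → R} (hf : Summable f) :
    ∑' n, ∑ p ∈ antidiagonal n, f p = ∑' p, f p := by
  rw [← sigmaAntidiagonalEquivProd.tsum_eq f,
    Summable.tsum_sigma (f := fun c => f (sigmaAntidiagonalEquivProd c))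
      (sigmaAntidiagonalEquivProd.summable_iff.mpr hf)]
  refine tsum_congr fun n => ?_
  rw [tsum_fintype]
  exact (Finset.sum_coe_sort (antidiagonal n) f).symm

omit [IsLinearTopology R R] in
theorem tsum_prod_swap [T2Space R] {ι κ : Type*} {f : ι × κ → R} (hf : Summable f) :
    ∑' p, f p = ∑' m, ∑' i, f (i, m) := by
  rw [← (Equiv.prodComm κ ι).tsum_eq f]
  exact ((Equiv.prodComm κ ι).summable_iff.mpr hf).tsum_prod

end LinearTopology

/-! ### Formal series over an abelian group, decaying along a cone -/

section Operators

open Filter Topology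

variable {R : Type*} [Ring R] [UniformSpace R] {Γ : Type*} [AddCommGroup Γ]

/-- A cone in which every element has only finitely many decompositions. -/
def Salient (C : AddSubmonoid Γ) : Prop := ∀ c : C, {p : C × C | p.1 + p.2 = c}.Finite

theorem apply_add_nsmul {v : Γ} {α : Type*} {f : Γ → α} (h : ∀ k, f (k + v) = f k) (n : ℕ) (k : Γ) :
    f (k + n • v) = f k := by
  induction n with
  | zero => simp
  | succ n ih => rw [succ_nsmul, ← add_assoc, h, ih]

/-- A vector of infinite order in the cone `C`. -/
def IsDir (C : AddSubmonoid Γ) (v : Γ) : Prop :=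
  v ∈ C ∧ Function.Injective fun n : ℕ => n • v

/-- A formal series with coefficients `F k` that tend to `0` along all translates of `C`. -/
def Adm (C : AddSubmonoid Γ) (F : Γ → R) : Prop := ∀ k, Summable fun c : C => F (k + c)

/-- The product of a formal series by the power series `D` in the monomial of degree `-v`, from
the left. -/
def lop (D : PowerSeries R) (v : Γ) (F : Γ → R) : Γ → R := fun k =>
  ∑' n : ℕ, PowerSeries.coeff n D * F (k + n • v)

/-- The product of a formal series by the power series `D` in the monomial of degree `-v`, from
the right. -/
def rop (F : Γ → R) (v : Γ) (D : PowerSeries R) : Γ → R := fun k =>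
  ∑' n : ℕ, F (k + n • v) * PowerSeries.coeff n D

/-- A power series with coefficients tending to `0`. -/
def NullSeries (D : PowerSeries R) : Prop := Summable fun n => PowerSeries.coeff n D

theorem lop_one (v : Γ) (F : Γ → R) : lop 1 v F = F := by
  ext k
  rw [lop, tsum_eq_single 0]
  · simp
  · intro n hn; simp [PowerSeries.coeff_one, hn]

theorem rop_one (v : Γ) (F : Γ → R) : rop F v 1 = F := by
  ext k
  rw [rop, tsum_eq_single 0]
  · simp
  · intro n hn; simp [PowerSeries.coeff_one, hn]

section Projection

variable {Γ' : Type*} [AddCommGroup Γ']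

theorem lop_fst (D : PowerSeries R) (v : Γ × Γ') (F : Γ → R) :
    (lop D v fun k => F k.1) = fun k => lop D v.1 F k.1 := rfl

theorem lop_snd (D : PowerSeries R) (v : Γ' × Γ) (F : Γ → R) :
    (lop D v fun k => F k.2) = fun k => lop D v.2 F k.2 := rfl

theorem rop_fst (D : PowerSeries R) (v : Γ × Γ') (F : Γ → R) :
    (rop (fun k => F k.1) v D) = fun k => rop F v.1 D k.1 := rfl

theorem rop_snd (D : PowerSeries R) (v : Γ' × Γ) (F : Γ → R) :
    (rop (fun k => F k.2) v D) = fun k => rop F v.2 D k.2 := rfl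

end Projection

/-- Finite fibres of addition make it a proper map of discrete sets. Decay along a salient cone
therefore implies summability of families indexed by several directions at once. -/
theorem Salient.tendsto_add {C : AddSubmonoid Γ} (hC : Salient C) {ι κ : Type*} {φ : ι → C}
    {ψ : κ → C} (hφ : Tendsto φ cofinite cofinite) (hψ : Tendsto ψ cofinite cofinite) :
    Tendsto (fun p : ι × κ => φ p.1 + ψ p.2) cofinite cofinite := by
  have h1 : Tendsto (fun p : C × C => p.1 + p.2) cofinite cofinite :=
    Tendsto.cofinite_of_finite_preimage_singleton hC
  have h2 := hφ.prodMap_coprod hψ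
  rw [coprod_cofinite, coprod_cofinite] at h2
  exact h1.comp h2

theorem IsDir.tendsto {C : AddSubmonoid Γ} {v : Γ} (hv : IsDir C v) :
    Tendsto (fun n : ℕ => (⟨n • v, C.nsmul_mem hv.1 n⟩ : C)) cofinite cofinite :=
  Function.Injective.tendsto_cofinite fun _ _ h => hv.2 (congrArg Subtype.val h)

variable [IsUniformAddGroup R] [IsLinearTopology R R] [CompleteSpace R]
  {C : AddSubmonoid Γ} {F G : Γ → R} {v w : Γ}

theorem Adm.comp (hF : Adm C F) {ι : Type*} {φ : ι → C} (hφ : Tendsto φ cofinite cofinite)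
    (k : Γ) : Summable fun i => F (k + φ i) :=
  summable_iff_finite.mpr fun J hJ => eventually_cofinite.mp <|
    hφ.eventually (p := fun c : C => F (k + c) ∈ J)
      (eventually_cofinite.mpr (summable_iff_finite.mp (hF k) J hJ))

theorem Adm.summable (hF : Adm C F) (hv : IsDir C v) (k : Γ) :
    Summable fun n : ℕ => F (k + n • v) :=
  hF.comp hv.tendsto k

theorem Adm.summable_coeff (hF : Adm C F) (hv : IsDir C v) (D : PowerSeries R) (k : Γ) :
    Summable fun n : ℕ => PowerSeries.coeff n D * F (k + n • v) :=
  summable_mul_left _ (hF.summable hv k)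

theorem Adm.summable_two (hF : Adm C F) (hC : Salient C) (hv : IsDir C v) (hw : IsDir C w)
    (k : Γ) : Summable fun p : ℕ × ℕ => F (k + p.1 • v + p.2 • w) := by
  simpa [add_assoc] using hF.comp (hC.tendsto_add hv.tendsto hw.tendsto) k

theorem Adm.summable_three (hF : Adm C F) (hC : Salient C) {u : Γ} (hv : IsDir C v)
    (hw : IsDir C w) (hu : IsDir C u) (k : Γ) :
    Summable fun p : ℕ × ℕ × ℕ => F (k + p.1 • v + p.2.1 • w + p.2.2 • u) := by
  simpa [add_assoc] using
    hF.comp (hC.tendsto_add hv.tendsto (hC.tendsto_add hw.tendsto hu.tendsto)) k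

/-- The map (c, n) ↦ c + n v is finite-to-one on the cone, and the coefficients of `D` stand on the
left, so nothing has to be required of them. -/
theorem Adm.lop (hF : Adm C F) (hC : Salient C) (hv : IsDir C v) (D : PowerSeries R) :
    Adm C (lop D v F) := fun k => by
  have h1 : Summable fun p : C × ℕ => F (k + p.1 + p.2 • v) := by
    simpa [add_assoc] using hF.comp (hC.tendsto_add tendsto_id hv.tendsto) k
  exact (summable_mul_left (fun p : C × ℕ => PowerSeries.coeff p.2 D) h1).prod

theorem summable_rop {D : PowerSeries R} (hD : NullSeries D) (F : Γ → R) (v k : Γ) :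
    Summable fun n : ℕ => F (k + n • v) * PowerSeries.coeff n D :=
  summable_mul_left _ hD

variable [IsTopologicalRing R]

/-- The smallness now comes from `D`, so the shift `v` need not lie in the cone; for each fixed
power the decay of `F` along a translate of the cone is enough. -/
theorem Adm.rop (hF : Adm C F) {D : PowerSeries R} (hD : NullSeries D) (v : Γ) :
    Adm C (rop F v D) := fun k => by
  refine (summable_prod_of_null (f := fun (c : C) (n : ℕ) => F (k + c + n • v))
    (g := fun n => PowerSeries.coeff n D) hD fun n => ?_).prod
  have := (hF (k + n • v)).mul_right (PowerSeries.coeff n D)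
  simpa only [add_right_comm] using this

theorem summable_rop_rop {D E : PowerSeries R} (hD : NullSeries D) (hE : NullSeries E)
    (F : Γ → R) (v w k : Γ) : Summable fun p : ℕ × ℕ =>
      F (k + p.1 • v + p.2 • w) * PowerSeries.coeff p.1 D * PowerSeries.coeff p.2 E := by
  refine summable_prod_of_null (g := fun n => PowerSeries.coeff n E) hE (f := fun (n m : ℕ) =>
    F (k + n • v + m • w) * PowerSeries.coeff n D) fun m => ?_
  exact (summable_mul_left _ hD).mul_right _

variable [T2Space R]

theorem lop_lop (hF : ∀ k, Summable fun p : ℕ × ℕ => F (k + p.1 • v + p.2 • w))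
    (D E : PowerSeries R) (k : Γ) : lop D v (lop E w F) k = ∑' p : ℕ × ℕ,
      PowerSeries.coeff p.1 D * PowerSeries.coeff p.2 E * F (k + p.1 • v + p.2 • w) := by
  rw [(summable_mul_left _ (hF k)).tsum_prod]
  refine tsum_congr fun n => ?_
  simp only [mul_assoc]
  exact ((summable_mul_left (fun m => PowerSeries.coeff m E)
    ((hF k).prod_factor n)).tsum_mul_left _).symm

theorem lop_comm (hF : ∀ k, Summable fun p : ℕ × ℕ => F (k + p.1 • v + p.2 • w))
    {D E : PowerSeries R}
    (h : ∀ m n, Commute (PowerSeries.coeff m D) (PowerSeries.coeff n E)) :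
    lop D v (lop E w F) = lop E w (lop D v F) := by
  have hF' : ∀ k, Summable fun p : ℕ × ℕ => F (k + p.1 • w + p.2 • v) := fun k => by
    refine ((Equiv.prodComm ℕ ℕ).summable_iff.mpr (hF k)).congr fun p => ?_
    simp [add_right_comm]
  ext k
  rw [lop_lop hF, lop_lop hF', ← (Equiv.prodComm ℕ ℕ).tsum_eq]
  refine tsum_congr fun p => ?_
  simp only [Equiv.prodComm_apply, Prod.fst_swap, Prod.snd_swap]
  rw [(h _ _).eq, add_right_comm]

theorem lop_mul (hF : Adm C F) (hC : Salient C) (hv : IsDir C v) (D E : PowerSeries R) :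
    lop D v (lop E v F) = lop (D * E) v F := by
  ext k
  rw [lop_lop (hF.summable_two hC hv hv), ← tsum_antidiagonal (summable_mul_left _ (hF.summable_two hC hv hv k))]
  refine tsum_congr fun n => ?_
  rw [PowerSeries.coeff_mul, Finset.sum_mul]
  refine Finset.sum_congr rfl fun p hp => ?_
  rw [← mem_antidiagonal.mp hp, add_smul, add_assoc]

theorem rop_rop {D E : PowerSeries R} (hD : NullSeries D) (hE : NullSeries E)
    (F : Γ → R) (v w k : Γ) : rop (rop F v D) w E k = ∑' p : ℕ × ℕ,
      F (k + p.1 • v + p.2 • w) * PowerSeries.coeff p.1 D * PowerSeries.coeff p.2 E := by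
  rw [tsum_prod_swap (summable_rop_rop hD hE F v w k)]
  refine tsum_congr fun n => ?_
  simp only [rop, add_right_comm _ _ (n • w)]
  refine ((summable_mul_left _ hD).tsum_mul_right _).symm

theorem rop_comm {D E : PowerSeries R} (hD : NullSeries D) (hE : NullSeries E)
    (h : ∀ m n, Commute (PowerSeries.coeff m D) (PowerSeries.coeff n E)) (F : Γ → R) (v w : Γ) :
    rop (rop F v D) w E = rop (rop F w E) v D := by
  ext k
  rw [rop_rop hD hE, rop_rop hE hD, ← (Equiv.prodComm ℕ ℕ).tsum_eq]
  refine tsum_congr fun p => ?_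
  simp only [Equiv.prodComm_apply, Prod.fst_swap, Prod.snd_swap]
  rw [mul_assoc, (h _ _).eq, add_right_comm, ← mul_assoc]

theorem rop_mul {D E : PowerSeries R} (hD : NullSeries D) (hE : NullSeries E) (F : Γ → R) (v : Γ) :
    rop (rop F v D) v E = rop F v (D * E) := by
  ext k
  rw [rop_rop hD hE, ← tsum_antidiagonal (summable_rop_rop hD hE F v v k)]
  refine tsum_congr fun n => ?_
  rw [PowerSeries.coeff_mul, Finset.mul_sum]
  refine Finset.sum_congr rfl fun p hp => ?_
  rw [← mem_antidiagonal.mp hp, add_smul, add_assoc, mul_assoc]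

/-- Multipliers on opposite sides commute by associativity; the interchange of the two summations is
justified by the null factor on the right. -/
theorem lop_rop (hF : ∀ k, Summable fun n : ℕ => F (k + n • v)) (D : PowerSeries R)
    {E : PowerSeries R} (hE : NullSeries E) (w : Γ) :
    lop D v (rop F w E) = rop (lop D v F) w E := by
  ext k
  have h1 : ∀ k, Summable fun n : ℕ => PowerSeries.coeff n D * F (k + n • v) :=
    fun k => summable_mul_left _ (hF k)
  have h : Summable fun p : ℕ × ℕ =>
      PowerSeries.coeff p.1 D * F (k + p.2 • w + p.1 • v) * PowerSeries.coeff p.2 E :=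
    summable_prod_of_null (g := fun n => PowerSeries.coeff n E) hE (f := fun n m : ℕ => PowerSeries.coeff n D * F (k + m • w + n • v))
      fun m => (h1 _).mul_right _
  trans ∑' p : ℕ × ℕ,
      PowerSeries.coeff p.1 D * F (k + p.2 • w + p.1 • v) * PowerSeries.coeff p.2 E
  · rw [h.tsum_prod]
    refine tsum_congr fun n => ?_
    rw [rop, ← (summable_rop hE F w _).tsum_mul_left]
    simp only [mul_assoc, add_right_comm]
  · rw [tsum_prod_swap h]
    refine tsum_congr fun n => ?_
    exact (h1 (k + n • w)).tsum_mul_right (PowerSeries.coeff n E)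

/-! Products of formal series in independent variables. -/

theorem lop_mul_right (hF : ∀ k, Summable fun n : ℕ => F (k + n • v)) (D : PowerSeries R)
    (hG : ∀ k, G (k + v) = G k) :
    (fun k => lop D v F k * G k) = lop D v fun k => F k * G k := by
  ext k
  have hG' : ∀ n : ℕ, G (k + n • v) = G k := fun n => apply_add_nsmul hG n k
  rw [lop, lop, ← (summable_mul_left _ (hF k)).tsum_mul_right]
  simp only [mul_assoc, hG']

theorem mul_lop (hF : ∀ k, Summable fun n : ℕ => F (k + n • v)) {D : PowerSeries R}
    (hG : ∀ k, G (k + v) = G k) (h : ∀ n k, Commute (PowerSeries.coeff n D) (G k)) :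
    (fun k => G k * lop D v F k) = lop D v fun k => G k * F k := by
  ext k
  rw [lop, lop, ← (summable_mul_left _ (hF k)).tsum_mul_left]
  simp only [← mul_assoc, (h _ _).eq, apply_add_nsmul hG]

theorem mul_rop {D : PowerSeries R} (hD : NullSeries D) (hG : ∀ k, G (k + v) = G k) :
    (fun k => G k * rop F v D k) = rop (fun k => G k * F k) v D := by
  ext k
  have hG' : ∀ n : ℕ, G (k + n • v) = G k := fun n => apply_add_nsmul hG n k
  rw [rop, rop, ← (summable_rop hD F v k).tsum_mul_left]
  simp only [← mul_assoc, hG']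

variable [Algebra ℂ R]

/-- A power series with complex coefficients as a power series over a complex algebra. -/
def scal (g : PowerSeries ℂ) : PowerSeries R := PowerSeries.map (algebraMap ℂ R) g

omit [UniformSpace R] [IsUniformAddGroup R] [IsLinearTopology R R] [CompleteSpace R]
  [IsTopologicalRing R] [T2Space R] in
theorem coeff_scal_mul (g : PowerSeries ℂ) (n : ℕ) (x : R) :
    PowerSeries.coeff n (scal g) * x = PowerSeries.coeff n g • x := by
  rw [scal, PowerSeries.coeff_map, Algebra.smul_def]

omit [UniformSpace R] [IsUniformAddGroup R] [IsLinearTopology R R] [CompleteSpace R]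
  [IsTopologicalRing R] [T2Space R] in
theorem commute_scal (g : PowerSeries ℂ) (D : PowerSeries R) (m n : ℕ) :
    Commute (PowerSeries.coeff m (scal g)) (PowerSeries.coeff n D) := by
  rw [scal, PowerSeries.coeff_map]
  exact Algebra.commutes _ _

omit [UniformSpace R] [IsUniformAddGroup R] [IsLinearTopology R R] [CompleteSpace R]
  [IsTopologicalRing R] [T2Space R] in
theorem scal_mul (f g : PowerSeries ℂ) : (scal (f * g) : PowerSeries R) = scal f * scal g :=
  map_mul _ _ _

omit [UniformSpace R] [IsUniformAddGroup R] [IsLinearTopology R R] [CompleteSpace R]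
  [IsTopologicalRing R] [T2Space R] in
@[simp]
theorem scal_one : (scal 1 : PowerSeries R) = 1 := map_one _

/-- A relation with two terms on each side, stable under all translations, survives a left dressing
term by term. It is the mechanism by which relations of bare currents pass to normally ordered
products. -/
theorem lop_linear (hF : ∀ k, Summable fun n : ℕ => F (k + n • v))
    (hG : ∀ k, Summable fun n : ℕ => G (k + n • v)) (D : PowerSeries R) {α β γ δ : ℂ} {s : Γ}
    (h : ∀ k, α • F k + β • F (k + s) = γ • G k + δ • G (k + s)) (k : Γ) :
    α • lop D v F k + β • lop D v F (k + s) = γ • lop D v G k + δ • lop D v G (k + s) := by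
  have key : ∀ (a b : ℂ) (K : Γ → R), (∀ k, Summable fun n : ℕ => K (k + n • v)) →
      a • lop D v K k + b • lop D v K (k + s) =
        ∑' n : ℕ, PowerSeries.coeff n D * (a • K (k + n • v) + b • K (k + n • v + s)) := by
    intro a b K hK
    have h1 : ∀ k, Summable fun n : ℕ => PowerSeries.coeff n D * K (k + n • v) :=
      fun k => summable_mul_left _ (hK k)
    simp only [Algebra.smul_def, lop]
    rw [← (h1 k).tsum_mul_left, ← (h1 (k + s)).tsum_mul_left,
      ← ((h1 k).mul_left _).tsum_add ((h1 (k + s)).mul_left _)]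
    refine tsum_congr fun n => ?_
    rw [mul_add, ← Algebra.left_comm, ← Algebra.left_comm, add_right_comm k s]
  rw [key _ _ F hF, key _ _ G hG]
  simp only [h]

theorem rop_linear {D : PowerSeries R} (hD : NullSeries D) {α β γ δ : ℂ} {s : Γ}
    (h : ∀ k, α • F k + β • F (k + s) = γ • G k + δ • G (k + s)) (k : Γ) :
    α • rop F v D k + β • rop F v D (k + s) = γ • rop G v D k + δ • rop G v D (k + s) := by
  have key : ∀ (a b : ℂ) (K : Γ → R), a • rop K v D k + b • rop K v D (k + s) =
        ∑' n : ℕ, (a • K (k + n • v) + b • K (k + n • v + s)) * PowerSeries.coeff n D := by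
    intro a b K
    have h1 : ∀ k, Summable fun n : ℕ => K (k + n • v) * PowerSeries.coeff n D :=
      fun k => summable_rop hD K v k
    simp only [Algebra.smul_def, rop]
    rw [← (h1 k).tsum_mul_left, ← (h1 (k + s)).tsum_mul_left,
      ← ((h1 k).mul_left _).tsum_add ((h1 (k + s)).mul_left _)]
    refine tsum_congr fun n => ?_
    rw [add_mul, mul_assoc, mul_assoc, add_right_comm k s]
  rw [key, key]
  simp only [h]

/-- Moving an exponential to the left past a family on which its exponents act by shifts. -/
theorem mul_lop_exchange (hFG : Adm C fun k => F k * G k) (hC : Salient C) (hv : IsDir C v)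
    (hvw : IsDir C (v + w)) (hG : ∀ k, Summable fun n : ℕ => G (k + n • v))
    (hFv : ∀ k, F (k + v) = F k) (hGw : ∀ k, G (k + w) = G k) {E : PowerSeries R}
    {g : PowerSeries ℂ}
    (h : ∀ n k, F k * PowerSeries.coeff n E = ∑ p ∈ antidiagonal n,
      PowerSeries.coeff p.2 g • (PowerSeries.coeff p.1 E * F (k + p.2 • w))) :
    (fun k => F k * lop E v G k) = lop (scal g) (v + w) (lop E v fun k => F k * G k) := by
  ext k
  have h2 : ∀ k, Summable fun p : ℕ × ℕ =>
      F (k + p.1 • (v + w) + p.2 • v) * G (k + p.1 • (v + w) + p.2 • v) :=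
    fun k => Adm.summable_two (F := fun k => F k * G k) hFG hC hvw hv k
  rw [lop_lop (F := fun k => F k * G k) h2, ← tsum_antidiagonal (summable_mul_left _ (h2 k)), lop,
    ← (summable_mul_left _ (hG k)).tsum_mul_left]
  refine tsum_congr fun n => ?_
  rw [← mul_assoc, h, Finset.sum_mul, ← Finset.Nat.sum_antidiagonal_swap]
  refine Finset.sum_congr rfl fun p hp => ?_
  -- `F` does not see shifts by `v` and `G` does not see shifts by `w`, so the diagonal shift by `v
  -- + w` moves them independently and the double sum regroups by the total power of `v`.
  have e1 : F (k + p.1 • (v + w) + p.2 • v) = F (k + p.1 • w) := by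
    rw [apply_add_nsmul hFv, nsmul_add, add_comm (p.1 • v), ← add_assoc, apply_add_nsmul hFv]
  have e2 : G (k + p.1 • (v + w) + p.2 • v) = G (k + n • v) := by
    rw [nsmul_add, ← add_assoc, add_right_comm, apply_add_nsmul hGw, add_assoc, ← add_smul,
      mem_antidiagonal.mp hp]
  simp only [Prod.fst_swap, Prod.snd_swap]
  rw [e1, e2, mul_assoc, coeff_scal_mul, smul_mul_assoc, mul_assoc]

/-- Moving an exponential to the right past a family on which its exponents act by shifts. -/
theorem rop_mul_exchange {D : PowerSeries R} (hD : NullSeries D) (hFG : Adm C fun k => F k * G k)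
    (hvw : IsDir C (v + w)) (hGv : ∀ k, G (k + v) = G k)
    (hFw : ∀ k, F (k + w) = F k) {g : PowerSeries ℂ}
    (h : ∀ n k, PowerSeries.coeff n D * G k = ∑ p ∈ antidiagonal n,
      PowerSeries.coeff p.2 g • (G (k + p.2 • w) * PowerSeries.coeff p.1 D)) :
    (fun k => rop F v D k * G k) = lop (scal g) (v + w) (rop (fun k => F k * G k) v D) := by
  ext k
  have hs : Summable fun p : ℕ × ℕ => PowerSeries.coeff p.1 (scal g) *
      (F (k + p.1 • (v + w) + p.2 • v) * G (k + p.1 • (v + w) + p.2 • v)) *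
        PowerSeries.coeff p.2 D :=
    summable_prod_of_null (g := fun m => PowerSeries.coeff m D)
      (f := fun n m : ℕ => PowerSeries.coeff n (scal g) *
        (F (k + n • (v + w) + m • v) * G (k + n • (v + w) + m • v))) hD fun m => by
      have := (summable_mul_left (fun n => PowerSeries.coeff n (scal g))
        (hFG.summable hvw (k + m • v))).mul_right (PowerSeries.coeff m D)
      simpa only [add_right_comm] using this
  have e : lop (scal g) (v + w) (rop (fun k => F k * G k) v D) k =
      ∑' p : ℕ × ℕ, PowerSeries.coeff p.1 (scal g) *
      (F (k + p.1 • (v + w) + p.2 • v) * G (k + p.1 • (v + w) + p.2 • v)) *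
        PowerSeries.coeff p.2 D := by
    rw [hs.tsum_prod]
    refine tsum_congr fun n => ?_
    rw [rop, ← (summable_rop hD (fun k => F k * G k) v (k + n • (v + w))).tsum_mul_left]
    simp only [mul_assoc]
  rw [e, ← tsum_antidiagonal hs, rop, ← (summable_rop hD F v k).tsum_mul_right]
  refine tsum_congr fun n => ?_
  rw [mul_assoc, h, Finset.mul_sum, ← Finset.Nat.sum_antidiagonal_swap]
  refine Finset.sum_congr rfl fun p hp => ?_
  have e1 : G (k + p.1 • (v + w) + p.2 • v) = G (k + p.1 • w) := by
    rw [apply_add_nsmul hGv, nsmul_add, add_comm (p.1 • v), ← add_assoc, apply_add_nsmul hGv]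
  have e2 : F (k + p.1 • (v + w) + p.2 • v) = F (k + n • v) := by
    rw [nsmul_add, ← add_assoc, add_right_comm, apply_add_nsmul hFw, add_assoc, ← add_smul,
      mem_antidiagonal.mp hp]
  simp only [Prod.fst_swap, Prod.snd_swap]
  rw [e1, e2, mul_assoc, coeff_scal_mul, mul_smul_comm, mul_assoc]

end Operators

/-! ### Cones for one, two and three variables -/

/-- The monomials `z ^ k` with `k ≤ 0`. -/
def coneOne : AddSubmonoid ℤ where
  carrier := {k | k ≤ 0}
  add_mem' {a b} ha hb := by simp only [Set.mem_ofPred_eq] at *; omega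
  zero_mem' := by simp

/-- The monomials in `z₁⁻¹` and `z₁ / z₂`. -/
def coneTwo : AddSubmonoid (ℤ × ℤ) where
  carrier := {k | k.2 ≤ 0 ∧ k.1 + k.2 ≤ 0}
  add_mem' {a b} ha hb := by simp only [Set.mem_ofPred_eq, Prod.fst_add, Prod.snd_add] at *; omega
  zero_mem' := by simp

/-- The monomials in `z₁⁻¹`, `z₁ / z₂` and `z₂ / z₃`. -/
def coneThree : AddSubmonoid (ℤ × ℤ × ℤ) where
  carrier := {k | k.2.2 ≤ 0 ∧ k.2.1 + k.2.2 ≤ 0 ∧ k.1 + k.2.1 + k.2.2 ≤ 0}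
  add_mem' {a b} ha hb := by simp only [Set.mem_ofPred_eq, Prod.fst_add, Prod.snd_add] at *; omega
  zero_mem' := by simp

theorem mem_coneOne {k : ℤ} : k ∈ coneOne ↔ k ≤ 0 := Iff.rfl

theorem mem_coneTwo {k : ℤ × ℤ} : k ∈ coneTwo ↔ k.2 ≤ 0 ∧ k.1 + k.2 ≤ 0 := Iff.rfl

theorem mem_coneThree {k : ℤ × ℤ × ℤ} :
    k ∈ coneThree ↔ k.2.2 ≤ 0 ∧ k.2.1 + k.2.2 ≤ 0 ∧ k.1 + k.2.1 + k.2.2 ≤ 0 := Iff.rfl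

/-- It is enough to confine the first summand of every decomposition to a finite set; the second one
is then confined too, by commutativity. -/
theorem salient_of_finite {Γ : Type*} [AddCommGroup Γ] {C : AddSubmonoid Γ} (S : Γ → Set Γ)
    (hS : ∀ c, (S c).Finite) (h : ∀ a ∈ C, ∀ b ∈ C, a ∈ S (a + b)) : Salient C := fun c => by
  have hf : (Subtype.val ⁻¹' S c : Set C).Finite := (hS c).preimage Subtype.val_injective.injOn
  refine (hf.prod hf).subset ?_
  rintro ⟨a, b⟩ rfl
  refine ⟨h a a.2 b b.2, ?_⟩
  have := h b b.2 a a.2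
  rw [add_comm] at this
  exact this

theorem salient_coneOne : Salient coneOne :=
  salient_of_finite (fun c => Set.Icc c 0) (fun _ => Set.finite_Icc _ _) fun a ha b hb => by
    simp only [mem_coneOne, Set.mem_Icc] at *
    omega

theorem salient_coneTwo : Salient coneTwo :=
  salient_of_finite (fun c => Set.Icc (c.1 + c.2, c.2) (-c.2, 0)) (fun _ => Set.finite_Icc _ _)
    fun a ha b hb => by
      simp only [mem_coneTwo, Set.mem_Icc, Prod.le_def, Prod.fst_add, Prod.snd_add] at *
      omega

theorem salient_coneThree : Salient coneThree :=
  salient_of_finite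
    (fun c => Set.Icc (c.1 + c.2.1 + c.2.2, c.2.1 + c.2.2, c.2.2) (-c.2.1 - c.2.2, -c.2.2, 0))
    (fun _ => Set.finite_Icc _ _) fun a ha b hb => by
      simp only [mem_coneThree, Set.mem_Icc, Prod.le_def, Prod.fst_add, Prod.snd_add] at *
      omega

theorem isDir_of_mem {Γ : Type*} [AddCommGroup Γ] [IsAddTorsionFree Γ] {C : AddSubmonoid Γ}
    {v : Γ} (h : v ∈ C) (h0 : v ≠ 0) : IsDir C v :=
  ⟨h, fun m n hmn => by
    by_contra hne
    rcases Nat.lt_or_gt_of_ne hne with hlt | hlt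
    · obtain ⟨d, rfl⟩ := Nat.exists_eq_add_of_lt hlt
      simp only [add_assoc, add_smul m, left_eq_add] at hmn
      exact h0 ((smul_eq_zero_iff_right (by omega : d + 1 ≠ 0)).mp hmn)
    · obtain ⟨d, rfl⟩ := Nat.exists_eq_add_of_lt hlt
      simp only [add_assoc, add_smul n, add_eq_left] at hmn
      exact h0 ((smul_eq_zero_iff_right (by omega : d + 1 ≠ 0)).mp hmn)⟩

section Decay

variable {R : Type*} [Ring R] [UniformSpace R]

/-- The coefficients of a current tend to `0` for exponents tending to `-∞`. -/
def Decays (X : ℤ → R) : Prop := ∀ k, Summable fun n : ℕ => X (k - n)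

theorem Decays.adm {X : ℤ → R} (hX : Decays X) : Adm coneOne X := fun k => by
  let e : ℕ → coneOne := fun n => ⟨-n, by simp [mem_coneOne]⟩
  have he : Function.Injective e := fun m n h => by simpa [e] using h
  have hr : ∀ c, c ∈ Set.range e := fun c => ⟨(-c.1).toNat, by
    have := mem_coneOne.mp c.2
    ext; simp only [e]; omega⟩
  refine (he.summable_iff fun c hc => absurd (hr c) hc).mp ?_
  simpa only [Function.comp_def, e, ← sub_eq_add_neg] using hX k

variable [IsUniformAddGroup R] [IsLinearTopology R R] [CompleteSpace R]

theorem Adm.decays {X : ℤ → R} (hX : Adm coneOne X) : Decays X := fun k => by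
  simpa [← sub_eq_add_neg] using
    hX.summable (isDir_of_mem (v := (-1 : ℤ)) (by simp [mem_coneOne]) (by simp)) k

variable [IsTopologicalRing R]

/-- The cone is free on (-1, 0) and (1, -1). Along the second generator the right factor `Y` tends
to 0 whatever stands on its left; along the first one only `X` moves and `Y` is a constant right
factor. -/
theorem adm_coneTwo_mul {X Y : ℤ → R} (hX : Decays X) (hY : Decays Y) :
    Adm coneTwo fun k => X k.1 * Y k.2 := fun k => by
  let e : ℕ × ℕ → coneTwo := fun p => ⟨((p.2 : ℤ) - p.1, -(p.2 : ℤ)), by simp [mem_coneTwo]⟩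
  have he : Function.Injective e := fun m n h => by
    simp only [e, Subtype.mk.injEq, Prod.mk.injEq] at h
    ext <;> omega
  have hr : ∀ c, c ∈ Set.range e := fun c =>
    ⟨((-(c.1.1 + c.1.2)).toNat, (-c.1.2).toNat), by
      have := mem_coneTwo.mp c.2
      ext <;> simp only [e] <;> omega⟩
  refine (he.summable_iff fun c hc => absurd (hr c) hc).mp ?_
  have := summable_prod_of_null (f := fun n m : ℕ => X (k.1 + m - n))
    (g := fun m : ℕ => Y (k.2 - m)) (hY k.2) fun m => (hX _).mul_right _
  simpa only [Function.comp_def, e, Prod.fst_add, Prod.snd_add, ← sub_eq_add_neg, ← add_sub_assoc]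
    using this

omit [IsTopologicalRing R] in
theorem Adm.summable_coneTwo {W : ℤ × ℤ → R} (hW : Adm coneTwo W) (k : ℤ × ℤ) :
    Summable fun p : ℕ × ℕ => W (k.1 + p.2 - p.1, k.2 - p.2) := by
  let e : ℕ × ℕ → coneTwo := fun p => ⟨((p.2 : ℤ) - p.1, -(p.2 : ℤ)), by simp [mem_coneTwo]⟩
  have he : Function.Injective e := fun m n h => by
    simp only [e, Subtype.mk.injEq, Prod.mk.injEq] at h
    ext <;> omega
  refine (hW.comp he.tendsto_cofinite k).congr fun p => ?_
  simp only [e, Prod.add_def, ← sub_eq_add_neg, ← add_sub_assoc]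

theorem adm_coneThree_mul_left {X : ℤ → R} {W : ℤ × ℤ → R} (hX : Decays X) (hW : Adm coneTwo W) :
    Adm coneThree fun k => X k.1 * W k.2 := fun k => by
  -- Coordinates with respect to the free generators (-1, 0, 0), (1, -1, 0), (0, 1, -1) of the cone.
  let e : ℕ × ℕ × ℕ → coneThree := fun p =>
    ⟨((p.2.1 : ℤ) - p.1, (p.2.2 : ℤ) - p.2.1, -(p.2.2 : ℤ)), by simp [mem_coneThree]⟩
  have he : Function.Injective e := fun m n h => by
    simp only [e, Subtype.mk.injEq, Prod.mk.injEq] at h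
    ext <;> omega
  have hr : ∀ c, c ∈ Set.range e := fun c => ⟨((-(c.1.1 + c.1.2.1 + c.1.2.2)).toNat,
      (-(c.1.2.1 + c.1.2.2)).toNat, (-c.1.2.2).toNat), by
    have := mem_coneThree.mp c.2
    ext <;> simp only [e] <;> omega⟩
  refine (he.summable_iff fun c hc => absurd (hr c) hc).mp ?_
  have := summable_prod_of_null (f := fun (n : ℕ) (p : ℕ × ℕ) => X (k.1 + p.1 - n))
    (g := fun p : ℕ × ℕ => W (k.2.1 + p.2 - p.1, k.2.2 - p.2)) (hW.summable_coneTwo k.2)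
    fun m => (hX _).mul_right _
  refine this.congr fun p => ?_
  simp only [Function.comp_def, e, Prod.add_def, ← sub_eq_add_neg, ← add_sub_assoc]

theorem adm_coneThree_mul_right {W : ℤ × ℤ → R} {Z : ℤ → R} (hW : Adm coneTwo W) (hZ : Decays Z) :
    Adm coneThree fun k => W (k.1, k.2.1) * Z k.2.2 := fun k => by
  let e : (ℕ × ℕ) × ℕ → coneThree := fun p =>
    ⟨((p.1.2 : ℤ) - p.1.1, (p.2 : ℤ) - p.1.2, -(p.2 : ℤ)), by simp [mem_coneThree]⟩
  have he : Function.Injective e := fun m n h => by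
    simp only [e, Subtype.mk.injEq, Prod.mk.injEq] at h
    obtain ⟨⟨m1, m2⟩, m3⟩ := m
    obtain ⟨⟨n1, n2⟩, n3⟩ := n
    simp only [Prod.mk.injEq] at *
    omega
  have hr : ∀ c, c ∈ Set.range e := fun c => ⟨(((-(c.1.1 + c.1.2.1 + c.1.2.2)).toNat,
      (-(c.1.2.1 + c.1.2.2)).toNat), (-c.1.2.2).toNat), by
    have := mem_coneThree.mp c.2
    ext <;> simp only [e] <;> omega⟩
  refine (he.summable_iff fun c hc => absurd (hr c) hc).mp ?_
  have := summable_prod_of_null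
    (f := fun (p : ℕ × ℕ) (l : ℕ) => W (k.1 + p.2 - p.1, k.2.1 + l - p.2))
    (g := fun l : ℕ => Z (k.2.2 - l)) (hZ _) fun l =>
      (hW.summable_coneTwo (k.1, k.2.1 + l)).mul_right _
  refine this.congr fun p => ?_
  simp only [Function.comp_def, e, Prod.add_def, ← sub_eq_add_neg, ← add_sub_assoc]

end Decay

/-! ### The topology of the completed algebra -/

section Completion

open Topology UniformSpace

variable {N : ℕ} {η : ℂ} {c : ℝ}

/-- The closure of the left ideal `I_n` in the completed algebra. -/
def degIdealHat (N : ℕ) (η : ℂ) (c : ℝ) (n : ℤ) : Ideal (UqHat N η c) where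
  carrier := closure ((fun x : Uq N η c => (x : UqHat N η c)) '' (degIdeal N η c n))
  zero_mem' := subset_closure ⟨0, zero_mem _, Completion.coe_zero⟩
  add_mem' {a b} ha hb := by
    refine map_mem_closure₂ continuous_add ha hb ?_
    rintro _ ⟨x, hx, rfl⟩ _ ⟨y, hy, rfl⟩
    exact ⟨x + y, add_mem hx hy, Completion.coe_add _ _⟩
  smul_mem' a b hb := by
    -- A general element of the completion is a limit of elements of the algebra, for which
    -- absorption holds; continuity of the product extends it to closures.
    refine map_mem_closure₂ (s := Set.range ((↑) : Uq N η c → UqHat N η c)) continuous_mul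
      (Completion.denseRange_coe a) hb ?_
    rintro _ ⟨x, rfl⟩ _ ⟨y, hy, rfl⟩
    exact ⟨x * y, Ideal.mul_mem_left _ _ hy, Completion.coe_mul _ _⟩

theorem coe_mem_degIdealHat {n : ℤ} {x : Uq N η c} (hx : x ∈ degIdeal N η c n) :
    (x : UqHat N η c) ∈ degIdealHat N η c n :=
  subset_closure ⟨x, hx, rfl⟩

theorem degIdealHat_anti {m n : ℤ} (h : m ≤ n) : degIdealHat N η c n ≤ degIdealHat N η c m :=
  closure_mono (Set.image_mono (degIdeal_anti h))

/-- Closures of the images of a basis of neighbourhoods form such a basis in the completion. As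
these closures are again left ideals, the completion is linearly topologized over itself. -/
theorem hasBasis_degIdealHat :
    (𝓝 (0 : UqHat N η c)).HasBasis (fun _ => True) fun n : ℤ => (degIdealHat N η c n : Set _) := by
  have h := ((degIdeal_basis (N := N) (η := η) (c := c)).hasBasis_nhds_zero).hasBasis_of_isDenseInducing
    Completion.isDenseInducing_coe
  rw [Completion.coe_zero] at h
  exact h

instance : IsLinearTopology (UqHat N η c) (UqHat N η c) :=
  IsLinearTopology.mk_of_hasBasis _ hasBasis_degIdealHat

theorem summable_of_mem_degIdealHat {ι : Type*} {f : ι → UqHat N η c} {d : ι → ℤ}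
    (hd : ∀ n, {i | d i < n}.Finite) (hf : ∀ i, f i ∈ degIdealHat N η c (d i)) : Summable f := by
  refine summable_iff_finite.mpr fun J hJ => ?_
  obtain ⟨n, -, hn⟩ := hasBasis_degIdealHat.mem_iff.mp (hJ.mem_nhds J.zero_mem)
  refine (hd n).subset fun i hi => ?_
  by_contra h
  exact hi (hn (degIdealHat_anti (not_lt.mp h) (hf i)))

end Completion

/-! ### Normal ordering -/

section NormalOrder

theorem isDir_one_neg_one : IsDir coneTwo ((1, -1) : ℤ × ℤ) :=
  isDir_of_mem (by simp [mem_coneTwo]) (by simp)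

theorem isDir_neg_one_zero : IsDir coneTwo ((-1, 0) : ℤ × ℤ) :=
  isDir_of_mem (by simp [mem_coneTwo]) (by simp)

theorem isDir_zero_neg_one : IsDir coneTwo ((0, -1) : ℤ × ℤ) :=
  isDir_of_mem (by simp [mem_coneTwo]) (by simp)

theorem isDir_coneThree {v : ℤ × ℤ × ℤ} (h : v ∈ coneThree) (h0 : v ≠ 0) : IsDir coneThree v :=
  isDir_of_mem h h0

variable {R : Type*} [Ring R]

section Exchange

variable [Algebra ℂ R]

/-- `X(z) E(w) = g(w / z) E(w) X(z)`. -/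
def LeftExchange (X : ℤ → R) (E : PowerSeries R) (g : PowerSeries ℂ) : Prop :=
  ∀ n k, X k * PowerSeries.coeff n E = ∑ p ∈ antidiagonal n,
    PowerSeries.coeff p.2 g • (PowerSeries.coeff p.1 E * X (k + p.2))

/-- `D(z⁻¹) Y(w) = g(w / z) Y(w) D(z⁻¹)`. -/
def RightExchange (D : PowerSeries R) (Y : ℤ → R) (g : PowerSeries ℂ) : Prop :=
  ∀ n k, PowerSeries.coeff n D * Y k = ∑ p ∈ antidiagonal n,
    PowerSeries.coeff p.2 g • (Y (k - p.2) * PowerSeries.coeff p.1 D)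

end Exchange

variable [UniformSpace R]

theorem Decays.summable {X : ℤ → R} (hX : Decays X) (k : ℤ) :
    Summable fun n : ℕ => X (k + n • (-1)) := by
  simpa [← sub_eq_add_neg] using hX k

variable [IsUniformAddGroup R] [IsLinearTopology R R] [CompleteSpace R]

theorem Decays.lop {X : ℤ → R} (hX : Decays X) (E : PowerSeries R) : Decays (lop E (-1) X) :=
  (hX.adm.lop salient_coneOne (isDir_of_mem (by simp [mem_coneOne]) (by simp)) E).decays

variable [IsTopologicalRing R]

theorem Decays.rop {X : ℤ → R} (hX : Decays X) {D : PowerSeries R} (hD : NullSeries D) (v : ℤ) :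
    Decays (rop X v D) :=
  (hX.adm.rop hD v).decays

variable [T2Space R] [Algebra ℂ R]

/-- Only one crossing takes place: the exponential `E'` of the second current has to move left past
the bare current `X`, which produces `g`. The exponential `E` is already in place, and the scalar
series commutes with it. -/
theorem dressed_left_mul {X Y : ℤ → R} (hX : Decays X) (hY : Decays Y) (E : PowerSeries R)
    {E' : PowerSeries R} {g : PowerSeries ℂ} (h : LeftExchange X E' g) :
    (fun k : ℤ × ℤ => lop E (-1) X k.1 * lop E' (-1) Y k.2) =
      lop (scal g) (1, -1) (lop E (-1, 0) (lop E' (0, -1) fun k => X k.1 * Y k.2)) := by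
  have hXY := adm_coneTwo_mul hX hY
  have hXb := adm_coneTwo_mul hX (hY.lop E')
  have e1 : (fun k : ℤ × ℤ => X k.1 * lop E' (-1) Y k.2) =
      lop (scal g) (1, -1) (lop E' (0, -1) fun k => X k.1 * Y k.2) := by
    have := mul_lop_exchange (F := fun k : ℤ × ℤ => X k.1) (G := fun k : ℤ × ℤ => Y k.2)
      (v := (0, -1)) (w := (1, 0)) (E := E') (g := g) hXY salient_coneTwo isDir_zero_neg_one
      (by simpa using isDir_one_neg_one) (fun k => by simpa using hY.summable k.2)
      (fun k => by simp) (fun k => by simp) (fun n k => by simpa using h n k.1)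
    rw [lop_snd] at this
    simpa using this
  have e2 : (fun k : ℤ × ℤ => lop E (-1) X k.1 * lop E' (-1) Y k.2) =
      lop E (-1, 0) fun k => X k.1 * lop E' (-1) Y k.2 := by
    have := lop_mul_right (F := fun k : ℤ × ℤ => X k.1) (v := (-1, 0))
      (G := fun k : ℤ × ℤ => lop E' (-1) Y k.2) (fun k => by simpa using hX.summable k.1) E
      (fun k => by simp)
    rw [← this, lop_fst]
  rw [e2, e1]
  exact lop_comm ((hXY.lop salient_coneTwo isDir_zero_neg_one E').summable_two salient_coneTwo
    isDir_neg_one_zero isDir_one_neg_one) fun m n => (commute_scal _ _ _ _).symm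

/-- The mirror image: the right dressing `D` of the first current crosses the bare current `Y`,
while `D'` already stands at the right end. -/
theorem dressed_right_mul {X Y : ℤ → R} (hX : Decays X) (hY : Decays Y) {D D' : PowerSeries R}
    (hD : NullSeries D) (hD' : NullSeries D') {g : PowerSeries ℂ} (h : RightExchange D Y g) :
    (fun k : ℤ × ℤ => rop X 1 D k.1 * rop Y 1 D' k.2) =
      lop (scal g) (1, -1) (rop (rop (fun k => X k.1 * Y k.2) (1, 0) D) (0, 1) D') := by
  have hXY := adm_coneTwo_mul hX hY
  have e1 : (fun k : ℤ × ℤ => rop X 1 D k.1 * rop Y 1 D' k.2) =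
      rop (fun k : ℤ × ℤ => rop X 1 D k.1 * Y k.2) (0, 1) D' := by
    have := mul_rop (F := fun k : ℤ × ℤ => Y k.2) (v := (0, 1))
      (G := fun k : ℤ × ℤ => rop X 1 D k.1) hD' (fun k => by simp)
    rw [← this, rop_snd]
  have e2 : (fun k : ℤ × ℤ => rop X 1 D k.1 * Y k.2) =
      lop (scal g) (1, -1) (rop (fun k => X k.1 * Y k.2) (1, 0) D) := by
    have := rop_mul_exchange (F := fun k : ℤ × ℤ => X k.1) (G := fun k : ℤ × ℤ => Y k.2)
      (v := (1, 0)) (w := (0, -1)) (D := D) (g := g) hD hXY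
      (by simpa using isDir_one_neg_one)
      (fun k => by simp) (fun k => by simp)
      (fun n k => by simpa [← sub_eq_add_neg] using h n k.2)
    rw [rop_fst] at this
    simpa using this
  rw [e1, e2]
  exact (lop_rop ((hXY.rop hD _).summable isDir_one_neg_one) _ hD' _).symm

theorem lop_scal_comm {Γ : Type*} [AddCommGroup Γ] {C : AddSubmonoid Γ} {F : Γ → R} {v w : Γ}
    (hF : Adm C F) (hC : Salient C) (hv : IsDir C v) (hw : IsDir C w) (g : PowerSeries ℂ)
    (D : PowerSeries R) : lop D v (lop (scal g) w F) = lop (scal g) w (lop D v F) :=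
  lop_comm (hF.summable_two hC hv hw) fun _ _ => (commute_scal _ _ _ _).symm

/-- There are three crossings: `E''` passes `Y` and then `X`, and `E'` passes `X`. Each contributes
its scalar series in the ratio of the two variables concerned. -/
theorem dressed_left_mul_mul {X Y Z : ℤ → R} (hX : Decays X) (hY : Decays Y) (hZ : Decays Z)
    (E : PowerSeries R) {E' E'' : PowerSeries R} {g₁₂ g₁₃ g₂₃ : PowerSeries ℂ}
    (h₁₂ : LeftExchange X E' g₁₂) (h₁₃ : LeftExchange X E'' g₁₃) (h₂₃ : LeftExchange Y E'' g₂₃) :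
    (fun k : ℤ × ℤ × ℤ => lop E (-1) X k.1 * (lop E' (-1) Y k.2.1 * lop E'' (-1) Z k.2.2)) =
      lop (scal g₁₂) (1, -1, 0) (lop (scal g₁₃) (1, 0, -1) (lop (scal g₂₃) (0, 1, -1)
        (lop E (-1, 0, 0) (lop E' (0, -1, 0) (lop E'' (0, 0, -1)
          fun k => X k.1 * (Y k.2.1 * Z k.2.2)))))) := by
  have hC := salient_coneThree
  have d12 : IsDir coneThree ((1, -1, 0) : ℤ × ℤ × ℤ) :=
    isDir_coneThree (by simp [mem_coneThree]) (by simp)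
  have d13 : IsDir coneThree ((1, 0, -1) : ℤ × ℤ × ℤ) :=
    isDir_coneThree (by simp [mem_coneThree]) (by simp)
  have d23 : IsDir coneThree ((0, 1, -1) : ℤ × ℤ × ℤ) :=
    isDir_coneThree (by simp [mem_coneThree]) (by simp)
  have d1 : IsDir coneThree ((-1, 0, 0) : ℤ × ℤ × ℤ) :=
    isDir_coneThree (by simp [mem_coneThree]) (by simp)
  have d2 : IsDir coneThree ((0, -1, 0) : ℤ × ℤ × ℤ) :=
    isDir_coneThree (by simp [mem_coneThree]) (by simp)
  have d3 : IsDir coneThree ((0, 0, -1) : ℤ × ℤ × ℤ) :=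
    isDir_coneThree (by simp [mem_coneThree]) (by simp)
  have hYZ := adm_coneTwo_mul hY hZ
  set W₂ : ℤ × ℤ → R := lop E'' (0, -1) fun q => Y q.1 * Z q.2 with hW₂
  have aW₂ : Adm coneTwo W₂ := hYZ.lop salient_coneTwo isDir_zero_neg_one E''
  set W₁ : ℤ × ℤ → R := lop E' (-1, 0) W₂ with hW₁
  have aW₁ : Adm coneTwo W₁ := aW₂.lop salient_coneTwo isDir_neg_one_zero E'
  have hW := dressed_left_mul hY hZ E' h₂₃
  rw [← hW₂, ← hW₁] at hW
  have hP := adm_coneThree_mul_left hX hYZ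
  set P : ℤ × ℤ × ℤ → R := fun k => X k.1 * (Y k.2.1 * Z k.2.2) with hPdef
  have e3 : (fun k : ℤ × ℤ × ℤ => X k.1 * W₂ k.2) =
      lop (scal g₁₃) (1, 0, -1) (lop E'' (0, 0, -1) P) := by
    have := mul_lop_exchange (F := fun k : ℤ × ℤ × ℤ => X k.1)
      (G := fun k : ℤ × ℤ × ℤ => Y k.2.1 * Z k.2.2) (v := (0, 0, -1)) (w := (1, 0, 0)) (E := E'')
      (g := g₁₃) hP hC d3 (by simpa using d13)
      (fun k => by simpa using hYZ.summable isDir_zero_neg_one k.2)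
      (fun k => by simp) (fun k => by simp) (fun n k => by simpa using h₁₃ n k.1)
    rw [lop_snd E'' (0, 0, -1) (fun q : ℤ × ℤ => Y q.1 * Z q.2)] at this
    simpa using this
  have e2 : (fun k : ℤ × ℤ × ℤ => X k.1 * W₁ k.2) =
      lop (scal g₁₂) (1, -1, 0) (lop E' (0, -1, 0) fun k => X k.1 * W₂ k.2) := by
    have := mul_lop_exchange (F := fun k : ℤ × ℤ × ℤ => X k.1)
      (G := fun k : ℤ × ℤ × ℤ => W₂ k.2) (v := (0, -1, 0)) (w := (1, 0, 0)) (E := E')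
      (g := g₁₂) (adm_coneThree_mul_left hX aW₂) hC d2 (by simpa using d12)
      (fun k => by simpa using aW₂.summable isDir_neg_one_zero k.2)
      (fun k => by simp) (fun k => congrArg W₂ (add_zero k.2))
      (fun n k => by simpa using h₁₂ n k.1)
    rw [lop_snd E' (0, -1, 0) W₂] at this
    simpa using this
  have e1 : (fun k : ℤ × ℤ × ℤ => X k.1 * lop (scal g₂₃) (1, -1) W₁ k.2) =
      lop (scal g₂₃) (0, 1, -1) fun k => X k.1 * W₁ k.2 := by
    have := mul_lop (F := fun k : ℤ × ℤ × ℤ => W₁ k.2) (G := fun k : ℤ × ℤ × ℤ => X k.1)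
      (v := (0, 1, -1)) (D := scal g₂₃) (fun k => by simpa using aW₁.summable isDir_one_neg_one k.2)
      (fun k => by simp) (fun n k => by
        simpa using commute_scal g₂₃ (PowerSeries.C (X k.1)) n 0)
    rw [lop_snd] at this
    simpa using this
  have e0 : (fun k : ℤ × ℤ × ℤ => lop E (-1) X k.1 *
        (lop E' (-1) Y k.2.1 * lop E'' (-1) Z k.2.2)) =
      lop E (-1, 0, 0) fun k => X k.1 * lop (scal g₂₃) (1, -1) W₁ k.2 := by
    have := lop_mul_right (F := fun k : ℤ × ℤ × ℤ => X k.1) (v := (-1, 0, 0))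
      (G := fun k : ℤ × ℤ × ℤ => lop (scal g₂₃) (1, -1) W₁ k.2)
      (fun k => by simpa using hX.summable k.1) E (fun k => congrArg _ (add_zero k.2))
    rw [← this, lop_fst, ← hW]
  have a3 := hP.lop hC d3 E''
  have a2 := a3.lop hC d2 E'
  -- The crossings produce scalar series between the exponentials; they are now moved outside one at
  -- a time, each interchange using the decay of its argument along the three-variable cone.
  rw [e0, e1, e2, e3, lop_scal_comm a3 hC d2 d13,
    lop_scal_comm ((a2.lop hC d13 _).lop hC d12 _) hC d1 d23,
    lop_scal_comm (a2.lop hC d13 _) hC d1 d12, lop_scal_comm a2 hC d1 d13]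
  have a1 := a2.lop hC d1 E
  rw [lop_scal_comm (a1.lop hC d13 _) hC d23 d12, lop_scal_comm a1 hC d23 d13]

/-- Here `D` passes `Y` and then `Z`, and `D'` passes `Z`. The scalar series are afterwards pulled
out of the right dressings. -/
theorem dressed_right_mul_mul {X Y Z : ℤ → R} (hX : Decays X) (hY : Decays Y) (hZ : Decays Z)
    {D D' D'' : PowerSeries R} (hD : NullSeries D) (hD' : NullSeries D') (hD'' : NullSeries D'')
    {g₁₂ g₁₃ g₂₃ : PowerSeries ℂ}
    (h₁₂ : RightExchange D Y g₁₂) (h₁₃ : RightExchange D Z g₁₃) (h₂₃ : RightExchange D' Z g₂₃) :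
    (fun k : ℤ × ℤ × ℤ => rop X 1 D k.1 * rop Y 1 D' k.2.1 * rop Z 1 D'' k.2.2) =
      lop (scal g₁₂) (1, -1, 0) (lop (scal g₁₃) (1, 0, -1) (lop (scal g₂₃) (0, 1, -1)
        (rop (rop (rop (fun k => X k.1 * Y k.2.1 * Z k.2.2) (1, 0, 0) D)
          (0, 1, 0) D') (0, 0, 1) D''))) := by
  have hC := salient_coneThree
  have d12 : IsDir coneThree ((1, -1, 0) : ℤ × ℤ × ℤ) :=
    isDir_coneThree (by simp [mem_coneThree]) (by simp)
  have d13 : IsDir coneThree ((1, 0, -1) : ℤ × ℤ × ℤ) :=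
    isDir_coneThree (by simp [mem_coneThree]) (by simp)
  have d23 : IsDir coneThree ((0, 1, -1) : ℤ × ℤ × ℤ) :=
    isDir_coneThree (by simp [mem_coneThree]) (by simp)
  have hXY := adm_coneTwo_mul hX hY
  set U : ℤ × ℤ → R := rop (fun q => X q.1 * Y q.2) (1, 0) D with hU
  have aU : Adm coneTwo U := hXY.rop hD _
  set V : ℤ × ℤ → R := rop U (0, 1) D' with hV
  have aV : Adm coneTwo V := aU.rop hD' _
  have hW := dressed_right_mul hX hY hD hD' h₁₂
  rw [← hU, ← hV] at hW
  have hP := adm_coneThree_mul_right hXY hZ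
  set P : ℤ × ℤ × ℤ → R := fun k => X k.1 * Y k.2.1 * Z k.2.2 with hPdef
  have e3 : (fun k : ℤ × ℤ × ℤ => U (k.1, k.2.1) * Z k.2.2) =
      lop (scal g₁₃) (1, 0, -1) (rop P (1, 0, 0) D) := by
    have := rop_mul_exchange (F := fun k : ℤ × ℤ × ℤ => X k.1 * Y k.2.1)
      (G := fun k : ℤ × ℤ × ℤ => Z k.2.2) (v := (1, 0, 0)) (w := (0, 0, -1)) (D := D)
      (g := g₁₃) hD hP (by simpa using d13) (fun k => by simp) (fun k => by simp)
      (fun n k => by simpa [← sub_eq_add_neg] using h₁₃ n k.2.2)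
    exact this.trans (by simp [hPdef])
  have e2 : (fun k : ℤ × ℤ × ℤ => V (k.1, k.2.1) * Z k.2.2) =
      lop (scal g₂₃) (0, 1, -1) (rop (fun k => U (k.1, k.2.1) * Z k.2.2) (0, 1, 0) D') := by
    have := rop_mul_exchange (F := fun k : ℤ × ℤ × ℤ => U (k.1, k.2.1))
      (G := fun k : ℤ × ℤ × ℤ => Z k.2.2) (v := (0, 1, 0)) (w := (0, 0, -1)) (D := D')
      (g := g₂₃) hD' (adm_coneThree_mul_right aU hZ) (by simpa using d23)
      (fun k => by simp) (fun k => by simp)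
      (fun n k => by simpa [← sub_eq_add_neg] using h₂₃ n k.2.2)
    exact this.trans (by simp)
  have e1 : (fun k : ℤ × ℤ × ℤ => lop (scal g₁₂) (1, -1) V (k.1, k.2.1) * Z k.2.2) =
      lop (scal g₁₂) (1, -1, 0) fun k => V (k.1, k.2.1) * Z k.2.2 :=
    lop_mul_right (F := fun k : ℤ × ℤ × ℤ => V (k.1, k.2.1)) (v := (1, -1, 0))
      (G := fun k : ℤ × ℤ × ℤ => Z k.2.2) (fun k => aV.summable isDir_one_neg_one (k.1, k.2.1)) _
      (fun k => by simp)
  have e0 : (fun k : ℤ × ℤ × ℤ => rop X 1 D k.1 * rop Y 1 D' k.2.1 * rop Z 1 D'' k.2.2) =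
      rop (fun k => lop (scal g₁₂) (1, -1) V (k.1, k.2.1) * Z k.2.2) (0, 0, 1) D'' := by
    have := mul_rop (F := fun k : ℤ × ℤ × ℤ => Z k.2.2) (v := (0, 0, 1))
      (G := fun k : ℤ × ℤ × ℤ => lop (scal g₁₂) (1, -1) V (k.1, k.2.1)) hD'' (fun k => by simp)
    rw [← this, ← hW]
    rfl
  have a1 := hP.rop hD (1, 0, 0)
  have a2 := a1.rop hD' (0, 1, 0)
  have a3 := (a2.lop hC d13 (scal g₁₃)).lop hC d23 (scal g₂₃)
  rw [e0, e1, e2, e3, ← lop_rop (a1.summable d13) _ hD', ← lop_rop (a3.summable d12) _ hD'',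
    ← lop_rop ((a2.lop hC d13 (scal g₁₃)).summable d23) _ hD'', ← lop_rop (a2.summable d13) _ hD'',
    lop_scal_comm (a2.rop hD'' _) hC d23 d13]

end NormalOrder

/-! ### Dressing by a Heisenberg algebra -/

section Operators

variable {R : Type*} [Ring R] [UniformSpace R]

theorem lop_X_pow {Γ : Type*} [AddCommGroup Γ] (v k : Γ) (n : ℕ) (F : Γ → R) :
    lop (PowerSeries.X ^ n) v F k = F (k + n • v) := by
  rw [lop, tsum_eq_single n]
  · simp
  · intro m hm; simp [PowerSeries.coeff_X_pow, hm]

theorem lop_swap (D : PowerSeries R) (v : ℤ × ℤ) (F : ℤ × ℤ → R) :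
    (fun k => lop D v F k.swap) = lop D v.swap fun k => F k.swap := rfl

theorem rop_swap (D : PowerSeries R) (v : ℤ × ℤ) (F : ℤ × ℤ → R) :
    (fun k => rop F v D k.swap) = rop (fun k => F k.swap) v.swap D := rfl

end Operators

section Heisenberg

variable {R : Type*} [Ring R] [Algebra ℂ R] {I : Type*}

/-- `exp (∑_{n > 0} x n H_{-n} z ^ n)`. -/
def expPlus (H : I → ℤ → R) (i : I) (x : ℕ → ℂ) : PowerSeries R :=
  expSeries fun n => x n • H i (-(n : ℤ))

/-- `exp (∑_{n > 0} y n H_n z ^ (-n))`, a power series in `z⁻¹`. -/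
def expMinus (H : I → ℤ → R) (i : I) (y : ℕ → ℂ) : PowerSeries R :=
  expSeries fun n => y n • H i (n : ℤ)

/-- `[H_n^i, X(z)] = χ i n z ^ n X(z)`. -/
def HasCharge (H : I → ℤ → R) (X : ℤ → R) (χ : I → ℤ → ℂ) : Prop :=
  ∀ i n, n ≠ 0 → ∀ k, H i n * X k - X k * H i n = χ i n • X (k - n)

variable [UniformSpace R]

/-- The commutation relations of a Heisenberg algebra, together with the decay of exponentials of
the annihilation operators. -/
structure IsHeisenberg (H : I → ℤ → R) (κ : I → I → ℤ → ℂ) : Prop where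
  comm : ∀ i j n m, n ≠ 0 → m ≠ 0 →
    H i n * H j m - H j m * H i n = if n + m = 0 then algebraMap ℂ R (κ i j n) else 0
  null : ∀ i y, NullSeries (expMinus H i y)

/-- The current `exp (∑_{n > 0} x n H_{-n} z ^ n) X(z) exp (∑_{n > 0} y n H_n z ^ (-n))`. -/
def dressed (H : I → ℤ → R) (i : I) (x y : ℕ → ℂ) (X : ℤ → R) : ℤ → R :=
  rop (lop (expPlus H i x) (-1) X) 1 (expMinus H i y)

/-- The dressing of a product of two currents with all creation operators to the left and all
annihilation operators to the right. -/
def normalOrder (H : I → ℤ → R) (i j : I) (x y x' y' : ℕ → ℂ) (P : ℤ × ℤ → R) : ℤ × ℤ → R :=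
  rop (rop (lop (expPlus H i x) (-1, 0) (lop (expPlus H j x') (0, -1) P)) (1, 0)
    (expMinus H i y)) (0, 1) (expMinus H j y')

variable {H : I → ℤ → R} {κ : I → I → ℤ → ℂ} (hH : IsHeisenberg H κ)

include hH

theorem IsHeisenberg.commute {i j : I} {n m : ℤ} (hn : n ≠ 0) (hm : m ≠ 0) (hnm : n + m ≠ 0) :
    Commute (H i n) (H j m) := by
  have := hH.comm i j n m hn hm
  rw [if_neg hnm] at this
  exact sub_eq_zero.mp this

theorem IsHeisenberg.commute_plus (i j : I) (x x' : ℕ → ℂ) (m n : ℕ) (hm : m ≠ 0) (hn : n ≠ 0) :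
    Commute (x m • H i (-(m : ℤ))) (x' n • H j (-(n : ℤ))) :=
  ((hH.commute (by omega) (by omega) (by omega)).smul_left _).smul_right _

theorem IsHeisenberg.commute_minus (i j : I) (x x' : ℕ → ℂ) (m n : ℕ) (hm : m ≠ 0) (hn : n ≠ 0) :
    Commute (x m • H i (m : ℤ)) (x' n • H j (n : ℤ)) :=
  ((hH.commute (by omega) (by omega) (by omega)).smul_left _).smul_right _

theorem IsHeisenberg.commute_expPlus (i j : I) (x x' : ℕ → ℂ) (m n : ℕ) :
    Commute (PowerSeries.coeff m (expPlus H i x)) (PowerSeries.coeff n (expPlus H j x')) :=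
  commute_expSeries (hH.commute_plus i j x x') m n

theorem IsHeisenberg.commute_expMinus (i j : I) (x x' : ℕ → ℂ) (m n : ℕ) :
    Commute (PowerSeries.coeff m (expMinus H i x)) (PowerSeries.coeff n (expMinus H j x')) :=
  commute_expSeries (hH.commute_minus i j x x') m n

/-- A creation mode H_{-n} shifts the coefficient index of X upwards by n, so X crosses the
exponential at the cost of exp of minus the weighted charges at -n. -/
theorem IsHeisenberg.leftExchange {X : ℤ → R} {χ : I → ℤ → ℂ} (hX : HasCharge H X χ) (j : I)
    (x : ℕ → ℂ) :
    LeftExchange X (expPlus H j x) (expSeries fun n => -(x n * χ j (-(n : ℤ)))) := by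
  intro n k
  refine (mul_coeff_expSeries (hH.commute_plus j j x x) (w := (1 : ℤ))
    (χ := fun n => x n * χ j (-(n : ℤ))) (fun m hm l => ?_) n k).trans (by simp [expPlus])
  rw [smul_mul_assoc, mul_smul_comm, ← smul_sub, hX j _ (by omega), smul_smul]
  simp

/-- Only the action of the positive modes is assumed. The lemma can therefore be applied to a
current that already carries its creation exponential, whose charge is modified by the Heisenberg
bracket. -/
theorem IsHeisenberg.rightExchange {Y : ℤ → R} {ψ : ℕ → ℂ} {i : I}
    (hY : ∀ n : ℕ, n ≠ 0 → ∀ k, H i n * Y k - Y k * H i n = ψ n • Y (k - n)) (y : ℕ → ℂ) :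
    RightExchange (expMinus H i y) Y (expSeries fun n => y n * ψ n) := by
  intro n k
  refine (coeff_expSeries_mul (hH.commute_minus i i y y) (w := (-1 : ℤ))
    (χ := fun n => y n * ψ n) (fun m hm l => ?_) n k).trans
      (by simp [expMinus, ← sub_eq_add_neg])
  rw [smul_mul_assoc, mul_smul_comm, ← smul_sub, hY m hm, smul_smul]
  simp [← sub_eq_add_neg]

variable [IsUniformAddGroup R] [IsLinearTopology R R] [CompleteSpace R] [IsTopologicalRing R]

theorem IsHeisenberg.adm_normalOrder {P : ℤ × ℤ → R} (hP : Adm coneTwo P) (i j : I)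
    (x y x' y' : ℕ → ℂ) : Adm coneTwo (normalOrder H i j x y x' y' P) :=
  (((hP.lop salient_coneTwo isDir_zero_neg_one _).lop salient_coneTwo isDir_neg_one_zero _).rop
    (hH.null i y) _).rop (hH.null j y') _

theorem IsHeisenberg.decays_dressed {X : ℤ → R} (hX : Decays X) (i : I) (x y : ℕ → ℂ) :
    Decays (dressed H i x y X) :=
  (hX.lop _).rop (hH.null i y) _

variable [T2Space R]

/-- The charge of a current after dressing by creation operators. -/
theorem IsHeisenberg.charge_lop {Y : ℤ → R} {χ : I → ℤ → ℂ} (hY : HasCharge H Y χ)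
    (hYd : Decays Y) (i j : I) (x : ℕ → ℂ) (n : ℕ) (hn : n ≠ 0) (k : ℤ) :
    H i n * lop (expPlus H j x) (-1) Y k - lop (expPlus H j x) (-1) Y k * H i n =
      (χ i n + x n * κ i j n) • lop (expPlus H j x) (-1) Y (k - n) := by
  set E := expPlus H j x with hE
  have hdir : IsDir coneOne (-1) := isDir_of_mem (by simp [mem_coneOne]) (by simp)
  have hs : ∀ (D : PowerSeries R) k, Summable fun a : ℕ =>
      PowerSeries.coeff a D * Y (k + a • (-1)) := fun D k => summable_mul_left _ (hYd.summable k)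
  -- Among the modes in the exponent only H_{-n} fails to commute with H_n, so the bracket of H_n
  -- with the exponential is a scalar times the n-th power of the variable times the exponential.
  -- This is the extra charge x_n κ.
  have hc := commutator_expSeries (hH.commute_plus j j x x) (x := H i n) (κ := x n * κ i j n) hn
    fun m hm => by
      rw [smul_mul_assoc, mul_smul_comm, ← smul_sub, hH.comm i j _ _ (by omega) (by omega)]
      by_cases h : m = n
      · subst h; simp [Algebra.smul_def]
      · rw [if_neg h, if_neg (by omega), smul_zero]
  change PowerSeries.C (H i n) * E - E * PowerSeries.C (H i n) = _ * _ * E at hc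
  have e1 : H i n * lop E (-1) Y k = lop (PowerSeries.C (H i n) * E) (-1) Y k := by
    rw [lop, lop, ← (hs E k).tsum_mul_left]
    simp only [PowerSeries.coeff_C_mul, mul_assoc]
  have e2 : lop E (-1) Y k * H i n = lop (E * PowerSeries.C (H i n)) (-1) Y k -
      χ i n • lop E (-1) Y (k - n) := by
    rw [Algebra.smul_def, lop, lop, lop, ← (hs E k).tsum_mul_right,
      ← (hs E (k - n)).tsum_mul_left, ← (hs _ k).tsum_sub ((hs E (k - n)).mul_left _)]
    refine tsum_congr fun a => ?_
    have := hY i n (by omega) (k + a • (-1))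
    rw [PowerSeries.coeff_mul_C, ← mul_assoc, Algebra.commutes, mul_assoc, mul_assoc, mul_assoc,
      ← mul_sub, ← Algebra.smul_def, show k - (n : ℤ) + a • (-1 : ℤ) = k + a • (-1) - n by ring,
      ← this]
    noncomm_ring
  have e3 : lop (PowerSeries.C (H i n) * E) (-1) Y k - lop (E * PowerSeries.C (H i n)) (-1) Y k =
      (x n * κ i j n) • lop E (-1) Y (k - n) := by
    trans lop (PowerSeries.C (algebraMap ℂ R (x n * κ i j n)) * PowerSeries.X ^ n * E) (-1) Y k
    · rw [← hc, lop, lop, lop, ← (hs _ k).tsum_sub (hs _ k)]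
      simp only [map_sub, sub_mul]
    · rw [mul_assoc, Algebra.smul_def, show k - (n : ℤ) = k + n • (-1 : ℤ) by simp; ring,
        ← lop_X_pow (-1) k n (lop E (-1) Y), lop_mul hYd.adm salient_coneOne hdir, lop, lop,
        ← (hs _ k).tsum_mul_left]
      simp only [PowerSeries.coeff_C_mul, mul_assoc]
  rw [e1, e2, add_smul, ← e3]
  noncomm_ring

/-- The scalar factor between the product and the normally ordered product of two dressed
currents. -/
def pairSeries (κ : I → I → ℤ → ℂ) (i j : I) (χ χ' : I → ℤ → ℂ) (y x' : ℕ → ℂ) :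
    PowerSeries ℂ :=
  expSeries (fun n => y n * (χ' i n + x' n * κ i j n)) *
    expSeries fun n => -(x' n * χ j (-(n : ℤ)))

/-- The contraction has two sources. The annihilation part of the first current crosses the second
bare current together with its creation part, giving the first factor of `pairSeries`; the creation
part of the second current crosses the first bare current, giving the second factor. -/
theorem IsHeisenberg.dressed_mul {X Y : ℤ → R} {χ χ' : I → ℤ → ℂ} (hX : HasCharge H X χ)
    (hY : HasCharge H Y χ') (hXd : Decays X) (hYd : Decays Y) (i j : I) (x y x' y' : ℕ → ℂ) :
    (fun k : ℤ × ℤ => dressed H i x y X k.1 * dressed H j x' y' Y k.2) =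
      lop (scal (pairSeries κ i j χ χ' y x')) (1, -1)
        (normalOrder H i j x y x' y' fun k => X k.1 * Y k.2) := by
  have hXY := adm_coneTwo_mul hXd hYd
  have h1 := dressed_left_mul hXd hYd (expPlus H i x) (hH.leftExchange hX j x')
  have h2 := dressed_right_mul (hXd.lop (expPlus H i x)) (hYd.lop (expPlus H j x')) (hH.null i y)
    (hH.null j y') (hH.rightExchange (hH.charge_lop hY hYd i j x') y)
  have a1 := (hXY.lop salient_coneTwo isDir_zero_neg_one (expPlus H j x')).lop salient_coneTwo
    isDir_neg_one_zero (expPlus H i x)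
  refine h2.trans ?_
  rw [h1, ← lop_rop (a1.summable isDir_one_neg_one) _ (hH.null i y),
    ← lop_rop ((a1.rop (hH.null i y) _).summable isDir_one_neg_one) _ (hH.null j y'),
    lop_mul ((a1.rop (hH.null i y) _).rop (hH.null j y') _) salient_coneTwo isDir_one_neg_one,
    ← scal_mul]
  rfl

/-- Creation exponentials commute with each other, and so do annihilation exponentials. A normally
ordered product thus remembers the order of the two currents only through the bare product `P`. -/
theorem IsHeisenberg.normalOrder_swap {P : ℤ × ℤ → R} (hP : Adm coneTwo P) (i j : I)
    (x y x' y' : ℕ → ℂ) (k : ℤ × ℤ) :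
    normalOrder H j i x' y' x y P k.swap = normalOrder H i j x y x' y' (fun k => P k.swap) k := by
  have h := congrFun (rop_swap (expMinus H i y) (0, 1) (rop (lop (expPlus H j x') (-1, 0)
    (lop (expPlus H i x) (0, -1) P)) (1, 0) (expMinus H j y'))) k
  refine h.trans ?_
  rw [rop_swap, lop_swap, lop_swap, rop_comm (hH.null j y') (hH.null i y)
    (hH.commute_expMinus j i y' y), lop_comm (fun k => ?_)
    (hH.commute_expPlus j i x' x)]
  · rfl
  · simpa using hP.summable_two salient_coneTwo isDir_neg_one_zero isDir_zero_neg_one k.swap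

/-- By the symmetry of normal ordering, both orders of the bare currents are dressed by the same
four exponentials, applied one after the other; each of them preserves the given relation. -/
theorem IsHeisenberg.normalOrder_exchange {X Y : ℤ → R} (hX : Decays X) (hY : Decays Y) (i j : I)
    (x y x' y' : ℕ → ℂ) {α β γ δ : ℂ}
    (h : ∀ k l, α • (X k * Y l) + β • (X (k - 1) * Y (l + 1)) =
      γ • (Y l * X k) + δ • (Y (l + 1) * X (k - 1))) (k l : ℤ) :
    α • normalOrder H i j x y x' y' (fun k => X k.1 * Y k.2) (k, l) +
        β • normalOrder H i j x y x' y' (fun k => X k.1 * Y k.2) (k - 1, l + 1) =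
      γ • normalOrder H j i x' y' x y (fun k => Y k.1 * X k.2) (l, k) +
        δ • normalOrder H j i x' y' x y (fun k => Y k.1 * X k.2) (l + 1, k - 1) := by
  have hXY := adm_coneTwo_mul hX hY
  have hYX := adm_coneTwo_mul hY hX
  have e1 := hH.normalOrder_swap hYX i j x y x' y' (k, l)
  have e2 := hH.normalOrder_swap hYX i j x y x' y' (k - 1, l + 1)
  simp only [Prod.swap_prod_mk, Prod.fst_swap, Prod.snd_swap] at e1 e2
  rw [e1, e2]
  set P : ℤ × ℤ → R := fun q => X q.1 * Y q.2 with hP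
  set Q : ℤ × ℤ → R := fun q => Y q.2 * X q.1 with hQ
  -- `Q` decays along the cone with the two variables exchanged. Its decay in the two directions
  -- (-1, 0) and (0, -1), shared by both cones, is all that the creation exponentials need.
  have hQ2 : ∀ k : ℤ × ℤ, Summable fun p : ℕ × ℕ => Q (k + p.1 • (-1, 0) + p.2 • (0, -1)) :=
    fun k => by
      have := hYX.summable_two salient_coneTwo isDir_zero_neg_one isDir_neg_one_zero k.swap
      simpa [hQ] using this
  have hP1 : ∀ k, Summable fun n : ℕ => P (k + n • (0, -1)) :=
    fun k => Adm.summable (F := P) hXY isDir_zero_neg_one k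
  have hQ1 : ∀ k, Summable fun n : ℕ => Q (k + n • (0, -1)) :=
    fun k => by simpa using (hQ2 k).prod_factor 0
  have hP2 : ∀ k, Summable fun n : ℕ => lop (expPlus H j x') (0, -1) P (k + n • (-1, 0)) :=
    fun k => (Adm.lop (F := P) hXY salient_coneTwo isDir_zero_neg_one _).summable
      isDir_neg_one_zero k
  have hQ3 : ∀ k, Summable fun n : ℕ => lop (expPlus H j x') (0, -1) Q (k + n • (-1, 0)) :=
    fun k => (summable_mul_left (fun p : ℕ × ℕ => PowerSeries.coeff p.2 (expPlus H j x'))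
      (hQ2 k)).prod
  have h1 : ∀ q : ℤ × ℤ, α • P q + β • P (q + (-1, 1)) = γ • Q q + δ • Q (q + (-1, 1)) :=
    fun q => by simpa [hP, hQ, sub_eq_add_neg] using h q.1 q.2
  have h2 := lop_linear hP1 hQ1 (expPlus H j x') h1
  have h3 := lop_linear hP2 hQ3 (expPlus H i x) h2
  have h4 := rop_linear (v := (1, 0)) (hH.null i y) h3
  have h5 := rop_linear (v := (0, 1)) (hH.null j y') h4 (k, l)
  simpa only [normalOrder, Prod.mk_add_mk, ← sub_eq_add_neg] using h5

end Heisenberg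

/-! ### Triple series -/

theorem hasSum_congr {ι α : Type*} [AddCommMonoid α] [TopologicalSpace α] {f g : ι → α} {a : α}
    (h : ∀ i, f i = g i) : HasSum f a ↔ HasSum g a := by rw [funext h]

section Triple

variable {R : Type*} [Ring R] [UniformSpace R] [IsUniformAddGroup R] [IsLinearTopology R R]
  [CompleteSpace R] [IsTopologicalRing R] [T2Space R]

theorem lop_lop_lop {Γ : Type*} [AddCommGroup Γ] {F : Γ → R} {u v w : Γ}
    (hF : ∀ k, Summable fun p : ℕ × ℕ × ℕ => F (k + p.1 • u + p.2.1 • v + p.2.2 • w))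
    (D E G : PowerSeries R) (k : Γ) :
    lop D u (lop E v (lop G w F)) k = ∑' p : ℕ × ℕ × ℕ,
      PowerSeries.coeff p.1 D * PowerSeries.coeff p.2.1 E * PowerSeries.coeff p.2.2 G *
        F (k + p.1 • u + p.2.1 • v + p.2.2 • w) := by
  have h1 : ∀ k, Summable fun p : ℕ × ℕ => F (k + p.1 • v + p.2 • w) := fun k => by
    simpa using (hF k).prod_factor 0
  rw [(summable_mul_left _ (hF k)).tsum_prod]
  refine tsum_congr fun n => ?_
  rw [lop_lop h1, ← (summable_mul_left (fun p : ℕ × ℕ => PowerSeries.coeff p.1 E *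
    PowerSeries.coeff p.2 G) (h1 (k + n • u))).tsum_mul_left]
  simp only [mul_assoc]

omit [T2Space R] in
theorem summable_rop_rop_rop {Γ : Type*} [AddCommGroup Γ] {D E G : PowerSeries R}
    (hD : NullSeries D) (hE : NullSeries E) (hG : NullSeries G) (F : Γ → R) (u v w k : Γ) :
    Summable fun p : (ℕ × ℕ) × ℕ => F (k + p.1.1 • u + p.1.2 • v + p.2 • w) *
      (PowerSeries.coeff p.1.1 D * PowerSeries.coeff p.1.2 E * PowerSeries.coeff p.2 G) := by
  have h : Summable fun p : (ℕ × ℕ) × ℕ =>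
      F (k + p.1.1 • u + p.1.2 • v + p.2 • w) * PowerSeries.coeff p.1.1 D *
        PowerSeries.coeff p.1.2 E * PowerSeries.coeff p.2 G :=
    summable_prod_of_null (g := fun n => PowerSeries.coeff n G)
      (f := fun (p : ℕ × ℕ) n => F (k + p.1 • u + p.2 • v + n • w) * PowerSeries.coeff p.1 D *
        PowerSeries.coeff p.2 E) hG fun n => by
          have := (summable_rop_rop hD hE F u v (k + n • w)).mul_right (PowerSeries.coeff n G)
          refine this.congr fun p => ?_
          rw [show k + n • w + p.1 • u + p.2 • v = k + p.1 • u + p.2 • v + n • w by abel]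
  simpa only [mul_assoc] using h

theorem rop_rop_rop {Γ : Type*} [AddCommGroup Γ] {D E G : PowerSeries R}
    (hD : NullSeries D) (hE : NullSeries E) (hG : NullSeries G) (F : Γ → R) (u v w k : Γ) :
    rop (rop (rop F u D) v E) w G k = ∑' p : (ℕ × ℕ) × ℕ,
      F (k + p.1.1 • u + p.1.2 • v + p.2 • w) *
        (PowerSeries.coeff p.1.1 D * PowerSeries.coeff p.1.2 E * PowerSeries.coeff p.2 G) := by
  rw [tsum_prod_swap (summable_rop_rop_rop hD hE hG F u v w k)]
  refine tsum_congr fun n => ?_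
  rw [rop_rop hD hE, ← (summable_rop_rop hD hE F u v (k + n • w)).tsum_mul_right]
  refine tsum_congr fun p => ?_
  rw [show k + n • w + p.1 • u + p.2 • v = k + p.1 • u + p.2 • v + n • w by abel]
  simp only [mul_assoc]

theorem hasSum_lop_three {A B C : ℤ → R} (hA : Decays A) (hB : Decays B) (hC : Decays C)
    (D₁ D₂ D₃ : PowerSeries R) (k : ℤ × ℤ × ℤ) :
    HasSum (fun p : ℕ × ℕ × ℕ => PowerSeries.coeff p.1 D₁ * PowerSeries.coeff p.2.1 D₂ *
        PowerSeries.coeff p.2.2 D₃ * (A (k.1 - p.1) * (B (k.2.1 - p.2.1) * C (k.2.2 - p.2.2))))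
      (lop D₁ (-1, 0, 0) (lop D₂ (0, -1, 0) (lop D₃ (0, 0, -1)
        fun k => A k.1 * (B k.2.1 * C k.2.2))) k) := by
  have hP := adm_coneThree_mul_left hA (adm_coneTwo_mul hB hC)
  set F : ℤ × ℤ × ℤ → R := fun k => A k.1 * (B k.2.1 * C k.2.2) with hF
  have hs : ∀ k, Summable fun p : ℕ × ℕ × ℕ =>
      F (k + p.1 • (-1, 0, 0) + p.2.1 • (0, -1, 0) + p.2.2 • (0, 0, -1)) :=
    fun k => hP.summable_three salient_coneThree
      (isDir_coneThree (by simp [mem_coneThree]) (by simp))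
      (isDir_coneThree (by simp [mem_coneThree]) (by simp))
      (isDir_coneThree (by simp [mem_coneThree]) (by simp)) k
  rw [lop_lop_lop hs]
  have := (summable_mul_left (fun p : ℕ × ℕ × ℕ => PowerSeries.coeff p.1 D₁ *
    PowerSeries.coeff p.2.1 D₂ * PowerSeries.coeff p.2.2 D₃) (hs k)).hasSum
  refine (hasSum_congr fun p => ?_).mp this
  simp [hF, sub_eq_add_neg]

theorem hasSum_rop_three {D₁ D₂ D₃ : PowerSeries R} (h₁ : NullSeries D₁) (h₂ : NullSeries D₂)
    (h₃ : NullSeries D₃) (F : ℤ × ℤ × ℤ → R) (k : ℤ × ℤ × ℤ) :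
    HasSum (fun p : (ℕ × ℕ) × ℕ => F (k.1 + p.1.1, k.2.1 + p.1.2, k.2.2 + p.2) *
      (PowerSeries.coeff p.1.1 D₁ * PowerSeries.coeff p.1.2 D₂ * PowerSeries.coeff p.2 D₃))
      (rop (rop (rop F (1, 0, 0) D₁) (0, 1, 0) D₂) (0, 0, 1) D₃ k) := by
  rw [rop_rop_rop h₁ h₂ h₃]
  refine (hasSum_congr fun p => ?_).mp (summable_rop_rop_rop h₁ h₂ h₃ F _ _ _ k).hasSum
  congr 2
  simp [Prod.ext_iff]

variable [Algebra ℂ R]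

/-- The cubic expression in the Serre relations. -/
def serreSum (t : ℂ) (X Y : ℤ → R) (k₁ k₂ l : ℤ) : R :=
  Y l * X k₁ * X k₂ - t • (X k₁ * Y l * X k₂) + X k₁ * X k₂ * Y l

/-- The Serre relations are preserved by a dressing from the left. -/
theorem serre_lop {X Y : ℤ → R} (hX : Decays X) (hY : Decays Y) {t : ℂ}
    (h : ∀ k₁ k₂ l, serreSum t X Y k₁ k₂ l + serreSum t X Y k₂ k₁ l = 0) {E E' : PowerSeries R}
    (hEE : ∀ m n, Commute (PowerSeries.coeff m E) (PowerSeries.coeff n E))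
    (hEE' : ∀ m n, Commute (PowerSeries.coeff m E) (PowerSeries.coeff n E'))
    (T₁ T₂ T₃ : ℤ × ℤ × ℤ → R)
    (h₁ : T₁ = lop E' (-1, 0, 0) (lop E (0, -1, 0) (lop E (0, 0, -1)
      fun k => Y k.1 * (X k.2.1 * X k.2.2))))
    (h₂ : T₂ = lop E (-1, 0, 0) (lop E' (0, -1, 0) (lop E (0, 0, -1)
      fun k => X k.1 * (Y k.2.1 * X k.2.2))))
    (h₃ : T₃ = lop E (-1, 0, 0) (lop E (0, -1, 0) (lop E' (0, 0, -1)
      fun k => X k.1 * (X k.2.1 * Y k.2.2)))) (k₁ k₂ l : ℤ) :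
    T₁ (l, k₁, k₂) - t • T₂ (k₁, l, k₂) + T₃ (k₁, k₂, l) +
      (T₁ (l, k₂, k₁) - t • T₂ (k₂, l, k₁) + T₃ (k₂, k₁, l)) = 0 := by
  have key : ∀ k₁ k₂, HasSum (fun p : ℕ × ℕ × ℕ =>
      PowerSeries.coeff p.1 E * PowerSeries.coeff p.2.1 E * PowerSeries.coeff p.2.2 E' *
        serreSum t X Y (k₁ - p.1) (k₂ - p.2.1) (l - p.2.2))
      (T₁ (l, k₁, k₂) - t • T₂ (k₁, l, k₂) + T₃ (k₁, k₂, l)) := by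
    intro k₁ k₂
    rw [h₁, h₂, h₃]
    -- The three orderings list the variables differently. The permutations make `p.1`, `p.2.1`,
    -- `p.2.2` belong to z₁, z₂, w throughout, so that commuting coefficients form one common
    -- factor.
    let e₁ : ℕ × ℕ × ℕ ≃ ℕ × ℕ × ℕ := ⟨fun p => (p.2.2, p.1, p.2.1),
      fun p => (p.2.1, p.2.2, p.1), fun _ => rfl, fun _ => rfl⟩
    let e₂ : ℕ × ℕ × ℕ ≃ ℕ × ℕ × ℕ := ⟨fun p => (p.1, p.2.2, p.2.1),
      fun p => (p.1, p.2.2, p.2.1), fun _ => rfl, fun _ => rfl⟩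
    have s1 := e₁.hasSum_iff.mpr (hasSum_lop_three hY hX hX E' E E (l, k₁, k₂))
    have s2 := (e₂.hasSum_iff.mpr (hasSum_lop_three hX hY hX E E' E (k₁, l, k₂))).const_smul t
    have s3 := hasSum_lop_three hX hX hY E E E' (k₁, k₂, l)
    refine (hasSum_congr fun p => ?_).mp ((s1.sub s2).add s3)
    have c1 := (hEE' p.1 p.2.2).eq
    have c2 := (hEE' p.2.1 p.2.2).eq
    simp only [Function.comp, e₁, e₂, Equiv.coe_fn_mk, serreSum, mul_add, mul_sub, mul_smul_comm,
      mul_assoc, c2]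
    simp only [← mul_assoc, c1]
  -- The term with z₁ and z₂ exchanged is reindexed so as to carry the same coefficient as the first
  -- one; the sum of the two then vanishes term by term.
  have key2 : HasSum (fun p : ℕ × ℕ × ℕ =>
      PowerSeries.coeff p.1 E * PowerSeries.coeff p.2.1 E * PowerSeries.coeff p.2.2 E' *
        serreSum t X Y (k₂ - p.2.1) (k₁ - p.1) (l - p.2.2))
      (T₁ (l, k₂, k₁) - t • T₂ (k₂, l, k₁) + T₃ (k₂, k₁, l)) := by
    let e : ℕ × ℕ × ℕ ≃ ℕ × ℕ × ℕ := ⟨fun p => (p.2.1, p.1, p.2.2),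
      fun p => (p.2.1, p.1, p.2.2), fun _ => rfl, fun _ => rfl⟩
    refine (hasSum_congr fun p => ?_).mp (e.hasSum_iff.mpr (key k₂ k₁))
    simp only [Function.comp, e, Equiv.coe_fn_mk, (hEE p.1 p.2.1).eq]
  refine ((key k₁ k₂).add key2).unique ((hasSum_congr fun p => ?_).mp hasSum_zero)
  rw [← mul_add, h, mul_zero]

/-- The Serre relations are preserved by a dressing from the right. -/
theorem serre_rop {X Y : ℤ → R} {t : ℂ}
    (h : ∀ k₁ k₂ l, serreSum t X Y k₁ k₂ l + serreSum t X Y k₂ k₁ l = 0) {D D' : PowerSeries R}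
    (hD : NullSeries D) (hD' : NullSeries D')
    (hDD : ∀ m n, Commute (PowerSeries.coeff m D) (PowerSeries.coeff n D))
    (hDD' : ∀ m n, Commute (PowerSeries.coeff m D) (PowerSeries.coeff n D'))
    (T₁ T₂ T₃ : ℤ × ℤ × ℤ → R)
    (h₁ : T₁ = rop (rop (rop (fun k => Y k.1 * X k.2.1 * X k.2.2)
      (1, 0, 0) D') (0, 1, 0) D) (0, 0, 1) D)
    (h₂ : T₂ = rop (rop (rop (fun k => X k.1 * Y k.2.1 * X k.2.2)
      (1, 0, 0) D) (0, 1, 0) D') (0, 0, 1) D)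
    (h₃ : T₃ = rop (rop (rop (fun k => X k.1 * X k.2.1 * Y k.2.2)
      (1, 0, 0) D) (0, 1, 0) D) (0, 0, 1) D') (k₁ k₂ l : ℤ) :
    T₁ (l, k₁, k₂) - t • T₂ (k₁, l, k₂) + T₃ (k₁, k₂, l) +
      (T₁ (l, k₂, k₁) - t • T₂ (k₂, l, k₁) + T₃ (k₂, k₁, l)) = 0 := by
  have key : ∀ k₁ k₂, HasSum (fun p : (ℕ × ℕ) × ℕ =>
      serreSum t X Y (k₁ + p.1.1) (k₂ + p.1.2) (l + p.2) *
      (PowerSeries.coeff p.1.1 D * PowerSeries.coeff p.1.2 D * PowerSeries.coeff p.2 D'))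
      (T₁ (l, k₁, k₂) - t • T₂ (k₁, l, k₂) + T₃ (k₁, k₂, l)) := by
    intro k₁ k₂
    rw [h₁, h₂, h₃]
    let e₁ : (ℕ × ℕ) × ℕ ≃ (ℕ × ℕ) × ℕ := ⟨fun p => ((p.2, p.1.1), p.1.2),
      fun p => ((p.1.2, p.2), p.1.1), fun _ => rfl, fun _ => rfl⟩
    let e₂ : (ℕ × ℕ) × ℕ ≃ (ℕ × ℕ) × ℕ := ⟨fun p => ((p.1.1, p.2), p.1.2),
      fun p => ((p.1.1, p.2), p.1.2), fun _ => rfl, fun _ => rfl⟩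
    have s1 := e₁.hasSum_iff.mpr (hasSum_rop_three hD' hD hD
      (fun k => Y k.1 * X k.2.1 * X k.2.2) (l, k₁, k₂))
    have s2 := (e₂.hasSum_iff.mpr (hasSum_rop_three hD hD' hD
      (fun k => X k.1 * Y k.2.1 * X k.2.2) (k₁, l, k₂))).const_smul t
    have s3 := hasSum_rop_three hD hD hD' (fun k => X k.1 * X k.2.1 * Y k.2.2) (k₁, k₂, l)
    refine (hasSum_congr fun p => ?_).mp ((s1.sub s2).add s3)
    have c1 := (hDD' p.1.1 p.2).eq
    have c2 := (hDD' p.1.2 p.2).eq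
    simp only [Function.comp, e₁, e₂, Equiv.coe_fn_mk, serreSum, add_mul, sub_mul, smul_mul_assoc,
      mul_assoc, c2]
    simp only [← mul_assoc (PowerSeries.coeff _ D) (PowerSeries.coeff _ D'), c1, mul_assoc]
  have key2 : HasSum (fun p : (ℕ × ℕ) × ℕ =>
      serreSum t X Y (k₂ + p.1.2) (k₁ + p.1.1) (l + p.2) *
      (PowerSeries.coeff p.1.1 D * PowerSeries.coeff p.1.2 D * PowerSeries.coeff p.2 D'))
      (T₁ (l, k₂, k₁) - t • T₂ (k₂, l, k₁) + T₃ (k₂, k₁, l)) := by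
    let e : (ℕ × ℕ) × ℕ ≃ (ℕ × ℕ) × ℕ := ⟨fun p => ((p.1.2, p.1.1), p.2),
      fun p => ((p.1.2, p.1.1), p.2), fun _ => rfl, fun _ => rfl⟩
    refine (hasSum_congr fun p => ?_).mp (e.hasSum_iff.mpr (key k₂ k₁))
    simp only [Function.comp, e, Equiv.coe_fn_mk, (hDD p.1.1 p.1.2).eq]
  refine ((key k₁ k₂).add key2).unique ((hasSum_congr fun p => ?_).mp hasSum_zero)
  rw [← add_mul, h, zero_mul]

end Triple

/-! ### Logarithms of scalar power series -/

section Scalar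

theorem expSeries_congr {A : Type*} [Ring A] [Algebra ℂ A] {s t : ℕ → A}
    (h : ∀ n, n ≠ 0 → s n = t n) : expSeries s = expSeries t := by
  have : posSeries s = posSeries t := by
    ext n
    simp only [coeff_posSeries]
    split_ifs with hn
    · rfl
    · exact h n hn
  rw [expSeries, this, expSeries]

theorem expSeries_zero {A : Type*} [Ring A] [Algebra ℂ A] :
    expSeries (fun _ => (0 : A)) = 1 := by
  have h : posSeries (fun _ => (0 : A)) = 0 := by ext n; simp
  ext n
  rw [expSeries, h, fexp, PowerSeries.coeff_mk, Finset.sum_eq_single 0]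
  · simp
  · intro k _ hk; simp [hk]
  · simp

theorem expSeries_add (s t : ℕ → ℂ) :
    expSeries s * expSeries t = expSeries (fun n => s n + t n) :=
  expSeries_mul (fun _ _ _ _ => Commute.all _ _) (fun _ _ _ _ => Commute.all _ _)
    fun _ _ _ _ => Commute.all _ _

theorem expSeries_inv (s : ℕ → ℂ) : (expSeries s)⁻¹ = expSeries fun n => -s n := by
  have h0 : PowerSeries.constantCoeff (expSeries s) ≠ 0 := by
    rw [← PowerSeries.coeff_zero_eq_constantCoeff_apply, coeff_zero_expSeries]; exact one_ne_zero
  have h : expSeries (fun n => -s n) * expSeries s = 1 := by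
    rw [expSeries_add]
    simp [expSeries_zero]
  exact ((PowerSeries.eq_inv_iff_mul_eq_one h0).mpr h).symm

theorem rescale_expSeries (t : ℂ) (s : ℕ → ℂ) :
    PowerSeries.rescale t (expSeries s) = expSeries fun n => t ^ n * s n := by
  have h : PowerSeries.rescale t (posSeries s) = posSeries fun n => t ^ n * s n := by
    ext n; simp [PowerSeries.coeff_rescale]
  ext n
  rw [expSeries, expSeries, ← h, PowerSeries.coeff_rescale, fexp, fexp, PowerSeries.coeff_mk,
    PowerSeries.coeff_mk, Finset.mul_sum]
  refine Finset.sum_congr rfl fun k _ => ?_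
  rw [← map_pow, PowerSeries.coeff_rescale]
  simp only [smul_eq_mul]
  ring

/-- The logarithmic derivative of 1 - uX is minus the sum of u^m X^m over m > 0, which is also the
Euler derivative of the exponent. -/
theorem one_sub_C_mul_X (u : ℂ) :
    1 - PowerSeries.C u * PowerSeries.X = expSeries fun n : ℕ => -(u ^ n / n) := by
  refine eq_of_eulerD (L := eulerD (posSeries fun n : ℕ => -(u ^ n / n))) (by simp) ?_
    (eulerD_expSeries fun _ _ _ _ => Commute.all _ _) (by simp)
  ext n
  have hc : ∀ m : ℕ, PowerSeries.coeff m (eulerD (posSeries fun n : ℕ => -(u ^ n / n))) =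
      if m = 0 then 0 else -u ^ m := fun m => by
    rw [coeff_eulerD, coeff_posSeries]
    split_ifs with hm
    · simp
    · have : (m : ℂ) ≠ 0 := by exact_mod_cast hm
      field_simp
  rw [mul_sub, mul_one, ← mul_assoc, mul_comm _ (PowerSeries.C u), mul_assoc, map_sub,
    PowerSeries.coeff_C_mul, coeff_eulerD]
  rcases n with _ | n
  · simp [hc]
  · rw [PowerSeries.coeff_succ_mul_X, hc, hc, map_sub, PowerSeries.coeff_one,
      PowerSeries.coeff_C_mul, PowerSeries.coeff_X]
    rcases n with _ | n
    · simp
    · simp; ring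

/-- A finite subproduct of the terms -u t^n X is a monomial, so each coefficient of the expanded
product is dominated by products of a geometric, hence absolutely summable, sequence. -/
theorem multipliable_qPochSeries {t : ℂ} (ht : ‖t‖ < 1) (u : ℂ) :
    Multipliable fun n : ℕ => (1 - PowerSeries.C (u * t ^ n) * PowerSeries.X : PowerSeries ℂ) := by
  simp only [sub_eq_add_neg]
  refine multipliable_one_add_of_summable_prod
    ((PowerSeries.WithPiTopology.summable_iff_summable_coeff _).mpr fun d => ?_)
  have hs : Summable fun n : ℕ => ‖-(u * t ^ n)‖ := by
    simp only [norm_neg, norm_mul, norm_pow]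
    exact (summable_geometric_of_lt_one (norm_nonneg t) ht).mul_left _
  have hp : ∀ s : Finset ℕ, ∏ i ∈ s, -(PowerSeries.C (u * t ^ i) * PowerSeries.X) =
      (PowerSeries.C (∏ i ∈ s, -(u * t ^ i)) * PowerSeries.X ^ s.card : PowerSeries ℂ) := by
    intro s
    rw [map_prod, ← Finset.prod_const, ← Finset.prod_mul_distrib]
    simp
  refine Summable.of_norm_bounded (g := fun s : Finset ℕ => ‖∏ i ∈ s, -(u * t ^ i)‖)
    (summable_finsetProd_of_summable_norm hs).norm fun s => ?_
  rw [hp, PowerSeries.coeff_C_mul, PowerSeries.coeff_X_pow]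
  split_ifs
  · simp
  · rw [mul_zero, norm_zero]; exact norm_nonneg _

/-- Both sides have constant term 1 and satisfy P(X) = (1 - uX) P(tX). This equation determines the
coefficients successively, because 1 - t^n ≠ 0 for n > 0. The exponential satisfies it since 1/(1 -
t^n) - t^n/(1 - t^n) = 1. -/
theorem qPochSeries_eq_expSeries {t : ℂ} (ht : ‖t‖ < 1) (u : ℂ) :
    qPochSeries t u = expSeries fun n : ℕ => -(u ^ n / (n * (1 - t ^ n))) := by
  have hm := multipliable_qPochSeries ht u
  have hcont : Continuous (PowerSeries.rescale t : PowerSeries ℂ →+* PowerSeries ℂ) := by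
    refine continuous_pi fun d => ?_
    exact continuous_const.mul (PowerSeries.WithPiTopology.continuous_coeff ℂ (d ()))
  have h0 : PowerSeries.coeff 0 (qPochSeries t u) = 1 := by
    rw [PowerSeries.coeff_zero_eq_constantCoeff_apply, qPochSeries,
      hm.map_tprod _ (PowerSeries.WithPiTopology.continuous_constantCoeff ℂ)]
    simp
  have hr : qPochSeries t u =
      (1 - PowerSeries.C u * PowerSeries.X) * PowerSeries.rescale t (qPochSeries t u) := by
    have hC : ∀ a : ℂ, PowerSeries.rescale t (PowerSeries.C a) = PowerSeries.C a := fun a => by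
      ext n
      rw [PowerSeries.coeff_rescale, PowerSeries.coeff_C]
      split_ifs with h <;> simp [h]
    have e : ∀ n : ℕ, PowerSeries.rescale t (1 - PowerSeries.C (u * t ^ n) * PowerSeries.X) =
        (1 - PowerSeries.C (u * t ^ (n + 1)) * PowerSeries.X : PowerSeries ℂ) := fun n => by
      rw [map_sub, map_one, map_mul, PowerSeries.rescale_X, ← mul_assoc, hC,
        ← map_mul, pow_succ, mul_assoc u]
    have hm' : Multipliable fun n : ℕ =>
        (1 - PowerSeries.C (u * t ^ (n + 1)) * PowerSeries.X : PowerSeries ℂ) := by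
      refine (multipliable_qPochSeries ht (u * t)).congr fun n => ?_
      rw [pow_succ', mul_assoc u]
    have h1 := hm.map_tprod (PowerSeries.rescale t) hcont
    have h2 := tprod_eq_zero_mul'
      (f := fun n : ℕ => (1 - PowerSeries.C (u * t ^ n) * PowerSeries.X : PowerSeries ℂ)) hm'
    rw [pow_zero, mul_one, ← tprod_congr e, ← h1] at h2
    exact h2
  have ht' : ∀ n : ℕ, n ≠ 0 → 1 - t ^ n ≠ 0 := fun n hn h => by
    have := pow_lt_one₀ (norm_nonneg t) ht hn
    rw [← norm_pow, ← sub_eq_zero.mp h, norm_one] at this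
    exact lt_irrefl _ this
  set Q := expSeries fun n : ℕ => -(u ^ n / (n * (1 - t ^ n))) with hQ
  have hQr : Q = (1 - PowerSeries.C u * PowerSeries.X) * PowerSeries.rescale t Q := by
    rw [hQ, rescale_expSeries, one_sub_C_mul_X, expSeries_add]
    refine expSeries_congr fun n hn => ?_
    have h1 : (n : ℂ) ≠ 0 := by exact_mod_cast hn
    have h2 := ht' n hn
    field_simp
    ring
  have hrec : ∀ {P : PowerSeries ℂ}, P = (1 - PowerSeries.C u * PowerSeries.X) *
      PowerSeries.rescale t P → ∀ n : ℕ, PowerSeries.coeff (n + 1) P * (1 - t ^ (n + 1)) =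
        -(u * (t ^ n * PowerSeries.coeff n P)) := fun {P} hP n => by
    have := congrArg (PowerSeries.coeff (n + 1)) hP
    rw [sub_mul, one_mul, map_sub, mul_assoc, PowerSeries.coeff_C_mul, PowerSeries.coeff_succ_X_mul,
      PowerSeries.coeff_rescale, PowerSeries.coeff_rescale] at this
    linear_combination this
  ext n
  induction n with
  | zero => rw [h0, hQ, coeff_zero_expSeries]
  | succ n ih =>
    refine mul_right_cancel₀ (ht' (n + 1) (by omega)) ?_
    rw [hrec hr, hrec hQr, ih]

end Scalar

/-! ### The Drinfeld generators in the completed algebra -/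

section Generators

open UniformSpace

theorem smul_coeff_expSeries {A : Type*} [Ring A] [Algebra ℂ A] (a : ℂ) (s : ℕ → A) (n : ℕ) :
    a ^ n • PowerSeries.coeff n (expSeries s) =
      PowerSeries.coeff n (expSeries fun n => a ^ n • s n) := by
  have h : ∀ k n, a ^ n • PowerSeries.coeff n (posSeries s ^ k) =
      PowerSeries.coeff n (posSeries (fun n => a ^ n • s n) ^ k) := by
    intro k
    induction k with
    | zero =>
      intro n
      simp only [pow_zero, PowerSeries.coeff_one]
      split_ifs with hn <;> simp [hn]
    | succ k ih =>
      intro n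
      rw [pow_succ, pow_succ, PowerSeries.coeff_mul, PowerSeries.coeff_mul, Finset.smul_sum]
      refine Finset.sum_congr rfl fun p hp => ?_
      rw [← ih, ← mem_antidiagonal.mp hp, pow_add, mul_smul, smul_mul_assoc]
      congr 1
      simp only [coeff_posSeries]
      split_ifs <;> simp
  rw [expSeries, expSeries, fexp, fexp, PowerSeries.coeff_mk, PowerSeries.coeff_mk,
    Finset.smul_sum]
  refine Finset.sum_congr rfl fun k _ => ?_
  rw [← h, smul_comm]

theorem map_expSeries {A B : Type*} [Ring A] [Algebra ℂ A] [Ring B] [Algebra ℂ B] (f : A →ₐ[ℂ] B)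
    (s : ℕ → A) (n : ℕ) :
    f (PowerSeries.coeff n (expSeries s)) = PowerSeries.coeff n (expSeries fun n => f (s n)) := by
  have h : PowerSeries.map (f : A →+* B) (posSeries s) = posSeries fun n => f (s n) := by
    ext n
    simp only [PowerSeries.coeff_map, coeff_posSeries]
    split_ifs <;> simp
  have := congrArg (PowerSeries.coeff n) (map_fexp f (posSeries s))
  rw [PowerSeries.coeff_map, h] at this
  exact this

variable {N : ℕ} {η : ℂ} {c : ℝ}

/-- The canonical map from the quantum affine algebra to its completion. -/
def coeHat : Uq N η c →ₐ[ℂ] UqHat N η c :=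
  { Completion.coeRingHom with commutes' := fun _ => (Completion.algebraMap_def _ _ _).symm }

theorem coeHat_apply (x : Uq N η c) : coeHat x = (x : UqHat N η c) := rfl

/-- The canonical map from the free algebra to the completed quantum affine algebra. -/
def toHat : FreeAlgebra ℂ (Gen N) →ₐ[ℂ] UqHat N η c := coeHat.comp Uq.proj

theorem toHat_apply (x : FreeAlgebra ℂ (Gen N)) :
    toHat x = ((Uq.proj x : Uq N η c) : UqHat N η c) := rfl

theorem toHat_rel {x y : FreeAlgebra ℂ (Gen N)} (h : Rel N η c x y) :
    (toHat x : UqHat N η c) = toHat y :=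
  congrArg coeHat (RingQuot.mkAlgHom_rel ℂ h)

/-- The generators `H_n^i` in the completed algebra. -/
def hMode (i : Fin (N - 1)) (n : ℤ) : UqHat N η c := toHat (HF i n)

/-- The current with the constant coefficient `q ^ (± h_i)`. -/
def kCurrent (s : ℤˣ) (i : Fin (N - 1)) : Current N η c := fun k => if k = 0 then toHat (KF s i) else 0

/-- The structure constants of the Heisenberg algebra generated by the `H_n^i`. -/
def cartanForm (η : ℂ) (c : ℝ) (i j : Fin (N - 1)) (n : ℤ) : ℂ :=
  qint η ((cartan i j : ℝ) * n) * qint η (c * n) / (n : ℂ)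

/-- The charges of the Drinfeld currents. -/
def cartanCharge (η : ℂ) (c : ℝ) (s : ℤˣ) (j i : Fin (N - 1)) (n : ℤ) : ℂ :=
  (sgn s : ℂ) * (qint η ((cartan i j : ℝ) * n) / (n : ℂ)) * qpow η (-(sgn s * (c / 2 * |(n : ℝ)|)))

theorem hasCharge_eDrinfeld (s : ℤˣ) (j : Fin (N - 1)) :
    HasCharge (hMode (N := N) (η := η) (c := c)) (eDrinfeld s j) (cartanCharge η c s j) := by
  intro i n hn k
  have := toHat_rel (Rel.H_e (η := η) (c := c) s i j n (-k - 1) hn)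
  rw [map_sub, map_mul, map_mul, map_smul] at this
  rw [show n + (-k - 1) = -(k - n) - 1 by ring] at this
  exact this

theorem commute_kCurrent (s : ℤˣ) (j i : Fin (N - 1)) (n k : ℤ) :
    Commute (hMode i n : UqHat N η c) (kCurrent s j k) := by
  rw [kCurrent]
  split_ifs
  · have := toHat_rel (Rel.K_H (η := η) (c := c) s j i n)
    rw [map_mul, map_mul] at this
    exact this.symm
  · exact Commute.zero_right _

theorem hasCharge_kCurrent (s : ℤˣ) (j : Fin (N - 1)) :
    HasCharge (hMode (N := N) (η := η) (c := c)) (kCurrent s j) (fun _ _ => 0) := by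
  intro i n _ k
  rw [(commute_kCurrent s j i n k).eq, sub_self, zero_smul]

theorem decays_kCurrent (s : ℤˣ) (j : Fin (N - 1)) :
    Decays (kCurrent s j : Current N η c) := by
  intro k
  refine summable_of_ne_finset_zero (s := {k.toNat}) fun n hn => ?_
  rw [kCurrent, if_neg]
  intro h
  exact hn (by simp; omega)

/-! The degree of generators and of exponentials. -/

/-- Right multiplication by `x` raises the degree by `n`. -/
def RaisesDeg (x : Uq N η c) (n : ℤ) : Prop :=
  ∀ m, ∀ y ∈ degIdeal N η c m, y * x ∈ degIdeal N η c (m + n)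

theorem RaisesDeg.mem {x : Uq N η c} {n : ℤ} (h : RaisesDeg x n) : x ∈ degIdeal N η c n := by
  have := h 0 1 (Ideal.subset_span ⟨[], by simp [wdeg], by simp [word]⟩)
  simpa using this

/-- Membership of the factors in I_m and I_n would not give membership of the product in I_{m+n},
these being only left ideals. Raising degrees under right multiplication is a stronger property that
is multiplicative. -/
theorem RaisesDeg.mul {x y : Uq N η c} {m n : ℤ} (hx : RaisesDeg x m) (hy : RaisesDeg y n) :
    RaisesDeg (x * y) (m + n) := fun l z hz => by
  rw [← mul_assoc, ← add_assoc]
  exact hy _ _ (hx _ _ hz)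

theorem RaisesDeg.smul {x : Uq N η c} {n : ℤ} (hx : RaisesDeg x n) (a : ℂ) :
    RaisesDeg (a • x) n := fun l z hz => by
  rw [mul_smul_comm, Algebra.smul_def]
  exact Ideal.mul_mem_left _ _ (hx _ _ hz)

theorem raisesDeg_zero (n : ℤ) : RaisesDeg (0 : Uq N η c) n := fun l z _ => by
  rw [mul_zero]; exact zero_mem _

theorem raisesDeg_sum {ι : Type*} {s : Finset ι} {f : ι → Uq N η c} {n : ℤ}
    (h : ∀ i ∈ s, RaisesDeg (f i) n) : RaisesDeg (∑ i ∈ s, f i) n := fun l z hz => by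
  rw [Finset.mul_sum]
  exact Ideal.sum_mem _ fun i hi => h i hi _ _ hz

theorem raisesDeg_one : RaisesDeg (1 : Uq N η c) 0 := fun l z hz => by
  rwa [mul_one, add_zero]

theorem raisesDeg_gen (g : Gen N) :
    RaisesDeg (Uq.proj (FreeAlgebra.ι ℂ g) : Uq N η c) g.deg := fun m y hy => by
  induction hy using Submodule.span_induction with
  | mem y hy =>
    obtain ⟨l, hl, rfl⟩ := hy
    refine Ideal.subset_span ⟨l ++ [g], ?_, ?_⟩
    · simp only [wdeg, List.map_append, List.sum_append, List.map_cons, List.map_nil,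
        List.sum_cons, List.sum_nil] at hl ⊢
      omega
    · simp [word]
  | zero => rw [zero_mul]; exact zero_mem _
  | add a b _ _ ha hb => rw [add_mul]; exact Ideal.add_mem _ ha hb
  | smul a b _ hb => rw [smul_eq_mul, mul_assoc]; exact Ideal.mul_mem_left _ _ hb

theorem raisesDeg_H (i : Fin (N - 1)) (n : ℤ) : RaisesDeg (Uq.proj (HF i n) : Uq N η c) n := by
  rw [HF]
  split_ifs with hn
  · exact raisesDeg_gen (Gen.H i n hn)
  · rw [map_zero]; exact raisesDeg_zero n

theorem raisesDeg_expSeries {s : ℕ → Uq N η c} (hs : ∀ n : ℕ, RaisesDeg (s n) n) (n : ℕ) :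
    RaisesDeg (PowerSeries.coeff n (expSeries s)) n := by
  have h : ∀ k n : ℕ, RaisesDeg (PowerSeries.coeff n (posSeries s ^ k)) n := by
    intro k
    induction k with
    | zero =>
      intro n
      rw [pow_zero, PowerSeries.coeff_one]
      split_ifs with hn
      · subst hn; exact raisesDeg_one
      · exact raisesDeg_zero _
    | succ k ih =>
      intro n
      rw [pow_succ, PowerSeries.coeff_mul]
      refine raisesDeg_sum fun p hp => ?_
      rw [← mem_antidiagonal.mp hp, Nat.cast_add]
      refine (ih _).mul ?_
      rw [coeff_posSeries]
      split_ifs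
      · exact raisesDeg_zero _
      · exact hs _
  rw [expSeries, fexp, PowerSeries.coeff_mk]
  exact raisesDeg_sum fun k _ => (h k n).smul _

/-- The coefficient of z^{k-n} is a generator of degree n - k - 1, which tends to +∞ with n. -/
theorem decays_eDrinfeld (s : ℤˣ) (j : Fin (N - 1)) :
    Decays (eDrinfeld s j : Current N η c) := by
  intro k
  refine summable_of_mem_degIdealHat (d := fun n : ℕ => (n : ℤ) - k - 1) (fun n => ?_) fun n => ?_
  · refine (Set.finite_Iio (n + k + 1).toNat).subset fun m hm => ?_
    have : (m : ℤ) - k - 1 < n := hm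
    simp only [Set.mem_Iio]
    omega
  · have := (raisesDeg_gen (η := η) (c := c) (Gen.e s j (-(k - n) - 1))).mem
    rw [show (Gen.e s j (-(k - n) - 1)).deg = (n : ℤ) - k - 1 by simp only [Gen.deg]; ring] at this
    exact coe_mem_degIdealHat this

theorem isHeisenberg_hMode : IsHeisenberg (hMode (N := N) (η := η) (c := c)) (cartanForm η c) where
  comm i j n m hn hm := by
    have := toHat_rel (Rel.H_H (η := η) (c := c) i j n m hn hm)
    rw [map_sub, map_mul, map_mul] at this
    refine this.trans ?_
    split_ifs
    · exact AlgHom.commutes _ _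
    · exact map_zero _
  -- The n-th coefficient of an exponential of annihilation modes is homogeneous of degree n,
  -- whatever the exponents `y` are, so it lies in I_n.
  null i y := by
    have h : ∀ n : ℕ, PowerSeries.coeff n (expMinus (hMode (N := N) (η := η) (c := c)) i y) =
        ((PowerSeries.coeff n (expSeries fun n : ℕ => y n • (Uq.proj (HF i n) : Uq N η c)) :
          Uq N η c) : UqHat N η c) := fun n => by
      rw [← coeHat_apply, map_expSeries]
      simp only [map_smul]
      rfl
    refine summable_of_mem_degIdealHat (d := fun n : ℕ => (n : ℤ)) (fun n => ?_) fun n => ?_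
    · refine (Set.finite_Iio n.toNat).subset fun m hm => ?_
      have : (m : ℤ) < n := hm
      simp only [Set.mem_Iio]
      omega
    · rw [h]
      exact coe_mem_degIdealHat
        (raisesDeg_expSeries (fun n => (raisesDeg_H i n).smul (y n)) n).mem

end Generators

/-! ### The dressed currents -/

section DressedCurrents

theorem qpow_add (η : ℂ) (x y : ℝ) : qpow η (x + y) = qpow η x * qpow η y := by
  rw [qpow, qpow, qpow, ← Complex.exp_add]
  congr 1
  push_cast
  ring

theorem qpow_zero (η : ℂ) : qpow η 0 = 1 := by simp [qpow]

theorem qpow_ne_zero (η : ℂ) (x : ℝ) : qpow η x ≠ 0 := Complex.exp_ne_zero _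

theorem qpow_neg (η : ℂ) (x : ℝ) : qpow η (-x) = (qpow η x)⁻¹ := by
  refine eq_inv_of_mul_eq_one_left ?_
  rw [← qpow_add, neg_add_cancel, qpow_zero]

theorem qpow_pow (η : ℂ) (x : ℝ) (n : ℕ) : qpow η x ^ n = qpow η (x * n) := by
  rw [qpow, qpow, ← Complex.exp_nat_mul]
  congr 1
  push_cast
  ring

theorem qpow_zpow (η : ℂ) (x : ℝ) (n : ℤ) : qpow η x ^ n = qpow η (x * n) := by
  rw [qpow, qpow, ← Complex.exp_int_mul]
  congr 1
  push_cast
  ring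

theorem norm_qpow (η : ℂ) (x : ℝ) : ‖qpow η x‖ = Real.exp (x * η.re) := by
  rw [qpow, Complex.norm_exp]
  simp

theorem norm_qpow_lt_one {η : ℂ} (hη : η.re < 0) {x : ℝ} (hx : 0 < x) : ‖qpow η x‖ < 1 := by
  rw [norm_qpow, Real.exp_lt_one_iff]
  exact mul_neg_of_pos_of_neg hx hη

theorem qpow_ne_one {η : ℂ} (hη : η.re < 0) {x : ℝ} (hx : x ≠ 0) : qpow η x ≠ 1 := by
  intro h
  have := norm_qpow η x
  rw [h, norm_one, eq_comm, Real.exp_eq_one_iff] at this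
  exact (mul_ne_zero hx hη.ne) this

theorem qpow_sub_ne_zero {η : ℂ} (hη : η.re < 0) {x : ℝ} (hx : x ≠ 0) :
    qpow η x - qpow η (-x) ≠ 0 := by
  intro h
  refine qpow_ne_one hη (x := x + x) (by simpa using hx) ?_
  rw [qpow_add]
  nth_rewrite 1 [sub_eq_zero.mp h]
  rw [← qpow_add, neg_add_cancel, qpow_zero]

theorem qint_ne_zero {η : ℂ} (hη : η.re < 0) {x : ℝ} (hx : x ≠ 0) : qint η x ≠ 0 :=
  div_ne_zero (qpow_sub_ne_zero hη hx) (qpow_sub_ne_zero hη one_ne_zero)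

variable {N : ℕ} {η : ℂ} {c : ℝ}

/-- The current `∑_{n ≥ 0} D n z ^ n`. -/
def plusCurrent (D : PowerSeries (UqHat N η c)) : Current N η c :=
  fun k => if 0 ≤ k then PowerSeries.coeff k.toNat D else 0

/-- The current `∑_{n ≥ 0} D n z ^ (-n)`. -/
def minusCurrent (D : PowerSeries (UqHat N η c)) : Current N η c :=
  fun k => if k ≤ 0 then PowerSeries.coeff (-k).toNat D else 0

theorem plusCurrent_mul (D : PowerSeries (UqHat N η c)) (X : Current N η c) :
    Current.mul (plusCurrent D) X = lop D (-1) X := by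
  ext k
  rw [Current.mul, lop, ← Nat.cast_injective.tsum_eq (f := fun a : ℤ => plusCurrent D a * X (k - a))]
  · refine tsum_congr fun n => ?_
    simp [plusCurrent, sub_eq_add_neg]
  · intro a ha
    have h0 : 0 ≤ a := by
      by_contra h
      exact ha (by simp [plusCurrent, h])
    exact ⟨a.toNat, by simp [h0]⟩

theorem plusCurrent_mulConverges (D : PowerSeries (UqHat N η c)) {X : Current N η c}
    (hX : Decays X) : Current.MulConverges (plusCurrent D) X := by
  intro k
  refine (Nat.cast_injective.summable_iff (fun a ha => ?_)).mp ((summable_mul_left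
    (fun n : ℕ => PowerSeries.coeff n D) (hX k)).congr fun n => by simp [plusCurrent])
  have h0 : ¬ 0 ≤ a := fun h => ha ⟨a.toNat, by simp [h]⟩
  simp [plusCurrent, h0]

theorem mul_minusCurrent (X : Current N η c) (D : PowerSeries (UqHat N η c)) :
    Current.mul X (minusCurrent D) = rop X 1 D := by
  ext k
  have hi : Function.Injective fun n : ℕ => k + (n : ℤ) := fun m n h => by simpa using h
  rw [Current.mul, rop, ← hi.tsum_eq (f := fun a : ℤ => X a * minusCurrent D (k - a))]
  · refine tsum_congr fun n => ?_
    simp [minusCurrent]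
  · intro a ha
    have h0 : k - a ≤ 0 := by
      by_contra h
      exact ha (by simp only [minusCurrent, if_neg h, mul_zero])
    exact ⟨(a - k).toNat, by simp only; omega⟩

theorem mul_minusCurrent_converges (X : Current N η c) {D : PowerSeries (UqHat N η c)}
    (hD : NullSeries D) : Current.MulConverges X (minusCurrent D) := by
  intro k
  have hi : Function.Injective fun n : ℕ => k + (n : ℤ) := fun m n h => by simpa using h
  refine (hi.summable_iff (fun a ha => ?_)).mp ((summable_mul_left
    (fun n : ℕ => X (k + n)) hD).congr fun n => by simp [minusCurrent])
  have h0 : ¬ k - a ≤ 0 := fun h => ha ⟨(a - k).toNat, by simp only; omega⟩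
  simp only [minusCurrent, if_neg h0, mul_zero]

theorem dplus_eq (r a : ℝ) (i : Fin (N - 1)) :
    Current.scale (qpow η a) (Dplus (η := η) (c := c) r i) = plusCurrent (expPlus hMode i fun n : ℕ =>
      qpow η (a * n) * ((qint η ((r - c) * n))⁻¹ * qpow η ((r - c + c / 2) * n))) := by
  ext k
  simp only [Current.scale, Dplus, plusCurrent]
  split_ifs with hk
  · have h := map_expSeries (coeHat (N := N) (η := η) (c := c)) (fun n : ℕ =>
      ((qint η ((r - c) * n))⁻¹ * qpow η ((r - c + c / 2) * n)) •
        (Uq.proj (HF i (-(n : ℤ))) : Uq N η c)) k.toNat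
    rw [coeHat_apply] at h
    have h2 : qpow η a ^ k = qpow η a ^ k.toNat := by
      rw [← zpow_natCast, Int.toNat_of_nonneg hk]
    refine (congrArg (qpow η a ^ k • ·) h).trans ?_
    rw [h2, smul_coeff_expSeries, expPlus]
    simp only [map_smul, smul_smul, qpow_pow]
    rfl
  · rw [smul_zero]

theorem dminus_eq (r a : ℝ) (i : Fin (N - 1)) :
    Current.scale (qpow η a) (Dminus (η := η) (c := c) r i) = minusCurrent (expMinus hMode i fun n : ℕ =>
      qpow η (-a * n) * -((qint η (r * n))⁻¹ * qpow η ((r - c / 2) * n))) := by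
  ext k
  simp only [Current.scale, Dminus, minusCurrent]
  split_ifs with hk
  · have h := map_expSeries (coeHat (N := N) (η := η) (c := c)) (fun n : ℕ =>
      (-((qint η (r * n))⁻¹ * qpow η ((r - c / 2) * n))) •
        (Uq.proj (HF i (n : ℤ)) : Uq N η c)) (-k).toNat
    rw [coeHat_apply] at h
    have h2 : qpow η a ^ k = qpow η (-a) ^ (-k).toNat := by
      rw [← zpow_natCast, Int.toNat_of_nonneg (by omega), qpow_neg, inv_zpow', neg_neg]
    refine (congrArg (qpow η a ^ k • ·) h).trans ?_
    rw [h2, smul_coeff_expSeries, expMinus]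
    simp only [map_smul, smul_smul, qpow_pow]
    rfl
  · rw [smul_zero]

theorem scale_one (X : Current N η c) : Current.scale (qpow η 0) X = X := by
  ext k; simp [Current.scale, qpow_zero]

/-- The exponential in ψ_+ consists of annihilation modes and stands to the right of q^{h_i}; this
is already the shape of a dressed constant current. -/
theorem psi_one (i : Fin (N - 1)) :
    (psi 1 i : Current N η c) =
      rop (kCurrent 1 i) 1 (expMinus hMode i fun _ => qpow η 1 - qpow η (-1)) := by
  ext k
  have h := map_expSeries (toHat (N := N) (η := η) (c := c)) (fun n : ℕ =>
      ((sgn 1 : ℂ) * (qpow η 1 - qpow η (-1))) • HF i (((1 : ℤˣ) : ℤ) * n)) (-k).toNat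
  have hk' : (((1 : ℤˣ) : ℤ) * -k) = -k := by simp
  rw [rop, psi, ← toHat_apply, psiF, hk']
  split_ifs with hk
  · rw [tsum_eq_single (-k).toNat]
    · simp only [psiSeriesF, PowerSeries.coeff_C_mul, map_mul, kCurrent]
      rw [if_pos (by simp; omega)]
      congr 1
      refine h.trans ?_
      simp [expMinus, hMode]
    · intro n hn
      rw [kCurrent, if_neg, zero_mul]
      simp only [nsmul_eq_mul, mul_one]
      omega
  · rw [map_zero, tsum_congr (g := fun _ => 0), tsum_zero]
    intro n
    rw [kCurrent, if_neg, zero_mul]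
    simp only [nsmul_eq_mul, mul_one]
    omega

/-- The exponential in ψ_- consists of creation modes but is defined to the right of q^{-h_i}. Since
q^{-h_i} commutes with all H_n, it may be put on the left, where creation exponentials belong. -/
theorem psi_neg_one (i : Fin (N - 1)) :
    (psi (-1) i : Current N η c) =
      lop (expPlus hMode i fun _ => -(qpow η 1 - qpow η (-1))) (-1) (kCurrent (-1) i) := by
  ext k
  have h := map_expSeries (toHat (N := N) (η := η) (c := c)) (fun n : ℕ =>
      ((sgn (-1) : ℂ) * (qpow η 1 - qpow η (-1))) • HF i (((-1 : ℤˣ) : ℤ) * n)) k.toNat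
  have hk' : (((-1 : ℤˣ) : ℤ) * -k) = k := by simp
  rw [lop, psi, ← toHat_apply, psiF, hk']
  split_ifs with hk
  · rw [tsum_eq_single k.toNat]
    · have hc : Commute (PowerSeries.coeff k.toNat
          (expPlus hMode i fun _ => -(qpow η 1 - qpow η (-1)))) (kCurrent (-1) i 0 : UqHat N η c) :=
        (commute_coeff_expSeries (fun n _ => ((commute_kCurrent (-1) i i _ 0).smul_left _).symm)
          _).symm
      rw [show k + k.toNat • (-1 : ℤ) = 0 by simp; omega, hc.eq, kCurrent, if_pos rfl]
      simp only [psiSeriesF, PowerSeries.coeff_C_mul, map_mul]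
      congr 1
      refine h.trans ?_
      simp [expPlus, hMode]
    · intro n hn
      rw [kCurrent, if_neg, mul_zero]
      simp only [nsmul_eq_mul]
      omega
  · rw [map_zero, tsum_congr (g := fun _ => 0), tsum_zero]
    intro n
    rw [kCurrent, if_neg, mul_zero]
    simp only [nsmul_eq_mul]
    omega

/-- The exponents of the creation operators in the dressed current `Ψ_i^±`. -/
def psiPlusExp (η : ℂ) (r c : ℝ) (s : ℤˣ) (n : ℕ) : ℂ :=
  qpow η ((sgn s * (r - c / 2) + c / 2) * n) / qint η ((r - c) * n)

/-- The exponents of the annihilation operators in the dressed current `Ψ_i^±`. -/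
def psiMinusExp (η : ℂ) (r c : ℝ) (s : ℤˣ) (n : ℕ) : ℂ :=
  -(qpow η ((-(sgn s * (r - c / 2)) - c / 2) * n) / qint η (r * n))

theorem expPlus_mul (i : Fin (N - 1)) (x x' : ℕ → ℂ) :
    expPlus hMode i x * expPlus hMode i x' =
      (expPlus hMode i (fun n => x n + x' n) : PowerSeries (UqHat N η c)) := by
  have hH := isHeisenberg_hMode (N := N) (η := η) (c := c)
  rw [expPlus, expPlus, expSeries_mul (hH.commute_plus i i x x) (hH.commute_plus i i x' x')
    (hH.commute_plus i i x x'), expPlus]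
  simp only [add_smul]

theorem expMinus_mul (i : Fin (N - 1)) (x x' : ℕ → ℂ) :
    expMinus hMode i x * expMinus hMode i x' =
      (expMinus hMode i (fun n => x n + x' n) : PowerSeries (UqHat N η c)) := by
  have hH := isHeisenberg_hMode (N := N) (η := η) (c := c)
  rw [expMinus, expMinus, expSeries_mul (hH.commute_minus i i x x) (hH.commute_minus i i x' x')
    (hH.commute_minus i i x x'), expMinus]
  simp only [add_smul]

theorem expPlus_congr {i : Fin (N - 1)} {x x' : ℕ → ℂ} (h : ∀ n, n ≠ 0 → x n = x' n) :
    (expPlus hMode i x : PowerSeries (UqHat N η c)) = expPlus hMode i x' :=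
  expSeries_congr fun n hn => by rw [h n hn]

theorem expMinus_congr {i : Fin (N - 1)} {x x' : ℕ → ℂ} (h : ∀ n, n ≠ 0 → x n = x' n) :
    (expMinus hMode i x : PowerSeries (UqHat N η c)) = expMinus hMode i x' :=
  expSeries_congr fun n hn => by rw [h n hn]

theorem expPlus_zero (i : Fin (N - 1)) :
    (expPlus hMode i (fun _ => 0) : PowerSeries (UqHat N η c)) = 1 := by
  simp only [expPlus, zero_smul, expSeries_zero]

theorem expMinus_zero (i : Fin (N - 1)) :
    (expMinus hMode i (fun _ => 0) : PowerSeries (UqHat N η c)) = 1 := by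
  simp only [expMinus, zero_smul, expSeries_zero]

section

variable (hη : η.re < 0) {r : ℝ}

theorem eDressed_eq (i : Fin (N - 1)) :
    (eDressed r i : Current N η c) = dressed hMode i
      (fun n : ℕ => qpow η ((r - c / 2) * n) / qint η ((r - c) * n)) (fun _ => 0)
      (eDrinfeld 1 i) := by
  rw [eDressed, ← scale_one (Dplus r i), dplus_eq, plusCurrent_mul, dressed, expMinus_zero, rop_one]
  congr 1
  refine expPlus_congr fun n _ => ?_
  rw [zero_mul, qpow_zero, one_mul, mul_comm, ← div_eq_mul_inv]
  ring_nf

theorem fDressed_eq (i : Fin (N - 1)) :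
    (fDressed r i : Current N η c) = dressed hMode i (fun _ => 0)
      (fun n : ℕ => -(qpow η ((r - c / 2) * n) / qint η (r * n))) (eDrinfeld (-1) i) := by
  rw [fDressed, ← scale_one (Dminus r i), dminus_eq, mul_minusCurrent, dressed, expPlus_zero,
    lop_one]
  congr 1
  refine expMinus_congr fun n _ => ?_
  rw [neg_zero, zero_mul, qpow_zero, one_mul, mul_comm _ (qpow _ _), ← div_eq_mul_inv]

include hη

/-- For s = -1 the creation modes of ψ_- add to those of D^+, and the two merge by q^x - (q -
q⁻¹)[x] = q^{-x} with x = (r - c) n. For s = 1 only D^+ contributes. -/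
theorem psiPlusExp_eq (hrc : 0 < r - c) (s : ℤˣ) {n : ℕ} (hn : n ≠ 0) :
    qpow η (sgn s * (c / 2) * n) * ((qint η ((r - c) * n))⁻¹ * qpow η ((r - c + c / 2) * n)) +
      (if s = 1 then 0 else -(qpow η 1 - qpow η (-1))) = psiPlusExp η r c s n := by
  have hn' : (n : ℝ) ≠ 0 := by exact_mod_cast hn
  have h0 := qpow_sub_ne_zero hη (mul_ne_zero hrc.ne' hn')
  have h1 := qpow_sub_ne_zero hη one_ne_zero
  rcases Int.units_eq_one_or s with rfl | rfl
  · rw [if_pos rfl, add_zero, psiPlusExp, mul_left_comm, ← qpow_add, div_eq_mul_inv, mul_comm]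
    simp only [sgn, Units.val_one, Int.cast_one]
    ring_nf
  · rw [if_neg (by decide), psiPlusExp, mul_left_comm, ← qpow_add]
    simp only [sgn, Units.val_neg, Units.val_one, Int.cast_neg, Int.cast_one]
    rw [qint, show (-1 * (c / 2) * n + (r - c + c / 2) * n : ℝ) = (r - c) * n by ring,
      show ((-1 * (r - c / 2) + c / 2) * n : ℝ) = -((r - c) * n) by ring]
    field_simp
    ring

/-- The same merging on the annihilation side, with x = r n; here it is the sign s = 1 for which ψ
contributes. -/
theorem psiMinusExp_eq (hr : 0 < r) (s : ℤˣ) {n : ℕ} (hn : n ≠ 0) :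
    (if s = 1 then qpow η 1 - qpow η (-1) else 0) +
      qpow η (-(-(sgn s * (c / 2))) * n) * -((qint η (r * n))⁻¹ * qpow η ((r - c / 2) * n)) =
        psiMinusExp η r c s n := by
  have hn' : (n : ℝ) ≠ 0 := by exact_mod_cast hn
  have h0 := qpow_sub_ne_zero hη (mul_ne_zero hr.ne' hn')
  have h1 := qpow_sub_ne_zero hη one_ne_zero
  rcases Int.units_eq_one_or s with rfl | rfl
  · rw [if_pos rfl, psiMinusExp, mul_neg, mul_left_comm, ← qpow_add]
    simp only [sgn, Units.val_one, Int.cast_one]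
    rw [qint, show (-(-(1 * (c / 2))) * n + (r - c / 2) * n : ℝ) = r * n by ring,
      show ((-(1 * (r - c / 2)) - c / 2) * n : ℝ) = -(r * n) by ring]
    field_simp
    ring
  · rw [if_neg (by decide), zero_add, psiMinusExp, mul_neg, mul_left_comm, ← qpow_add,
      div_eq_mul_inv, mul_comm]
    simp only [sgn, Units.val_neg, Units.val_one, Int.cast_neg, Int.cast_one]
    ring_nf

theorem psi_dressed_eq (hr : 0 < r) (s : ℤˣ) (i : Fin (N - 1)) :
    Current.mul (psi s i) (Current.scale (qpow η (-(sgn s * (c / 2)))) (Dminus r i)) =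
      (dressed hMode i (fun _ => if s = 1 then 0 else -(qpow η 1 - qpow η (-1)))
        (psiMinusExp η r c s) (kCurrent s i) : Current N η c) := by
  have hH := isHeisenberg_hMode (N := N) (η := η) (c := c)
  rw [dminus_eq, mul_minusCurrent, dressed,
    ← expMinus_congr fun n hn => psiMinusExp_eq hη hr s hn, ← expMinus_mul,
    ← rop_mul (hH.null _ _) (hH.null _ _)]
  congr 1
  rcases Int.units_eq_one_or s with rfl | rfl
  · simp only [if_true]
    rw [psi_one, expPlus_zero, lop_one]
  · rw [psi_neg_one]
    simp only [show (-1 : ℤˣ) ≠ 1 by decide, if_false]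
    rw [expMinus_zero, rop_one]

/-- The creation exponents of D^+ and ψ, and the annihilation exponents of ψ and D^-, combine into
one exponential on each side of q^{±h_i}. So the same contraction calculus applies to Ψ, e and f. -/
theorem Psi_eq (hr : 0 < r) (hrc : 0 < r - c) (s : ℤˣ) (i : Fin (N - 1)) :
    (Psi r s i : Current N η c) =
      dressed hMode i (psiPlusExp η r c s) (psiMinusExp η r c s) (kCurrent s i) := by
  have hH := isHeisenberg_hMode (N := N) (η := η) (c := c)
  have hd := decays_kCurrent (η := η) (c := c) s i
  rw [Psi, psi_dressed_eq hη hr, dplus_eq, plusCurrent_mul, dressed, dressed,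
    lop_rop (hd.lop _).summable _ (hH.null _ _),
    lop_mul hd.adm salient_coneOne (isDir_of_mem (by simp [mem_coneOne]) (by simp)), expPlus_mul,
    expPlus_congr fun n hn => psiPlusExp_eq hη hrc s hn]

theorem dressedConverge (hr : 0 < r) : DressedConverge N η r c := by
  have hH := isHeisenberg_hMode (N := N) (η := η) (c := c)
  refine fun i => ⟨fun s => ⟨?_, ?_⟩, ?_, ?_⟩
  · rw [dminus_eq]
    exact mul_minusCurrent_converges _ (hH.null _ _)
  · rw [psi_dressed_eq hη hr, dplus_eq]
    exact plusCurrent_mulConverges _ (hH.decays_dressed (decays_kCurrent s i) _ _ _)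
  · rw [← scale_one (Dplus r i), dplus_eq]
    exact plusCurrent_mulConverges _ (decays_eDrinfeld 1 i)
  · rw [← scale_one (Dminus r i), dminus_eq]
    exact mul_minusCurrent_converges _ (hH.null _ _)

end

end DressedCurrents

/-! ### Logarithms of theta functions and of the contractions -/

section Numerics

/-- The exponents in the ratio of `(q ^ (2 R + b ± a) X; q ^ (2 R))_∞`. -/
def thetaLog (η : ℂ) (R b a : ℝ) (n : ℕ) : ℂ :=
  qpow η ((R + b) * n) * qint η (a * n) / (n * qint η (R * n))

variable {η : ℂ} (hη : η.re < 0) {r c : ℝ}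

include hη in
-- With t = q^{2R} one has t^n/(1 - t^n) = -q^{Rn}/(q^{Rn} - q^{-Rn}), so the logarithm of the
-- quotient becomes a ratio of q-integers. Contractions are logarithms of the same form, hence
-- directly comparable.
theorem qPochSeries_div {R : ℝ} (hR : 0 < R) (b a : ℝ) :
    qPochSeries (qpow η (2 * R)) (qpow η (2 * R) * qpow η (b + a)) *
      (qPochSeries (qpow η (2 * R)) (qpow η (2 * R) * qpow η (b - a)))⁻¹ =
        expSeries (thetaLog η R b a) := by
  have hlt := norm_qpow_lt_one hη (show 0 < 2 * R by positivity)
  rw [qPochSeries_eq_expSeries hlt, qPochSeries_eq_expSeries hlt, expSeries_inv, expSeries_add]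
  refine expSeries_congr fun n hn => ?_
  have hn' : (n : ℝ) ≠ 0 := by exact_mod_cast hn
  have hn'' : (n : ℂ) ≠ 0 := by exact_mod_cast hn
  have h1 := qpow_sub_ne_zero hη (mul_ne_zero hR.ne' hn')
  have h2 := qpow_sub_ne_zero hη one_ne_zero
  have hP := qpow_ne_zero η (R * n)
  have hT := qpow_ne_zero η (a * n)
  rw [thetaLog, qint, qint, mul_pow, mul_pow, qpow_pow, qpow_pow, qpow_pow, add_mul, add_mul,
    sub_mul, sub_eq_add_neg (b * (n : ℝ)), show 2 * R * (n : ℝ) = R * n + R * n by ring]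
  simp only [qpow_add, qpow_neg] at *
  set P := qpow η (R * n)
  set T := qpow η (a * n)
  set D := qpow η 1 - (qpow η 1)⁻¹
  have h6 : P - P⁻¹ = (P ^ 2 - 1) / P := by field_simp
  have h3 : P ^ 2 - 1 ≠ 0 := fun h => h1 (by rw [h6, h, zero_div])
  have h4 : 1 - P ^ 2 ≠ 0 := fun h => h3 (by linear_combination -h)
  have h5 : 1 - P * P ≠ 0 := by rwa [← sq]
  rw [h6]
  field_simp
  ring

include hη in
theorem minusPart_div {R : ℝ} (hR : 0 < R) (b a : ℝ) :
    minusPart [(qpow η (2 * R), qpow η (b - a))] *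
      (minusPart [(qpow η (2 * R), qpow η (b + a))])⁻¹ = expSeries (thetaLog η R (-b) a) := by
  rw [← qPochSeries_div hη hR, minusPart, minusPart]
  simp only [List.map_cons, List.map_nil, List.prod_cons, List.prod_nil, mul_one, ← qpow_neg]
  ring_nf

include hη in
theorem plusPart_div {R : ℝ} (hR : 0 < R) (b a : ℝ) :
    plusPart [(qpow η (2 * R), qpow η (b + a))] *
      (plusPart [(qpow η (2 * R), qpow η (b - a))])⁻¹ = expSeries (thetaLog η R b a) := by
  rw [← qPochSeries_div hη hR, plusPart, plusPart]
  simp only [List.map_cons, List.map_nil, List.prod_cons, List.prod_nil, mul_one]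

theorem minusPart_cons (x : ℂ × ℂ) (L : List (ℂ × ℂ)) :
    minusPart (x :: L) = minusPart [x] * minusPart L := by simp [minusPart]

theorem plusPart_cons (x : ℂ × ℂ) (L : List (ℂ × ℂ)) :
    plusPart (x :: L) = plusPart [x] * plusPart L := by simp [plusPart]

variable {N : ℕ}

theorem cartan_comm (i j : Fin (N - 1)) : cartan i j = cartan j i := by
  have := congrFun (congrFun (CartanMatrix.A_isSymm (n := N - 1)) j) i
  exact this

theorem cartanForm_natCast (i j : Fin (N - 1)) (n : ℕ) :
    cartanForm η c i j n = qint η ((cartan i j : ℝ) * n) * qint η (c * n) / n := by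
  simp [cartanForm]

theorem cartanCharge_natCast (s : ℤˣ) (i j : Fin (N - 1)) (n : ℕ) :
    cartanCharge η c s j i n = (sgn s : ℂ) * (qint η ((cartan i j : ℝ) * n) / n) *
      qpow η (-(sgn s * (c / 2 * n))) := by
  simp [cartanCharge]

theorem qint_neg (x : ℝ) : qint η (-x) = -qint η x := by
  rw [qint, qint, neg_neg, ← neg_div, neg_sub]

theorem cartanCharge_neg_natCast (s : ℤˣ) (i j : Fin (N - 1)) (n : ℕ) :
    cartanCharge η c s j i (-(n : ℤ)) = cartanCharge η c s j i n := by
  simp [cartanCharge, qint_neg, neg_div_neg_eq]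

theorem pairSeries_eq {I : Type*} (κ : I → I → ℤ → ℂ) (i j : I) (χ χ' : I → ℤ → ℂ)
    (y x' : ℕ → ℂ) : pairSeries κ i j χ χ' y x' =
      expSeries fun n => y n * (χ' i n + x' n * κ i j n) + -(x' n * χ j (-(n : ℤ))) := by
  rw [pairSeries, expSeries_add]

/-- The exponents in the dressed current `e_i`. -/
def eExp (η : ℂ) (r c : ℝ) (n : ℕ) : ℂ := qpow η ((r - c / 2) * n) / qint η ((r - c) * n)

/-- The exponents in the dressed current `f_i`. -/
def fExp (η : ℂ) (r c : ℝ) (n : ℕ) : ℂ := -(qpow η ((r - c / 2) * n) / qint η (r * n))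

theorem qint_mul_qpow (x y : ℝ) :
    qint η x * qpow η y = (qpow η (y + x) - qpow η (y - x)) / (qpow η 1 - qpow η (-1)) := by
  rw [qint, div_mul_eq_mul_div, sub_mul, ← qpow_add, ← qpow_add, neg_add_eq_sub, add_comm x]

section

variable (hr : 0 < r) (hrc : 0 < r - c) {n : ℕ} (hn : n ≠ 0)

include hη hr hn in
theorem qint_mul_ne_zero : qint η (r * n) ≠ 0 :=
  qint_ne_zero hη (mul_ne_zero hr.ne' (by exact_mod_cast hn))

include hη hrc hn in
-- The left side is, up to a common factor, the charge of e^+ corrected by its creation dressing.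
-- The correction yields a factor [rn], which cancels the denominator of the annihilation exponents
-- and leaves only the nome p*.
theorem eExp_contraction : qpow η (-(c / 2 * n)) + eExp η r c n * qint η (c * n) =
    qpow η (c / 2 * n) * qint η (r * n) / qint η ((r - c) * n) := by
  have h := qint_mul_ne_zero hη hrc hn
  rw [eExp, eq_div_iff h, add_mul, mul_right_comm, div_mul_cancel₀ _ h,
    mul_comm (qpow η _), qint_mul_qpow, mul_comm (qpow η _), qint_mul_qpow, mul_comm (qpow η _),
    qint_mul_qpow, ← add_div]
  congr 1
  ring_nf

include hη hr hn in
-- The counterpart for f: the correction yields a factor [(r - c)n], which cancels the denominator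
-- of the creation exponents of Ψ and leaves only the nome p.
theorem fExp_contraction : qpow η (c / 2 * n) + fExp η r c n * qint η (c * n) =
    qpow η (-(c / 2 * n)) * qint η ((r - c) * n) / qint η (r * n) := by
  have h := qint_mul_ne_zero hη hr hn
  rw [fExp, eq_div_iff h, add_mul, mul_right_comm, neg_mul, div_mul_cancel₀ _ h,
    mul_comm (qpow η _), qint_mul_qpow, neg_mul, mul_comm (qpow η _), qint_mul_qpow, mul_comm (qpow η _), qint_mul_qpow,
    ← neg_div, ← add_div]
  congr 1
  ring_nf

include hη hr hrc hn in
-- The contraction of two Ψ has both [rn] and [(r - c)n] in its denominator. This partial fraction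
-- decomposition splits it into a p* part and a p part, the source of the two kinds of theta
-- functions.
theorem qint_level : qint η (c * n) / (qint η (r * n) * qint η ((r - c) * n)) =
    qpow η ((r - c) * n) / qint η ((r - c) * n) - qpow η (r * n) / qint η (r * n) := by
  have h1 := qint_mul_ne_zero hη hr hn
  have h2 := qint_mul_ne_zero hη hrc hn
  rw [div_sub_div _ _ h2 h1, mul_comm (qint η ((r - c) * n)) (qint η (r * n)),
    mul_comm (qpow η ((r - c) * n)), qint_mul_qpow, qint_mul_qpow, ← sub_div, qint]
  congr 2
  ring_nf

end

/-! ### Contractions of all pairs of dressed currents -/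

section Pairs

variable (hr : 0 < r) (hrc : 0 < r - c) (i j : Fin (N - 1))

theorem pairSeries_ee :
    pairSeries (cartanForm η c) i j (cartanCharge η c 1 i) (cartanCharge η c 1 j) (fun _ => 0)
      (eExp η r c) = expSeries fun n => -thetaLog η (r - c) 0 (cartan i j) n := by
  rw [pairSeries_eq]
  refine expSeries_congr fun n hn => ?_
  rw [cartanCharge_neg_natCast, cartanCharge_natCast, cartanCharge_natCast, cartan_comm j i,
    thetaLog, eExp]
  have e : qpow η ((r - c + 0) * n) = qpow η ((r - c / 2) * n) * qpow η (-(c / 2 * n)) := by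
    rw [← qpow_add]; ring_nf
  simp only [sgn, Units.val_one, Int.cast_one, Complex.ofReal_one, one_mul, zero_mul, e]
  ring

theorem pairSeries_ff :
    pairSeries (cartanForm η c) i j (cartanCharge η c (-1) i) (cartanCharge η c (-1) j)
      (fExp η r c) (fun _ => 0) = expSeries fun n => thetaLog η r 0 (cartan i j) n := by
  rw [pairSeries_eq]
  refine expSeries_congr fun n hn => ?_
  rw [cartanCharge_natCast, thetaLog, fExp]
  have e : qpow η ((r + 0) * n) = qpow η ((r - c / 2) * n) * qpow η (c / 2 * n) := by
    rw [← qpow_add]; ring_nf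
  simp only [sgn, Units.val_neg, Units.val_one, Int.cast_neg, Int.cast_one, Complex.ofReal_neg,
    Complex.ofReal_one, zero_mul, neg_mul, one_mul, neg_neg, e]
  ring

/-- With e on the left there is nothing to reorder: e has no annihilation part and f has no creation
part. -/
theorem pairSeries_ef :
    pairSeries (cartanForm η c) i j (cartanCharge η c 1 i) (cartanCharge η c (-1) j) (fun _ => 0)
      (fun _ => 0) = 1 := by
  rw [pairSeries_eq]
  simp [expSeries_zero]

include hη hr hrc in
-- Two nontrivial crossings cancel: D^- of f past the dressed e, with its charge corrected by
-- `eExp_contraction`, and D^+ of e past the bare e^-. This cancellation keeps the commutator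
-- relation undeformed.
theorem pairSeries_fe :
    pairSeries (cartanForm η c) i j (cartanCharge η c (-1) i) (cartanCharge η c 1 j)
      (fExp η r c) (eExp η r c) = 1 := by
  rw [pairSeries_eq, ← expSeries_zero]
  refine expSeries_congr fun n hn => ?_
  have h := eExp_contraction hη hrc hn
  have h1 := qint_mul_ne_zero hη hr hn
  have h2 := qint_mul_ne_zero hη hrc hn
  have hn' : (n : ℂ) ≠ 0 := by exact_mod_cast hn
  rw [cartanCharge_neg_natCast, cartanCharge_natCast, cartanCharge_natCast, cartan_comm j i,
    cartanForm_natCast]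
  simp only [sgn, Units.val_neg, Units.val_one, Int.cast_neg, Int.cast_one, Complex.ofReal_neg,
    Complex.ofReal_one, neg_mul, one_mul, neg_neg]
  have e : qint η ((cartan i j : ℝ) * n) / n * qpow η (-(c / 2 * n)) +
      eExp η r c n * (qint η ((cartan i j : ℝ) * n) * qint η (c * n) / n) =
      qint η ((cartan i j : ℝ) * n) / n *
        (qpow η (c / 2 * n) * qint η (r * n) / qint η ((r - c) * n)) := by
    rw [← h]; ring
  rw [e, fExp, eExp]
  field_simp
  ring

include hη hrc in
theorem pairSeries_psi_e (s : ℤˣ) (hr : 0 < r) :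
    pairSeries (cartanForm η c) i j (fun _ _ => 0) (cartanCharge η c 1 j) (psiMinusExp η r c s)
      (eExp η r c) =
        expSeries fun n => -thetaLog η (r - c) (-(sgn s * (r - c / 2)) - (r - c)) (cartan i j) n := by
  rw [pairSeries_eq]
  refine expSeries_congr fun n hn => ?_
  have h := eExp_contraction hη hrc hn
  have h1 := qint_mul_ne_zero hη hr hn
  have h2 := qint_mul_ne_zero hη hrc hn
  have hn' : (n : ℂ) ≠ 0 := by exact_mod_cast hn
  rw [cartanCharge_natCast, cartanForm_natCast, thetaLog, psiMinusExp]
  simp only [sgn, Units.val_one, Int.cast_one, Complex.ofReal_one, one_mul, mul_zero, neg_zero,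
    add_zero]
  have e : qint η ((cartan i j : ℝ) * n) / n * qpow η (-(c / 2 * n)) +
      eExp η r c n * (qint η ((cartan i j : ℝ) * n) * qint η (c * n) / n) =
      qint η ((cartan i j : ℝ) * n) / n *
        (qpow η (c / 2 * n) * qint η (r * n) / qint η ((r - c) * n)) := by
    rw [← h]; ring
  have e2 : qpow η ((r - c + (-(((s : ℤ) : ℝ) * (r - c / 2)) - (r - c))) * n) =
      qpow η ((-(((s : ℤ) : ℝ) * (r - c / 2)) - c / 2) * n) * qpow η (c / 2 * n) := by
    rw [← qpow_add]; ring_nf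
  rw [e, e2]
  field_simp

theorem pairSeries_e_psi (s : ℤˣ) :
    pairSeries (cartanForm η c) j i (cartanCharge η c 1 j) (fun _ _ => 0) (fun _ => 0)
      (psiPlusExp η r c s) =
        expSeries fun n => -thetaLog η (r - c) (sgn s * (r - c / 2) - (r - c)) (cartan i j) n := by
  rw [pairSeries_eq]
  refine expSeries_congr fun n hn => ?_
  rw [cartanCharge_neg_natCast, cartanCharge_natCast, thetaLog, psiPlusExp]
  simp only [sgn, Units.val_one, Int.cast_one, Complex.ofReal_one, one_mul, zero_mul, zero_add]
  have e2 : qpow η ((r - c + (((s : ℤ) : ℝ) * (r - c / 2) - (r - c))) * n) =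
      qpow η ((((s : ℤ) : ℝ) * (r - c / 2) + c / 2) * n) * qpow η (-(c / 2 * n)) := by
    rw [← qpow_add]; ring_nf
  rw [e2]
  ring

theorem pairSeries_psi_f (s : ℤˣ) :
    pairSeries (cartanForm η c) i j (fun _ _ => 0) (cartanCharge η c (-1) j) (psiMinusExp η r c s)
      (fun _ => 0) =
        expSeries fun n => thetaLog η r (-(sgn s * (r - c / 2)) - r) (cartan i j) n := by
  rw [pairSeries_eq]
  refine expSeries_congr fun n hn => ?_
  rw [cartanCharge_natCast, thetaLog, psiMinusExp]
  simp only [sgn, Units.val_neg, Units.val_one, Int.cast_neg, Int.cast_one, Complex.ofReal_neg,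
    Complex.ofReal_one, zero_mul, neg_mul, one_mul, neg_neg]
  have e2 : qpow η ((r + (-(((s : ℤ) : ℝ) * (r - c / 2)) - r)) * n) =
      qpow η ((-(((s : ℤ) : ℝ) * (r - c / 2)) - c / 2) * n) * qpow η (c / 2 * n) := by
    rw [← qpow_add]; ring_nf
  rw [e2]
  ring

include hη hr in
theorem pairSeries_f_psi (s : ℤˣ) (hrc : 0 < r - c) :
    pairSeries (cartanForm η c) j i (cartanCharge η c (-1) j) (fun _ _ => 0) (fExp η r c)
      (psiPlusExp η r c s) =
        expSeries fun n => thetaLog η r (sgn s * (r - c / 2) - r) (cartan i j) n := by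
  rw [pairSeries_eq]
  refine expSeries_congr fun n hn => ?_
  have h := fExp_contraction (c := c) hη hr hn
  have h1 := qint_mul_ne_zero hη hr hn
  have h2 := qint_mul_ne_zero hη hrc hn
  have hn' : (n : ℂ) ≠ 0 := by exact_mod_cast hn
  rw [cartanCharge_neg_natCast, cartanCharge_natCast, cartanForm_natCast, cartan_comm j i, thetaLog]
  simp only [sgn, Units.val_neg, Units.val_one, Int.cast_neg, Int.cast_one, Complex.ofReal_neg,
    Complex.ofReal_one, neg_mul, one_mul, neg_neg, zero_add]
  have e : fExp η r c n * (psiPlusExp η r c s n *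
        (qint η ((cartan i j : ℝ) * n) * qint η (c * n) / n)) +
      -(psiPlusExp η r c s n * -(qint η ((cartan i j : ℝ) * n) / n * qpow η (c / 2 * n))) =
      psiPlusExp η r c s n * (qint η ((cartan i j : ℝ) * n) / n) *
        (qpow η (-(c / 2 * n)) * qint η ((r - c) * n) / qint η (r * n)) := by
    rw [← h]; ring
  have e2 : qpow η ((r + (((s : ℤ) : ℝ) * (r - c / 2) - r)) * n) =
      qpow η ((((s : ℤ) : ℝ) * (r - c / 2) + c / 2) * n) * qpow η (-(c / 2 * n)) := by
    rw [← qpow_add]; ring_nf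
  rw [e, e2, psiPlusExp]
  generalize qint η ((r - c) * n) = B at *
  field_simp

/-- The bare currents q^{±h_i} have no charge, so the contraction comes solely from the Heisenberg
bracket between the annihilation part of the first and the creation part of the second current. -/
theorem pairSeries_psi_psi (s t : ℤˣ) :
    pairSeries (cartanForm η c) i j (fun _ _ => 0) (fun _ _ => 0) (psiMinusExp η r c s)
      (psiPlusExp η r c t) = expSeries fun n => -(qpow η ((sgn t - sgn s) * (r - c / 2) * n) *
        (qint η ((cartan i j : ℝ) * n) / n) *
        (qint η (c * n) / (qint η (r * n) * qint η ((r - c) * n)))) := by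
  rw [pairSeries_eq]
  refine expSeries_congr fun n hn => ?_
  rw [cartanForm_natCast, psiPlusExp, psiMinusExp]
  have e2 : qpow η ((sgn t - sgn s) * (r - c / 2) * n) =
      qpow η ((-(sgn s * (r - c / 2)) - c / 2) * n) * qpow η ((sgn t * (r - c / 2) + c / 2) * n) := by
    rw [← qpow_add]; ring_nf
  rw [e2]
  ring

end Pairs

end Numerics

/-! ### Exchange relations of dressed currents -/

section ExchangeRelations

variable {N : ℕ} {η : ℂ} {c : ℝ}

theorem seriesMul_eq (A : PowerSeries ℂ) (X Y : Current N η c) (k l : ℤ) :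
    seriesMul A X Y k l = lop (scal A) (1, -1) (fun q : ℤ × ℤ => X q.1 * Y q.2) (k, l) := by
  rw [seriesMul, lop]
  refine tsum_congr fun m => ?_
  rw [coeff_scal_mul]
  simp [sub_eq_add_neg]

theorem seriesMulConverges {X Y : Current N η c} (hX : Decays X) (hY : Decays Y)
    (A : PowerSeries ℂ) : SeriesMulConverges A X Y := by
  intro k l
  refine (Adm.summable_coeff (adm_coneTwo_mul hX hY) isDir_one_neg_one (scal A) (k, l)).congr
    fun m => ?_
  rw [coeff_scal_mul]
  simp [sub_eq_add_neg]

theorem polyMul_linear (α β : ℂ) (F : ℤ → ℤ → UqHat N η c) (k l : ℤ) :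
    polyMul (Polynomial.C α + Polynomial.C β * Polynomial.X) F k l =
      α • F k l + β • F (k - 1) (l + 1) := by
  have h1 : (Polynomial.C α + Polynomial.C β * Polynomial.X).natDegree < 2 := by
    refine (Polynomial.natDegree_add_le _ _).trans_lt ?_
    have := Polynomial.natDegree_C_mul_le β Polynomial.X
    have h1 : (Polynomial.X : Polynomial ℂ).natDegree ≤ 1 := Polynomial.natDegree_X_le
    simp only [Polynomial.natDegree_C]
    omega
  rw [polyMul, Polynomial.sum_over_range' (f := fun j a => a • F (k - j) (l + j)) _
    (fun n => zero_smul _ _) 2 h1]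
  simp [Finset.sum_range_succ, Polynomial.coeff_X, Polynomial.coeff_C]

/-- Multiplication by a linear polynomial in the ratio of the two variables. -/
theorem lop_linear_mul {W : ℤ × ℤ → UqHat N η c} (hW : Adm coneTwo W) {D : PowerSeries ℂ}
    {α β α' β' : ℂ}
    (h : (PowerSeries.C β + PowerSeries.C α * PowerSeries.X) * D =
      PowerSeries.C β' + PowerSeries.C α' * PowerSeries.X) (k : ℤ × ℤ) :
    α • lop (scal D) (1, -1) W k + β • lop (scal D) (1, -1) W (k - (1, -1)) =
      α' • W k + β' • W (k - (1, -1)) := by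
  have h1 : ∀ (D : PowerSeries (UqHat N η c)) k, Summable fun n : ℕ =>
      PowerSeries.coeff n D * W (k + n • (1, -1)) :=
    fun D k => hW.summable_coeff isDir_one_neg_one D k
  have key : ∀ (E : PowerSeries ℂ) (a b : ℂ), lop (scal ((PowerSeries.C b + PowerSeries.C a *
      PowerSeries.X) * E)) (1, -1) W (k - (1, -1)) =
        a • lop (scal E) (1, -1) W k + b • lop (scal E) (1, -1) W (k - (1, -1)) := by
    intro E a b
    have e1 : ∀ (a : ℂ) (D : PowerSeries (UqHat N η c)) q,
        lop (scal (PowerSeries.C a) * D) (1, -1) W q = a • lop D (1, -1) W q := by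
      intro a D q
      rw [lop, lop, Algebra.smul_def, ← (h1 D q).tsum_mul_left]
      refine tsum_congr fun n => ?_
      rw [scal, PowerSeries.map_C, PowerSeries.coeff_C_mul, mul_assoc]
    have e2 : lop (PowerSeries.X * scal E) (1, -1) W (k - (1, -1)) = lop (scal E) (1, -1) W k := by
      rw [← lop_mul hW salient_coneTwo isDir_one_neg_one]
      have := lop_X_pow (1, -1) (k - (1, -1)) 1 (lop (scal E) (1, -1) W)
      rw [pow_one, one_smul, sub_add_cancel] at this
      exact this
    have e3 : scal ((PowerSeries.C b + PowerSeries.C a * PowerSeries.X) * E) =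
        (scal (PowerSeries.C b) * scal E + scal (PowerSeries.C a) * (PowerSeries.X * scal E) :
          PowerSeries (UqHat N η c)) := by
      simp only [scal, map_mul, map_add, PowerSeries.map_X]
      noncomm_ring
    rw [e3, ← e2, ← e1, ← e1, add_comm, lop, lop, lop, ← (h1 _ _).tsum_add (h1 _ _)]
    simp only [map_add, add_mul]
  have h2 := key D α β
  have h3 := key 1 α' β'
  rw [mul_one, scal_one, lop_one] at h3
  rw [← h2, ← h3, h]

/-- In both orders, the theta factor times the contraction turns the linear polynomial into another
linear polynomial acting on a normally ordered product, and the two sides then agree by the relation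
`hcore` of the bare currents. The product X(z) Y(w) is expanded in w/z, so the polynomial α + β z/w
enters `hA` as β + α w/z, that is, divided by z/w; this is the origin of the shift by (-1, 1). -/
theorem exchange_of_core {X₀ Y₀ X Y : Current N η c} {i j : Fin (N - 1)}
    {χ χ' : Fin (N - 1) → ℤ → ℂ} (hX : HasCharge hMode X₀ χ) (hY : HasCharge hMode Y₀ χ')
    (hXd : Decays X₀) (hYd : Decays Y₀) {x y x' y' : ℕ → ℂ}
    (hX' : X = dressed hMode i x y X₀) (hY' : Y = dressed hMode j x' y' Y₀) {g : ThetaQuot}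
    {α β γ δ α' β' γ' δ' : ℂ}
    (hA : (PowerSeries.C β + PowerSeries.C α * PowerSeries.X) *
      (minusPart g.den * (minusPart g.num)⁻¹ * pairSeries (cartanForm η c) i j χ χ' y x') =
        PowerSeries.C β' + PowerSeries.C α' * PowerSeries.X)
    (hB : (PowerSeries.C γ + PowerSeries.C δ * PowerSeries.X) *
      (plusPart g.num * (plusPart g.den)⁻¹ * pairSeries (cartanForm η c) j i χ' χ y' x) =
        PowerSeries.C γ' + PowerSeries.C δ' * PowerSeries.X)
    (hcop : IsCoprime (Polynomial.C γ + Polynomial.C δ * Polynomial.X)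
      (Polynomial.C α + Polynomial.C β * Polynomial.X))
    (hlin : (Polynomial.C γ + Polynomial.C δ * Polynomial.X) * linPart g.den =
      (Polynomial.C α + Polynomial.C β * Polynomial.X) * (Polynomial.C g.κ * linPart g.num))
    (hcore : ∀ k l, α' • (X₀ k * Y₀ l) + β' • (X₀ (k - 1) * Y₀ (l + 1)) =
      γ' • (Y₀ l * X₀ k) + δ' • (Y₀ (l + 1) * X₀ (k - 1))) : Exchange g X Y := by
  have hH := isHeisenberg_hMode (N := N) (η := η) (c := c)
  subst hX' hY'
  have dX := hH.decays_dressed hXd i x y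
  have dY := hH.decays_dressed hYd j x' y'
  refine ⟨seriesMulConverges dX dY _, seriesMulConverges dY dX _, _, _, hcop, hlin, fun k l => ?_⟩
  have aN := hH.adm_normalOrder (adm_coneTwo_mul hXd hYd) i j x y x' y'
  have aN' := hH.adm_normalOrder (adm_coneTwo_mul hYd hXd) j i x' y' x y
  rw [polyMul_linear, polyMul_linear]
  simp only [seriesMul_eq, hH.dressed_mul hX hY hXd hYd, hH.dressed_mul hY hX hYd hXd]
  rw [lop_mul aN salient_coneTwo isDir_one_neg_one, lop_mul aN' salient_coneTwo isDir_one_neg_one,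
    ← scal_mul, ← scal_mul]
  have h1 := lop_linear_mul aN hA (k, l)
  have h2 := lop_linear_mul aN' hB (l + 1, k - 1)
  simp only [Prod.mk_sub_mk, sub_neg_eq_add, add_sub_cancel_right, sub_add_cancel] at h1 h2
  rw [h1, add_comm (γ • _), h2, hH.normalOrder_exchange hXd hYd i j x y x' y' hcore k l, add_comm]

/-- The case of a single theta function in the numerator and in the denominator. -/
theorem exchange_theta {X₀ Y₀ X Y : Current N η c} {i j : Fin (N - 1)}
    {χ χ' : Fin (N - 1) → ℤ → ℂ} (hX : HasCharge hMode X₀ χ) (hY : HasCharge hMode Y₀ χ')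
    (hXd : Decays X₀) (hYd : Decays Y₀) {x y x' y' : ℕ → ℂ}
    (hX' : X = dressed hMode i x y X₀) (hY' : Y = dressed hMode j x' y' Y₀) {κ t u v : ℂ}
    (hκ : κ ≠ 0) {A B : PowerSeries ℂ} (hAB : A = minusPart [(t, u)] * (minusPart [(t, v)])⁻¹ *
      pairSeries (cartanForm η c) i j χ χ' y x')
    (hBA : B = plusPart [(t, v)] * (plusPart [(t, u)])⁻¹ *
      pairSeries (cartanForm η c) j i χ' χ y' x) {α' β' γ' δ' : ℂ}
    (hA : (PowerSeries.C (-u) + PowerSeries.X) * A =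
      PowerSeries.C β' + PowerSeries.C α' * PowerSeries.X)
    (hB : (PowerSeries.C κ + PowerSeries.C (-(κ * v)) * PowerSeries.X) * B =
      PowerSeries.C γ' + PowerSeries.C δ' * PowerSeries.X)
    (hcore : ∀ k l, α' • (X₀ k * Y₀ l) + β' • (X₀ (k - 1) * Y₀ (l + 1)) =
      γ' • (Y₀ l * X₀ k) + δ' • (Y₀ (l + 1) * X₀ (k - 1)))
    (huv : u = v → κ = 1 ∧ A = 1 ∧ B = 1 ∧ ∀ k l, X₀ k * Y₀ l = Y₀ l * X₀ k) :
    Exchange ⟨κ, [(t, v)], [(t, u)]⟩ X Y := by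
  subst hAB hBA
  -- If the linear factors of numerator and denominator coincide, the fraction in lowest terms is
  -- constant. The claim is then plain commutativity, which does not follow formally from the
  -- relation multiplied by the common factor; hence the separate hypothesis `huv`.
  by_cases h : u = v
  · obtain ⟨h1, h2, h3, h4⟩ := huv h
    refine exchange_of_core hX hY hXd hYd hX' hY' (α := 1) (β := 0) (γ := 1) (δ := 0) (α' := 1)
      (β' := 0) (γ' := 1) (δ' := 0) ?_ ?_ ?_ ?_ ?_
    · rw [h2, mul_one]
    · rw [h3, mul_one]
    · simpa using isCoprime_one_left
    · simp [h1, h]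
    · simpa using h4
  · refine exchange_of_core hX hY hXd hYd hX' hY' (α := 1) (β := -u) (γ := κ) (δ := -(κ * v)) ?_ hB
      ?_ ?_ hcore
    · rwa [map_one, one_mul]
    · have h' : v - u ≠ 0 := sub_ne_zero.mpr (Ne.symm h)
      -- Bézout coefficients for κ(1 - vx) and 1 - ux: they are constants, chosen so that the terms
      -- in x cancel.
      refine ⟨Polynomial.C (-(u / (κ * (v - u)))), Polynomial.C (v / (v - u)), ?_⟩
      have e1 : -(u / (κ * (v - u))) * κ + v / (v - u) = 1 := by field_simp; ring
      have e2 : -(u / (κ * (v - u))) * -(κ * v) + v / (v - u) * -u = 0 := by field_simp; ring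
      rw [mul_add, mul_add, ← mul_assoc, ← mul_assoc, ← map_mul, ← map_mul, ← map_mul, ← map_mul,
        mul_one, add_add_add_comm, ← map_add, ← add_mul, ← map_add, e1, e2]
      simp
    · simp only [linPart, List.map_cons, List.map_nil, List.prod_cons, List.prod_nil, map_neg,
        map_mul, map_one]
      ring

end ExchangeRelations

/-! ### Exchange relations among Ψ, e and f -/

section Items

variable {N : ℕ} {η : ℂ} {r c : ℝ}

theorem expSeries_mul_neg (s : ℕ → ℂ) : expSeries s * expSeries (fun n => -s n) = 1 := by
  rw [expSeries_add, ← expSeries_zero]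
  exact expSeries_congr fun n _ => add_neg_cancel _

theorem thetaLog_neg (R b a : ℝ) (n : ℕ) : thetaLog η R b (-a) n = -thetaLog η R b a n := by
  rw [thetaLog, thetaLog, neg_mul, qint_neg, mul_neg, neg_div]

theorem thetaLog_zero (R b : ℝ) (n : ℕ) : thetaLog η R b 0 n = 0 := by
  simp [thetaLog, qint]

/-- Real exponents are determined by the absolute value of q^x, as Re η ≠ 0. Thus zeros of numerator
and denominator coincide only when the Cartan entry vanishes. -/
theorem qpow_injective (hη : η.re < 0) : Function.Injective (qpow η) := fun x y h => by
  by_contra hxy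
  refine qpow_ne_one hη (sub_ne_zero.mpr hxy) ?_
  rw [sub_eq_add_neg, qpow_add, h, ← qpow_add, add_neg_cancel, qpow_zero]

/-- Shifting the argument by one period q^{2R} changes the infinite product only by its first
factor. This converts a contraction that is off by one period into an explicit ratio of linear
factors. -/
theorem thetaLog_sub (hη : η.re < 0) {R : ℝ} (hR : 0 < R) (m a : ℝ) :
    expSeries (thetaLog η R m a) * expSeries (fun n => -thetaLog η R (m - 2 * R) a n) *
      (1 - PowerSeries.C (qpow η (m + a)) * PowerSeries.X) =
        1 - PowerSeries.C (qpow η (m - a)) * PowerSeries.X := by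
  rw [one_sub_C_mul_X, one_sub_C_mul_X, expSeries_add, expSeries_add]
  refine expSeries_congr fun n hn => ?_
  have h := qint_mul_ne_zero hη hR hn
  have h1 := qpow_sub_ne_zero hη one_ne_zero
  have hn' : (n : ℂ) ≠ 0 := by exact_mod_cast hn
  have e : qpow η ((R + m) * n) - qpow η ((R + (m - 2 * R)) * n) =
      (qpow η 1 - qpow η (-1)) * (qint η (R * n) * qpow η (m * n)) := by
    rw [qint_mul_qpow, mul_div_cancel₀ _ h1]
    ring_nf
  have e2 : qpow η ((m + a) * n) - qpow η ((m - a) * n) =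
      (qpow η 1 - qpow η (-1)) * (qint η (a * n) * qpow η (m * n)) := by
    rw [qint_mul_qpow, mul_div_cancel₀ _ h1]
    ring_nf
  have e3 : thetaLog η R m a n + -thetaLog η R (m - 2 * R) a n =
      (qpow η ((m + a) * n) - qpow η ((m - a) * n)) / n := by
    rw [thetaLog, thetaLog, ← sub_eq_add_neg, ← sub_div, ← sub_mul, e, e2]
    field_simp
  rw [e3, qpow_pow, qpow_pow]
  ring

theorem thetaLog_level (hη : η.re < 0) (hr : 0 < r) (hrc : 0 < r - c) (m a : ℝ) {n : ℕ}
    (hn : n ≠ 0) : thetaLog η r m (-a) n + thetaLog η (r - c) m a n =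
      qpow η (m * n) * (qint η (a * n) / n) *
        (qint η (c * n) / (qint η (r * n) * qint η ((r - c) * n))) := by
  rw [qint_level hη hr hrc hn, thetaLog_neg, thetaLog, thetaLog, add_mul, add_mul, qpow_add,
    qpow_add]
  field_simp
  ring

theorem kCurrent_mul (s t : ℤˣ) (i j : Fin (N - 1)) (k l : ℤ) :
    (kCurrent s i k * kCurrent t j l : UqHat N η c) = kCurrent t j l * kCurrent s i k := by
  rw [kCurrent, kCurrent]
  split_ifs
  · have := toHat_rel (Rel.K_K (η := η) (c := c) s t i j)
    rwa [map_mul, map_mul] at this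
  all_goals simp

theorem kCurrent_mul_eDrinfeld (s t : ℤˣ) (i j : Fin (N - 1)) (k l : ℤ) :
    (kCurrent s i k * eDrinfeld t j l : UqHat N η c) =
      qpow η (sgn s * sgn t * (cartan i j : ℝ)) • (eDrinfeld t j l * kCurrent s i k) := by
  rw [kCurrent]
  split_ifs
  · have := toHat_rel (Rel.K_e (η := η) (c := c) s t i j (-l - 1))
    rw [map_mul, map_smul, map_mul] at this
    exact this
  · simp

theorem minusPart_pair_div (x y z w : ℂ × ℂ) : minusPart [x, y] * (minusPart [z, w])⁻¹ =
    minusPart [x] * (minusPart [z])⁻¹ * (minusPart [y] * (minusPart [w])⁻¹) := by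
  rw [minusPart_cons, minusPart_cons z, PowerSeries.mul_inv_rev]
  ring

theorem plusPart_pair_div (x y z w : ℂ × ℂ) : plusPart [x, y] * (plusPart [z, w])⁻¹ =
    plusPart [x] * (plusPart [z])⁻¹ * (plusPart [y] * (plusPart [w])⁻¹) := by
  rw [plusPart_cons, plusPart_cons z, PowerSeries.mul_inv_rev]
  ring

/-- The contractions are exactly inverse to the power series parts of the theta quotient, and the
bare currents commute, so no polynomial factor is left. -/
theorem exchange_psi_psi (hη : η.re < 0) (hr : 0 < r) (hrc : 0 < r - c) (s t : ℤˣ)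
    (i j : Fin (N - 1)) {b : ℝ} (hb : b = (sgn s - sgn t) * (r - c / 2)) :
    Exchange (η := η) (c := c)
      ⟨1, [(qpow η (2 * r), qpow η (b - cartan i j)),
          (qpow η (2 * (r - c)), qpow η (b + cartan i j))],
        [(qpow η (2 * r), qpow η (b + cartan i j)),
          (qpow η (2 * (r - c)), qpow η (b - cartan i j))]⟩
      (Psi r s i) (Psi r t j) := by
  refine exchange_of_core (hasCharge_kCurrent s i) (hasCharge_kCurrent t j) (decays_kCurrent s i)
    (decays_kCurrent t j) (Psi_eq hη hr hrc s i) (Psi_eq hη hr hrc t j) (α := 1) (β := 0) (γ := 1)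
    (δ := 0) (α' := 1) (β' := 0) (γ' := 1) (δ' := 0) ?_ ?_ (by simpa using isCoprime_one_left) ?_ ?_
  · have h1 := minusPart_div hη hr b (-(cartan i j : ℝ))
    have h2 := minusPart_div hη hrc b (cartan i j : ℝ)
    rw [sub_neg_eq_add, ← sub_eq_add_neg] at h1
    rw [minusPart_pair_div, h1, h2, expSeries_add, pairSeries_psi_psi,
      expSeries_congr fun n hn => thetaLog_level hη hr hrc _ _ hn, hb, ← neg_mul, neg_sub,
      expSeries_mul_neg, mul_one]
  · have h1 := plusPart_div hη hr b (-(cartan i j : ℝ))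
    have h2 := plusPart_div hη hrc b (cartan i j : ℝ)
    rw [sub_neg_eq_add, ← sub_eq_add_neg] at h1
    rw [plusPart_pair_div, h1, h2, expSeries_add, pairSeries_psi_psi, cartan_comm j i,
      expSeries_congr fun n hn => thetaLog_level hη hr hrc _ _ hn, hb,
      expSeries_mul_neg, mul_one]
  -- The linear factors of the p-thetas in the numerator cancel those of the p*-thetas in the
  -- denominator and conversely, since both families have the same arguments; so the fraction in
  -- lowest terms is 1.
  · simp only [linPart, List.map_cons, List.map_nil, List.prod_cons, List.prod_nil]
    simp
    ring
  · simpa using fun k l => kCurrent_mul s t i j k l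

/-- The exchange relation of `Ψ_i^±` and a current with contractions given by `thetaLog`. -/
theorem exchange_psi_theta (hη : η.re < 0) (hr : 0 < r) (hrc : 0 < r - c) {s : ℤˣ}
    {i j : Fin (N - 1)} {Y₀ Y : Current N η c} {χ : Fin (N - 1) → ℤ → ℂ}
    (hY : HasCharge hMode Y₀ χ) (hYd : Decays Y₀) {x' y' : ℕ → ℂ}
    (hY' : Y = dressed hMode j x' y' Y₀) {R b a : ℝ} (hR : 0 < R)
    (h₁ : pairSeries (cartanForm η c) i j (fun _ _ => 0) χ (psiMinusExp η r c s) x' =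
      expSeries fun n => -thetaLog η R (-b - (1 + sgn s) * R) a n)
    (h₂ : pairSeries (cartanForm η c) j i χ (fun _ _ => 0) y' (psiPlusExp η r c s) =
      expSeries fun n => -thetaLog η R (b - (1 - sgn s) * R) a n)
    (hcore : ∀ k l, kCurrent s i k * Y₀ l = qpow η (sgn s * a) • (Y₀ l * kCurrent s i k)) :
    Exchange ⟨qpow η (-a), [(qpow η (2 * R), qpow η (b + a))], [(qpow η (2 * R), qpow η (b - a))]⟩
      (Psi r s i) Y := by
  have huv : qpow η (b - a) = qpow η (b + a) → a = 0 := fun h => by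
    have := qpow_injective hη h
    linarith
  have hA := minusPart_div hη hR b a
  have hB := plusPart_div hη hR b a
  have hz : ∀ b₁ b₂ : ℝ, a = 0 → expSeries (thetaLog η R b₁ a) *
      expSeries (fun n => -thetaLog η R b₂ a n) = 1 := fun b₁ b₂ ha => by
    rw [expSeries_add, ← expSeries_zero]
    exact expSeries_congr fun n _ => by rw [ha, thetaLog_zero, thetaLog_zero, neg_zero, add_zero]
  have hdeg : qpow η (b - a) = qpow η (b + a) → qpow η (-a) = 1 ∧
      expSeries (thetaLog η R (-b) a) *
        expSeries (fun n => -thetaLog η R (-b - (1 + sgn s) * R) a n) = 1 ∧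
      expSeries (thetaLog η R b a) *
        expSeries (fun n => -thetaLog η R (b - (1 - sgn s) * R) a n) = 1 ∧
      ∀ k l, kCurrent s i k * Y₀ l = Y₀ l * kCurrent s i k := fun h => by
    have ha := huv h
    refine ⟨by rw [ha, neg_zero, qpow_zero], hz _ _ ha, hz _ _ ha, fun k l => ?_⟩
    rw [hcore, ha, mul_zero, qpow_zero, one_smul]
  -- In one of the two orders the contraction cancels the theta factors exactly; in the other it is
  -- off by one period, and `thetaLog_sub` supplies the remaining linear factors. The shifted order
  -- is ΨY for s = 1 and YΨ for s = -1.
  rcases Int.units_eq_one_or s with rfl | rfl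
  · simp only [sgn, Units.val_one, Int.cast_one, one_mul, sub_self, zero_mul, sub_zero,
      one_add_one_eq_two] at h₁ h₂ hcore hdeg
    refine exchange_theta (hasCharge_kCurrent 1 i) hY (decays_kCurrent 1 i) hYd
      (Psi_eq hη hr hrc 1 i) hY' (qpow_ne_zero η _) (by rw [hA, h₁]) (by rw [hB, h₂])
      (α' := qpow η (-(2 * a))) (β' := -qpow η (b - a)) (γ' := qpow η (-a))
      (δ' := -(qpow η (-a) * qpow η (b + a))) ?_ ?_ ?_ hdeg
    · have h := thetaLog_sub hη hR (-b) a
      have e : PowerSeries.C (-qpow η (b - a)) + PowerSeries.X =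
          PowerSeries.C (-qpow η (b - a)) *
            (1 - PowerSeries.C (qpow η (-b + a)) * PowerSeries.X) := by
        rw [mul_sub, ← mul_assoc, ← map_mul, neg_mul, ← qpow_add, mul_one,
          show b - a + (-b + a) = 0 by ring, qpow_zero, map_neg PowerSeries.C (1 : ℂ), map_one]
        ring
      rw [e, mul_assoc, mul_comm (1 - _), h, mul_sub, mul_one, ← mul_assoc, ← map_mul, neg_mul,
        ← qpow_add, show b - a + (-b - a) = -(2 * a) by ring, map_neg PowerSeries.C (qpow η (-(2 * a)))]
      ring
    · rw [expSeries_mul_neg, mul_one]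
    · intro k l
      rw [hcore, hcore, smul_smul, smul_smul, neg_mul, ← qpow_add, ← qpow_add, ← qpow_add]
      ring_nf
  · simp only [sgn, Units.val_neg, Units.val_one, Int.cast_neg, Int.cast_one, add_neg_cancel,
      zero_mul, sub_zero, neg_one_mul, sub_neg_eq_add, one_add_one_eq_two] at h₁ h₂ hcore hdeg
    refine exchange_theta (hasCharge_kCurrent (-1) i) hY (decays_kCurrent (-1) i) hYd
      (Psi_eq hη hr hrc (-1) i) hY' (qpow_ne_zero η _) (by rw [hA, h₁]) (by rw [hB, h₂])
      (α' := 1) (β' := -qpow η (b - a)) (γ' := qpow η (-a))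
      (δ' := -(qpow η (-a) * qpow η (b - a))) ?_ ?_ ?_ hdeg
    · rw [expSeries_mul_neg, mul_one, map_one, one_mul]
    · have h := thetaLog_sub hη hR b a
      have e : PowerSeries.C (qpow η (-a)) + PowerSeries.C (-(qpow η (-a) * qpow η (b + a))) *
          PowerSeries.X = PowerSeries.C (qpow η (-a)) *
            (1 - PowerSeries.C (qpow η (b + a)) * PowerSeries.X) := by
        rw [mul_sub, ← mul_assoc, ← map_mul, mul_one, map_neg, neg_mul, sub_eq_add_neg]
      rw [e, mul_assoc, mul_comm (1 - _), h, mul_sub, mul_one, ← mul_assoc, ← map_mul,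
        map_neg, neg_mul, sub_eq_add_neg]
    · intro k l
      rw [hcore, hcore, one_smul, smul_smul, neg_mul, mul_comm]

theorem exchange_psi_e (hη : η.re < 0) (hr : 0 < r) (hrc : 0 < r - c) (s : ℤˣ)
    (i j : Fin (N - 1)) :
    Exchange (η := η) (c := c)
      ⟨qpow η (-cartan i j), [(qpow η (2 * (r - c)), qpow η (sgn s * (c / 2) + cartan i j))],
        [(qpow η (2 * (r - c)), qpow η (sgn s * (c / 2) - cartan i j))]⟩
      (Psi r s i) (eDressed r j) := by
  refine exchange_psi_theta hη hr hrc (hasCharge_eDrinfeld 1 j) (decays_eDrinfeld 1 j)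
    (eDressed_eq j) hrc ?_ ?_ fun k l => ?_
  · rw [show -(sgn s * (c / 2)) - (1 + sgn s) * (r - c) = -(sgn s * (r - c / 2)) - (r - c) by ring]
    exact pairSeries_psi_e hη hrc i j s hr
  · rw [show sgn s * (c / 2) - (1 - sgn s) * (r - c) = sgn s * (r - c / 2) - (r - c) by ring]
    exact pairSeries_e_psi i j s
  · rw [kCurrent_mul_eDrinfeld]
    simp [sgn]

theorem exchange_psi_f (hη : η.re < 0) (hr : 0 < r) (hrc : 0 < r - c) (s : ℤˣ)
    (i j : Fin (N - 1)) :
    Exchange (η := η) (c := c)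
      ⟨qpow η (cartan i j), [(qpow η (2 * r), qpow η (-(sgn s * (c / 2)) - cartan i j))],
        [(qpow η (2 * r), qpow η (-(sgn s * (c / 2)) + cartan i j))]⟩
      (Psi r s i) (fDressed r j) := by
  have := exchange_psi_theta (s := s) (i := i) (b := -(sgn s * (c / 2)))
    (a := -(cartan i j : ℝ)) hη hr hrc (hasCharge_eDrinfeld (-1) j) (decays_eDrinfeld (-1) j)
    (fDressed_eq (r := r) j) hr ?_ ?_ fun k l => ?_
  · rwa [neg_neg, sub_neg_eq_add, ← sub_eq_add_neg] at this
  · simp only [thetaLog_neg, neg_neg]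
    rw [show sgn s * (c / 2) - (1 + sgn s) * r = -(sgn s * (r - c / 2)) - r by ring]
    exact pairSeries_psi_f i j s
  · simp only [thetaLog_neg, neg_neg]
    rw [show -(sgn s * (c / 2)) - (1 - sgn s) * r = sgn s * (r - c / 2) - r by ring]
    exact pairSeries_f_psi hη hr i j s hrc
  · rw [kCurrent_mul_eDrinfeld]
    simp [sgn]

theorem eDrinfeld_quad (t : ℤˣ) (i j : Fin (N - 1)) (k l : ℤ) :
    (eDrinfeld t i k * eDrinfeld t j l : UqHat N η c) -
        qpow η (-(sgn t * (cartan i j : ℝ))) •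
          (eDrinfeld t i (k - 1) * eDrinfeld t j (l + 1)) =
      qpow η (-(sgn t * (cartan i j : ℝ))) • (eDrinfeld t j l * eDrinfeld t i k) -
        eDrinfeld t j (l + 1) * eDrinfeld t i (k - 1) := by
  -- The coefficient of z^k is the mode of index -k - 1. The indices are chosen so that the four
  -- products that occur are at (k, l) and at (k - 1, l + 1), as needed for multiplication by a
  -- linear polynomial in z/w.
  have h := toHat_rel (Rel.e_quad (η := η) (c := c) t i j (-k - 1) (-l - 2))
  simp only [qbr, map_add, map_sub, map_smul, map_mul, map_zero] at h
  rw [show -k - 1 + 1 = -(k - 1) - 1 by ring, show -l - 2 + 1 = -l - 1 by ring,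
    show -l - 2 = -(l + 1) - 1 by ring] at h
  have h2 := congrArg (qpow η (-(sgn t * (cartan i j : ℝ))) • ·) h
  simp only [smul_add, smul_sub, smul_smul, ← qpow_add, neg_add_cancel, qpow_zero, one_smul,
    smul_zero] at h2
  change _ • (eDrinfeld t i (k - 1) * eDrinfeld t j (l + 1)) -
    eDrinfeld t j (l + 1) * eDrinfeld t i (k - 1) + (_ • (eDrinfeld t j l * eDrinfeld t i k) -
      eDrinfeld t i k * eDrinfeld t j l) = 0 at h2
  rw [← sub_eq_zero, ← neg_eq_zero, ← h2]
  abel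

theorem eDrinfeld_comm (t : ℤˣ) {i j : Fin (N - 1)} (hij : cartan i j = 0) (k l : ℤ) :
    (eDrinfeld t i k * eDrinfeld t j l : UqHat N η c) = eDrinfeld t j l * eDrinfeld t i k := by
  have := toHat_rel (Rel.e_comm (η := η) (c := c) t i j (-k - 1) (-l - 1) hij)
  rwa [map_mul, map_mul] at this

/-- The contractions cancel the power series parts of the theta quotient in both orders. What
remains is the quadratic Drinfeld relation, or plain commutativity when the Cartan entry is 0. -/
theorem exchange_drinfeld (hη : η.re < 0) (t : ℤˣ) {i j : Fin (N - 1)} {X Y : Current N η c}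
    {x y x' y' : ℕ → ℂ} (hX' : X = dressed hMode i x y (eDrinfeld t i))
    (hY' : Y = dressed hMode j x' y' (eDrinfeld t j)) {R a : ℝ} (hR : 0 < R)
    (ha : a = sgn t * (cartan i j : ℝ))
    (h₁ : pairSeries (cartanForm η c) i j (cartanCharge η c t i) (cartanCharge η c t j) y x' =
      expSeries fun n => -thetaLog η R 0 a n)
    (h₂ : pairSeries (cartanForm η c) j i (cartanCharge η c t j) (cartanCharge η c t i) y' x =
      expSeries fun n => -thetaLog η R 0 a n) :
    Exchange ⟨qpow η (-a), [(qpow η (2 * R), qpow η a)], [(qpow η (2 * R), qpow η (-a))]⟩ X Y := by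
  have hA := minusPart_div hη hR 0 a
  have hB := plusPart_div hη hR 0 a
  rw [zero_sub, zero_add] at hA hB
  rw [neg_zero] at hA
  refine exchange_theta (hasCharge_eDrinfeld t i) (hasCharge_eDrinfeld t j) (decays_eDrinfeld t i)
    (decays_eDrinfeld t j) hX' hY' (qpow_ne_zero η _) (A := 1) (B := 1)
    (by rw [hA, h₁, expSeries_mul_neg]) (by rw [hB, h₂, expSeries_mul_neg])
    (α' := 1) (β' := -qpow η (-a)) (γ' := qpow η (-a)) (δ' := -(qpow η (-a) * qpow η a))
    (by rw [mul_one, map_one, one_mul]) (mul_one _) ?_ ?_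
  · intro k l
    have := eDrinfeld_quad (η := η) (c := c) t i j k l
    rw [← ha] at this
    rw [one_smul, neg_smul, ← sub_eq_add_neg, this, ← qpow_add, neg_add_cancel, qpow_zero, neg_smul,
      one_smul, sub_eq_add_neg]
  · intro h
    have h0 : a = 0 := by
      have := qpow_injective hη h
      linarith
    refine ⟨by rw [h0, neg_zero, qpow_zero], rfl, rfl, eDrinfeld_comm t ?_⟩
    rw [ha] at h0
    rcases Int.units_eq_one_or t with rfl | rfl <;> simpa using h0

theorem exchange_e_e (hη : η.re < 0) (hrc : 0 < r - c) (i j : Fin (N - 1)) :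
    Exchange (η := η) (c := c)
      ⟨qpow η (-cartan i j), [(qpow η (2 * (r - c)), qpow η (cartan i j))],
        [(qpow η (2 * (r - c)), qpow η (-cartan i j))]⟩
      (eDressed r i) (eDressed r j) := by
  refine exchange_drinfeld hη 1 (eDressed_eq i) (eDressed_eq j) hrc (by simp [sgn])
    (pairSeries_ee i j) ?_
  rw [cartan_comm i j]
  exact pairSeries_ee j i

theorem exchange_f_f (hη : η.re < 0) (hr : 0 < r) (i j : Fin (N - 1)) :
    Exchange (η := η) (c := c)
      ⟨qpow η (cartan i j), [(qpow η (2 * r), qpow η (-cartan i j))],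
        [(qpow η (2 * r), qpow η (cartan i j))]⟩
      (fDressed r i) (fDressed r j) := by
  have := exchange_drinfeld (a := -(cartan i j : ℝ)) hη (-1) (fDressed_eq (r := r) (c := c) i)
    (fDressed_eq (r := r) (c := c) j) hr (by simp [sgn]) ?_ ?_
  · rwa [neg_neg] at this
  · simp only [thetaLog_neg, neg_neg]
    exact pairSeries_ff i j
  · simp only [thetaLog_neg, neg_neg]
    rw [cartan_comm i j]
    exact pairSeries_ff j i

end Items

/-! ### The commutator of `e_i` and `f_j` -/

section Commutator

section Generic

variable {R : Type*} [Ring R] [UniformSpace R] [IsTopologicalRing R] [T2Space R]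

theorem lop_sub {Γ : Type*} [AddCommGroup Γ] {F G : Γ → R} {D : PowerSeries R} {v : Γ}
    (hF : ∀ k, Summable fun n : ℕ => PowerSeries.coeff n D * F (k + n • v))
    (hG : ∀ k, Summable fun n : ℕ => PowerSeries.coeff n D * G (k + n • v)) (k : Γ) :
    lop D v (fun k => F k - G k) k = lop D v F k - lop D v G k := by
  rw [lop, lop, lop, ← (hF k).tsum_sub (hG k)]
  simp only [mul_sub]

theorem rop_sub {Γ : Type*} [AddCommGroup Γ] {F G : Γ → R} {D : PowerSeries R} {v : Γ}
    (hF : ∀ k, Summable fun n : ℕ => F (k + n • v) * PowerSeries.coeff n D)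
    (hG : ∀ k, Summable fun n : ℕ => G (k + n • v) * PowerSeries.coeff n D) (k : Γ) :
    rop (fun k => F k - G k) v D k = rop F v D k - rop G v D k := by
  rw [rop, rop, rop, ← (hF k).tsum_sub (hG k)]
  simp only [sub_mul]

variable [Algebra ℂ R]

theorem tsum_smul {ι : Type*} (a : ℂ) (f : ι → R) : ∑' i, a • f i = a • ∑' i, f i := by
  rcases eq_or_ne a 0 with rfl | ha
  · simp
  by_cases hf : Summable f
  · simp only [Algebra.smul_def]
    exact hf.tsum_mul_left _
  · rw [tsum_eq_zero_of_not_summable hf, smul_zero, tsum_eq_zero_of_not_summable]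
    intro h
    refine hf ?_
    have := h.mul_left (algebraMap ℂ R a⁻¹)
    simpa only [← Algebra.smul_def, smul_smul, inv_mul_cancel₀ ha, one_smul] using this

theorem lop_smul {Γ : Type*} [AddCommGroup Γ] (D : PowerSeries R) (v : Γ) (F : Γ → R) (a : ℂ)
    (k : Γ) : lop D v (fun k => a • F k) k = a • lop D v F k := by
  simp only [lop, mul_smul_comm, tsum_smul]

theorem rop_smul {Γ : Type*} [AddCommGroup Γ] (D : PowerSeries R) (v : Γ) (F : Γ → R) (a : ℂ)
    (k : Γ) : rop (fun k => a • F k) v D k = a • rop F v D k := by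
  simp only [rop, smul_mul_assoc, tsum_smul]

/-- Dressing of a series of the form `δ(z / w) F(w)`. -/
theorem lop_delta {E E' : PowerSeries R} {u : ℂ} (hu : u ≠ 0)
    (hE : ∀ n, PowerSeries.coeff n E' = u ^ n • PowerSeries.coeff n E) (F : ℤ → R) (k : ℤ × ℤ) :
    lop E (-1, 0) (fun k => u ^ (k.2 - k.1) • F (k.1 + k.2)) k =
      u ^ (k.2 - k.1) • lop E' (-1) F (k.1 + k.2) := by
  rw [lop, lop, ← tsum_smul]
  refine tsum_congr fun n => ?_
  rw [hE, smul_mul_assoc, smul_smul, mul_smul_comm, ← zpow_natCast, ← zpow_add₀ hu]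
  have e : k + n • ((-1, 0) : ℤ × ℤ) = (k.1 - n, k.2) := by ext <;> simp [sub_eq_add_neg]
  have e2 : n • (-1 : ℤ) = -n := by simp
  rw [e, e2, show k.2 - (k.1 - (n : ℤ)) = k.2 - k.1 + n by ring,
    show k.1 - (n : ℤ) + k.2 = k.1 + k.2 + -(n : ℤ) by ring]

theorem rop_delta {D D' : PowerSeries R} {u : ℂ} (hu : u ≠ 0)
    (hD : ∀ n, PowerSeries.coeff n D' = u ^ n • PowerSeries.coeff n D) (F : ℤ → R) (k : ℤ × ℤ) :
    rop (fun k => u ^ (k.2 - k.1) • F (k.1 + k.2)) (0, 1) D k =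
      u ^ (k.2 - k.1) • rop F 1 D' (k.1 + k.2) := by
  rw [rop, rop, ← tsum_smul]
  refine tsum_congr fun n => ?_
  rw [hD, smul_mul_assoc, mul_smul_comm, smul_smul, ← zpow_natCast, ← zpow_add₀ hu]
  have e : k + n • ((0, 1) : ℤ × ℤ) = (k.1, k.2 + n) := by ext <;> simp
  have e2 : n • (1 : ℤ) = n := by simp
  rw [e, e2, show k.2 + (n : ℤ) - k.1 = k.2 - k.1 + n by ring, add_assoc]

theorem rop_lop_smul_sub {Γ : Type*} [AddCommGroup Γ] {E D : PowerSeries R} {u v : Γ}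
    {F G : Γ → R} (a : ℂ)
    (hD : ∀ (F : Γ → R) (k : Γ), Summable fun n : ℕ => F (k + n • v) * PowerSeries.coeff n D)
    (hF : ∀ k, Summable fun n : ℕ => PowerSeries.coeff n E * F (k + n • u))
    (hG : ∀ k, Summable fun n : ℕ => PowerSeries.coeff n E * G (k + n • u)) (k : Γ) :
    rop (lop E u fun k => a • (F k - G k)) v D k =
      a • (rop (lop E u F) v D k - rop (lop E u G) v D k) := by
  have h1 : (lop E u fun k => a • (F k - G k)) = fun k => a • (lop E u F k - lop E u G k) :=
    funext fun k => by rw [lop_smul E u (fun k => F k - G k), lop_sub hF hG]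
  rw [h1, rop_smul D v (fun k => lop E u F k - lop E u G k),
    rop_sub (F := lop E u F) (G := lop E u G) (hD _) (hD _)]

end Generic

variable {N : ℕ} {η : ℂ} {r c : ℝ}

theorem decays_psi (s : ℤˣ) (i : Fin (N - 1)) : Decays (psi s i : Current N η c) := by
  have hH := isHeisenberg_hMode (N := N) (η := η) (c := c)
  rcases Int.units_eq_one_or s with rfl | rfl
  · rw [psi_one]; exact (decays_kCurrent 1 i).rop (hH.null _ _) _
  · rw [psi_neg_one]; exact (decays_kCurrent (-1) i).lop _

theorem commutator_eDrinfeld (i j : Fin (N - 1)) (k l : ℤ) :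
    (eDrinfeld 1 i k * eDrinfeld (-1) j l - eDrinfeld (-1) j l * eDrinfeld 1 i k : UqHat N η c) =
      if i = j then (qpow η 1 - qpow η (-1))⁻¹ •
        (qpow η (c / 2) ^ (l - k) • psi 1 i (k + l + 2) -
          qpow η (-(c / 2)) ^ (l - k) • psi (-1) i (k + l + 2)) else 0 := by
  have h := toHat_rel (Rel.e_e (η := η) (c := c) i j (-k - 1) (-l - 1))
  rw [map_sub, map_mul, map_mul] at h
  refine h.trans ?_
  split_ifs
  -- The factors z⁻¹ and w⁻¹ in the definition of the two currents shift the index of ψ by 2 in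
  -- total.
  · rw [map_smul, map_sub, map_smul, map_smul, qpow_zpow, qpow_zpow,
      show -k - 1 + (-l - 1) = -(k + l + 2) by ring,
      show c / 2 * (((-k - 1 : ℤ) : ℝ) - ((-l - 1 : ℤ) : ℝ)) = c / 2 * ((l - k : ℤ) : ℝ) by
        push_cast; ring, neg_mul]
    rfl
  · exact map_zero _

/-- Dressing of one of the two terms of `[e^{+, i}(z), e^{-, i}(w)]`. -/
theorem dressed_delta (s : ℤˣ) (i : Fin (N - 1)) (k l : ℤ) :
    rop (lop (expPlus hMode i (eExp η r c)) (-1, 0) fun k : ℤ × ℤ =>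
      qpow η (sgn s * (c / 2)) ^ (k.2 - k.1) • (psi s i (k.1 + k.2 + 2) : UqHat N η c)) (0, 1)
        (expMinus hMode i (fExp η r c)) (k, l) =
      qpow η (sgn s * (c / 2)) ^ (l - k) • Psi r s i (k + l + 2) := by
  have hH := isHeisenberg_hMode (N := N) (η := η) (c := c)
  have hu := qpow_ne_zero η (sgn s * (c / 2))
  have hE : expPlus hMode i (fun n : ℕ => qpow η (sgn s * (c / 2) * n) * eExp η r c n) =
      (expPlus hMode i fun n : ℕ => qpow η (sgn s * (c / 2) * n) * ((qint η ((r - c) * n))⁻¹ *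
        qpow η ((r - c + c / 2) * n)) : PowerSeries (UqHat N η c)) :=
    expPlus_congr fun n _ => by rw [eExp, mul_comm (_)⁻¹, ← div_eq_mul_inv]; ring_nf
  have hD : expMinus hMode i (fun n : ℕ => qpow η (sgn s * (c / 2) * n) * fExp η r c n) =
      (expMinus hMode i fun n : ℕ => qpow η (-(-(sgn s * (c / 2))) * n) * -((qint η (r * n))⁻¹ *
        qpow η ((r - c / 2) * n)) : PowerSeries (UqHat N η c)) :=
    expMinus_congr fun n _ => by rw [fExp, neg_neg, mul_comm (_)⁻¹, ← div_eq_mul_inv]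
  rw [Psi, dplus_eq, dminus_eq, mul_minusCurrent, plusCurrent_mul,
    lop_rop (decays_psi s i).summable _ (hH.null _ _), ← hE, ← hD]
  -- With u = q^{± c/2}, the series equals a delta function identifying z/u and uw with one variable
  -- ζ, times a function of ζ. On its support D^+(z) = D^+(uζ) and D^-(w) = D^-(ζ/u), which are the
  -- dressings in the definition of Ψ.
  have h1 : (lop (expPlus hMode i (eExp η r c)) (-1, 0) fun k : ℤ × ℤ =>
      qpow η (sgn s * (c / 2)) ^ (k.2 - k.1) • (psi s i (k.1 + k.2 + 2) : UqHat N η c)) =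
      fun k => qpow η (sgn s * (c / 2)) ^ (k.2 - k.1) •
        lop (expPlus hMode i fun n : ℕ => qpow η (sgn s * (c / 2) * n) * eExp η r c n) (-1)
          (fun m => psi s i (m + 2)) (k.1 + k.2) :=
    funext fun k => lop_delta hu (fun n => by
      rw [expPlus, expPlus, smul_coeff_expSeries]
      simp only [smul_smul, qpow_pow]) (fun m => psi s i (m + 2)) k
  rw [h1]
  refine (rop_delta (D' := expMinus hMode i fun n : ℕ => qpow η (sgn s * (c / 2) * n) *
    fExp η r c n) hu (fun n => by
      rw [expMinus, expMinus, smul_coeff_expSeries]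
      simp only [smul_smul, qpow_pow]) _ (k, l)).trans ?_
  congr 1
  simp only [rop, lop, add_right_comm _ _ (2 : ℤ)]

/-- Both contractions being 1, the products e f and f e are the same dressing applied to the bare
products in the two orders. Their difference is therefore the dressing of the Drinfeld commutator,
which is a sum of two delta terms. -/
theorem commutator_dressed (hη : η.re < 0) (hr : 0 < r) (hrc : 0 < r - c) (i j : Fin (N - 1))
    (k l : ℤ) : (eDressed r i k * fDressed r j l - fDressed r j l * eDressed r i k : UqHat N η c) =
        if i = j then
          ((qpow η 1 - qpow η (-1))⁻¹) •
            (deltaMul (qpow η (-c)) (Current.scale (qpow η (c / 2)) (Psi r 1 i)) (k + 1) (l + 1) -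
              deltaMul (qpow η c) (Current.scale (qpow η (-(c / 2))) (Psi r (-1) i))
                (k + 1) (l + 1))
        else 0 := by
  have hH := isHeisenberg_hMode (N := N) (η := η) (c := c)
  have dX := decays_eDrinfeld (η := η) (c := c) 1 i
  have dY := decays_eDrinfeld (η := η) (c := c) (-1) j
  have h1 := congrFun (hH.dressed_mul (hasCharge_eDrinfeld 1 i) (hasCharge_eDrinfeld (-1) j) dX dY
    i j (eExp η r c) (fun _ => 0) (fun _ => 0) (fExp η r c)) (k, l)
  have h2 := congrFun (hH.dressed_mul (hasCharge_eDrinfeld (-1) j) (hasCharge_eDrinfeld 1 i) dY dX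
    j i (fun _ => 0) (fExp η r c) (eExp η r c) (fun _ => 0)) (l, k)
  rw [pairSeries_ef, scal_one, lop_one] at h1
  rw [pairSeries_fe hη hr hrc, scal_one, lop_one] at h2
  have h3 := hH.normalOrder_swap (adm_coneTwo_mul dY dX) i j (eExp η r c) (fun _ => 0) (fun _ => 0)
    (fExp η r c) (k, l)
  simp only [Prod.swap_prod_mk] at h3
  rw [h3] at h2
  simp only [normalOrder, expPlus_zero, expMinus_zero, lop_one, rop_one] at h1 h2
  rw [show (eDressed r i : Current N η c) = dressed hMode i (eExp η r c) (fun _ => 0)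
      (eDrinfeld 1 i) from eDressed_eq i,
    show (fDressed r j : Current N η c) = dressed hMode j (fun _ => 0) (fExp η r c)
      (eDrinfeld (-1) j) from fDressed_eq j, h1, h2]
  set E : PowerSeries (UqHat N η c) := expPlus hMode i (eExp η r c)
  set D : PowerSeries (UqHat N η c) := expMinus hMode j (fExp η r c) with hD
  have hDn : NullSeries D := hH.null _ _
  have hdir : ∀ (q : ℤ × ℤ) (n : ℕ), q + n • ((-1, 0) : ℤ × ℤ) = (q.1 - n, q.2) := fun q n => by
    ext <;> simp [sub_eq_add_neg]
  have s1 : ∀ q : ℤ × ℤ, Summable fun n : ℕ => PowerSeries.coeff n E *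
      (eDrinfeld 1 i (q + n • ((-1, 0) : ℤ × ℤ)).1 *
        eDrinfeld (-1) j (q + n • ((-1, 0) : ℤ × ℤ)).2) := fun q => by
    simp only [hdir]
    exact summable_mul_left _ ((dX q.1).mul_right _)
  have s2 : ∀ q : ℤ × ℤ, Summable fun n : ℕ => PowerSeries.coeff n E *
      (eDrinfeld (-1) j (q + n • ((-1, 0) : ℤ × ℤ)).2 *
        eDrinfeld 1 i (q + n • ((-1, 0) : ℤ × ℤ)).1) := fun q => by
    simp only [hdir]
    exact summable_mul_left _ (summable_mul_left _ (dX q.1))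
  have h4 := rop_sub (fun k => summable_rop hDn (lop E (-1, 0) fun q : ℤ × ℤ =>
      eDrinfeld 1 i q.1 * eDrinfeld (-1) j q.2) (0, 1) k)
    (fun k => summable_rop hDn (lop E (-1, 0) fun q : ℤ × ℤ =>
      eDrinfeld (-1) j q.2 * eDrinfeld 1 i q.1) (0, 1) k) (k, l)
  have h5 := funext fun q => lop_sub (D := E) (v := (-1, 0))
    (F := fun q : ℤ × ℤ => eDrinfeld 1 i q.1 * eDrinfeld (-1) j q.2)
    (G := fun q : ℤ × ℤ => eDrinfeld (-1) j q.2 * eDrinfeld 1 i q.1) s1 s2 q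
  rw [← h5] at h4
  refine h4.symm.trans ?_
  simp only [commutator_eDrinfeld]
  split_ifs with hij
  · subst hij
    have w : ∀ (u : ℂ) (s : ℤˣ) (q : ℤ × ℤ), Summable fun n : ℕ => PowerSeries.coeff n E *
        (u ^ ((q + n • ((-1, 0) : ℤ × ℤ)).2 - (q + n • ((-1, 0) : ℤ × ℤ)).1) •
          psi s i ((q + n • ((-1, 0) : ℤ × ℤ)).1 + (q + n • ((-1, 0) : ℤ × ℤ)).2 + 2)) := by
      intro u s q
      simp only [hdir]
      simp only [Algebra.smul_def]
      refine summable_mul_left _ (summable_mul_left _ ?_)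
      refine (decays_psi s i (q.1 + q.2 + 2)).congr fun n => ?_
      congr 1
      ring
    rw [rop_lop_smul_sub (F := fun q : ℤ × ℤ => qpow η (c / 2) ^ (q.2 - q.1) •
        (psi 1 i (q.1 + q.2 + 2) : UqHat N η c))
      (G := fun q : ℤ × ℤ => qpow η (-(c / 2)) ^ (q.2 - q.1) •
        (psi (-1) i (q.1 + q.2 + 2) : UqHat N η c)) _
      (fun F k => summable_rop hDn F _ k)
      (w (qpow η (c / 2)) 1) (w (qpow η (-(c / 2))) (-1))]
    have t1 := dressed_delta (η := η) (c := c) (r := r) 1 i k l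
    have t2 := dressed_delta (η := η) (c := c) (r := r) (-1) i k l
    simp only [sgn, Units.val_one, Units.val_neg, Int.cast_neg, Int.cast_one, one_mul, neg_mul]
      at t1 t2
    rw [t1, t2]
    -- The arguments `k + 1`, `l + 1` account for the prefactor 1/(zw). The powers of q agree since
    -- -c(k + 1) + (c/2)(k + l + 2) = (c/2)(l - k).
    simp only [deltaMul, Current.scale, smul_smul, qpow_zpow, ← qpow_add]
    congr 3
    · congr 1
      push_cast
      ring
    · congr 1
      ring
    · congr 1
      push_cast
      ring
    · congr 1
      ring
  · rw [rop, tsum_congr (g := fun _ => 0), tsum_zero]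
    intro n
    rw [lop, tsum_congr (g := fun _ => 0), tsum_zero, zero_mul]
    intro m
    rw [mul_zero]

end Commutator

/-! ### The elliptic Serre relations -/

section Serre

theorem isDir_coneThree₁₂ : IsDir coneThree ((1, -1, 0) : ℤ × ℤ × ℤ) :=
  isDir_coneThree (by simp [mem_coneThree]) (by simp)

theorem isDir_coneThree₁₃ : IsDir coneThree ((1, 0, -1) : ℤ × ℤ × ℤ) :=
  isDir_coneThree (by simp [mem_coneThree]) (by simp)

theorem isDir_coneThree₂₃ : IsDir coneThree ((0, 1, -1) : ℤ × ℤ × ℤ) :=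
  isDir_coneThree (by simp [mem_coneThree]) (by simp)

section Generic

variable {R : Type*} [Ring R] [UniformSpace R] [IsUniformAddGroup R] [IsLinearTopology R R]
  [CompleteSpace R] [IsTopologicalRing R] [T2Space R] [Algebra ℂ R]

theorem lop_scal_lop_scal {Γ : Type*} [AddCommGroup Γ] {C : AddSubmonoid Γ} {F : Γ → R} {v : Γ}
    (hF : Adm C F) (hC : Salient C) (hv : IsDir C v) {f g : PowerSeries ℂ} (h : f * g = 1) :
    lop (scal f) v (lop (scal g) v F) = F := by
  rw [lop_mul hF hC hv, ← scal_mul, h, scal_one, lop_one]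

/-- Scalar multipliers in the three ratios of variables commute, so each inverse pair can be brought
together and cancelled. -/
theorem lop_scal_three {T : ℤ × ℤ × ℤ → R} (hT : Adm coneThree T)
    {f₁₂ f₁₃ f₂₃ g₁₂ g₁₃ g₂₃ : PowerSeries ℂ} (h₁₂ : f₁₂ * g₁₂ = 1) (h₁₃ : f₁₃ * g₁₃ = 1)
    (h₂₃ : f₂₃ * g₂₃ = 1) :
    lop (scal f₁₂) (1, -1, 0) (lop (scal f₁₃) (1, 0, -1) (lop (scal f₂₃) (0, 1, -1)
      (lop (scal g₁₂) (1, -1, 0) (lop (scal g₁₃) (1, 0, -1) (lop (scal g₂₃) (0, 1, -1) T))))) =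
      T := by
  have hC := salient_coneThree
  have a := hT.lop hC isDir_coneThree₂₃ (scal g₂₃)
  have b := hT.lop hC isDir_coneThree₁₃ (scal g₁₃)
  rw [lop_scal_comm (a.lop hC isDir_coneThree₁₃ _) hC isDir_coneThree₂₃ isDir_coneThree₁₂,
    lop_scal_comm a hC isDir_coneThree₂₃ isDir_coneThree₁₃,
    lop_scal_lop_scal hT hC isDir_coneThree₂₃ h₂₃,
    lop_scal_comm b hC isDir_coneThree₁₃ isDir_coneThree₁₂,
    lop_scal_lop_scal hT hC isDir_coneThree₁₃ h₁₃, lop_scal_lop_scal hT hC isDir_coneThree₁₂ h₁₂]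

end Generic

variable {N : ℕ} {η : ℂ} {r c : ℝ}

theorem tripleTerm_eq (A B C : PowerSeries ℂ) (X Y Z : Current N η c) (k : ℤ × ℤ × ℤ)
    (m : ℕ × ℕ × ℕ) : tripleTerm A B C X Y Z k.1 k.2.1 k.2.2 m =
      PowerSeries.coeff m.1 (scal A) * PowerSeries.coeff m.2.1 (scal B) *
        PowerSeries.coeff m.2.2 (scal C) * (fun k : ℤ × ℤ × ℤ => X k.1 * Y k.2.1 * Z k.2.2)
          (k + m.1 • (1, -1, 0) + m.2.1 • (1, 0, -1) + m.2.2 • (0, 1, -1)) := by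
  rw [mul_assoc, mul_assoc, coeff_scal_mul, coeff_scal_mul, coeff_scal_mul, smul_smul, smul_smul,
    tripleTerm, mul_assoc]
  simp [sub_eq_add_neg]

theorem adm_mul_mul {X Y Z : Current N η c} (hX : Decays X) (hY : Decays Y) (hZ : Decays Z) :
    Adm coneThree fun k : ℤ × ℤ × ℤ => X k.1 * Y k.2.1 * Z k.2.2 :=
  adm_coneThree_mul_right (W := fun k => X k.1 * Y k.2) (adm_coneTwo_mul hX hY) hZ

theorem tripleMulConverges (A B C : PowerSeries ℂ) {X Y Z : Current N η c} (hX : Decays X)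
    (hY : Decays Y) (hZ : Decays Z) : TripleMulConverges A B C X Y Z := fun k₁ k₂ k₃ => by
  have h := (adm_mul_mul hX hY hZ).summable_three salient_coneThree
    isDir_coneThree₁₂ isDir_coneThree₁₃ isDir_coneThree₂₃ (k₁, k₂, k₃)
  refine (summable_mul_left (fun m : ℕ × ℕ × ℕ => PowerSeries.coeff m.1 (scal A) *
    PowerSeries.coeff m.2.1 (scal B) * PowerSeries.coeff m.2.2 (scal C)) h).congr fun m => ?_
  exact (tripleTerm_eq A B C X Y Z (k₁, k₂, k₃) m).symm

theorem tripleMul_eq (A B C : PowerSeries ℂ) {X Y Z : Current N η c} (hX : Decays X)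
    (hY : Decays Y) (hZ : Decays Z) (k₁ k₂ k₃ : ℤ) : tripleMul A B C X Y Z k₁ k₂ k₃ =
      lop (scal A) (1, -1, 0) (lop (scal B) (1, 0, -1) (lop (scal C) (0, 1, -1)
        fun k : ℤ × ℤ × ℤ => X k.1 * Y k.2.1 * Z k.2.2)) (k₁, k₂, k₃) := by
  have h := (adm_mul_mul hX hY hZ).summable_three salient_coneThree isDir_coneThree₁₂
    isDir_coneThree₁₃ isDir_coneThree₂₃
  rw [lop_lop_lop (F := fun k : ℤ × ℤ × ℤ => X k.1 * Y k.2.1 * Z k.2.2) h]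
  exact tsum_congr fun m => tripleTerm_eq A B C X Y Z (k₁, k₂, k₃) m

/-- Multiplication by `A`, `B`, `C` undoes the reordering factors of a product of three
currents. -/
theorem tripleMul_of_eq {A B C g₁₂ g₁₃ g₂₃ : PowerSeries ℂ} {X Y Z : Current N η c}
    (hX : Decays X) (hY : Decays Y) (hZ : Decays Z) {T : ℤ × ℤ × ℤ → UqHat N η c}
    (hT : Adm coneThree T) (h₁₂ : A * g₁₂ = 1) (h₁₃ : B * g₁₃ = 1) (h₂₃ : C * g₂₃ = 1)
    (h : (fun k : ℤ × ℤ × ℤ => X k.1 * Y k.2.1 * Z k.2.2) =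
      lop (scal g₁₂) (1, -1, 0) (lop (scal g₁₃) (1, 0, -1) (lop (scal g₂₃) (0, 1, -1) T)))
    (k₁ k₂ k₃ : ℤ) : tripleMul A B C X Y Z k₁ k₂ k₃ = T (k₁, k₂, k₃) := by
  rw [tripleMul_eq A B C hX hY hZ, h, lop_scal_three hT h₁₂ h₁₃ h₂₃]

/-- Expanding the nested q-brackets, the outer coefficients multiply to q · q⁻¹ = 1 and the middle
term gets q + q⁻¹ = [2] after symmetrization, for either sign. -/
theorem serreSum_eDrinfeld (s : ℤˣ) {i j : Fin (N - 1)} (hij : cartan i j = -1) (hη : η.re < 0)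
    (k₁ k₂ l : ℤ) :
    serreSum (qint η 2) (eDrinfeld s i) (eDrinfeld s j : Current N η c) k₁ k₂ l +
      serreSum (qint η 2) (eDrinfeld s i) (eDrinfeld s j) k₂ k₁ l = 0 := by
  have h := toHat_rel (Rel.e_serre (η := η) (c := c) s i j (-k₁ - 1) (-k₂ - 1) (-l - 1) hij)
  have hq : qint η 2 = qpow η (sgn s) + qpow η (-sgn s) := by
    have e : qint η 2 = qpow η 1 + qpow η (-1) := by
      have h0 : qpow η 1 - qpow η (-1) ≠ 0 := qpow_sub_ne_zero hη (by norm_num)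
      rw [qint, div_eq_iff h0, show (2 : ℝ) = 1 + 1 by norm_num, neg_add, qpow_add, qpow_add]
      ring
    rcases Int.units_eq_one_or s with rfl | rfl
    · simpa [sgn] using e
    · simpa [sgn, add_comm] using e
  have hm : qpow η (sgn s) * qpow η (-sgn s) = 1 := by rw [← qpow_add, add_neg_cancel, qpow_zero]
  simp only [map_add, qbr, map_sub, map_mul, map_smul, map_zero] at h
  change eDrinfeld s i k₁ * (eDrinfeld s i k₂ * eDrinfeld s j l -
    qpow η (-sgn s) • (eDrinfeld s j l * eDrinfeld s i k₂)) - qpow η (sgn s) •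
      ((eDrinfeld s i k₂ * eDrinfeld s j l -
        qpow η (-sgn s) • (eDrinfeld s j l * eDrinfeld s i k₂)) * eDrinfeld s i k₁) +
    (eDrinfeld s i k₂ * (eDrinfeld s i k₁ * eDrinfeld s j l -
      qpow η (-sgn s) • (eDrinfeld s j l * eDrinfeld s i k₁)) - qpow η (sgn s) •
      ((eDrinfeld s i k₁ * eDrinfeld s j l -
        qpow η (-sgn s) • (eDrinfeld s j l * eDrinfeld s i k₁)) * eDrinfeld s i k₂)) =
    (0 : UqHat N η c) at h
  simp only [mul_sub, sub_mul, mul_smul_comm, smul_mul_assoc, smul_sub, smul_smul, hm, one_smul,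
    ← mul_assoc] at h
  rw [serreSum, serreSum, hq, add_smul, add_smul, ← h]
  abel

theorem decays_eDressed (r : ℝ) (i : Fin (N - 1)) : Decays (eDressed r i : Current N η c) := by
  rw [eDressed_eq]
  exact isHeisenberg_hMode.decays_dressed (decays_eDrinfeld 1 i) _ _ _

theorem decays_fDressed (r : ℝ) (i : Fin (N - 1)) : Decays (fDressed r i : Current N η c) := by
  rw [fDressed_eq]
  exact isHeisenberg_hMode.decays_dressed (decays_eDrinfeld (-1) i) _ _ _

theorem eDressed_eq_lop (i : Fin (N - 1)) : (eDressed r i : Current N η c) =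
    lop (expPlus hMode i (eExp η r c)) (-1) (eDrinfeld 1 i) := by
  rw [eDressed_eq, dressed, expMinus_zero, rop_one]
  rfl

theorem fDressed_eq_rop (i : Fin (N - 1)) : (fDressed r i : Current N η c) =
    rop (eDrinfeld (-1) i) 1 (expMinus hMode i (fExp η r c)) := by
  rw [fDressed_eq, dressed, expPlus_zero, lop_one]
  rfl

theorem leftExchange_e (i j : Fin (N - 1)) :
    LeftExchange (eDrinfeld 1 i : Current N η c) (expPlus hMode j (eExp η r c))
      (expSeries fun n => -thetaLog η (r - c) 0 (cartan i j) n) := by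
  have h := isHeisenberg_hMode.leftExchange (hasCharge_eDrinfeld (η := η) (c := c) 1 i) j
    (eExp η r c)
  rw [← pairSeries_ee i j, pairSeries_eq]
  simpa only [zero_mul, zero_add] using h

theorem rightExchange_f (i j : Fin (N - 1)) :
    RightExchange (expMinus hMode i (fExp η r c)) (eDrinfeld (-1) j : Current N η c)
      (expSeries fun n => thetaLog η r 0 (cartan i j) n) := by
  have h := isHeisenberg_hMode.rightExchange
    (fun n hn => hasCharge_eDrinfeld (η := η) (c := c) (-1) j i n (by exact_mod_cast hn))
    (fExp η r c)
  rw [← pairSeries_ff i j, pairSeries_eq]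
  simpa only [zero_mul, add_zero, neg_zero] using h

theorem cartan_self (i : Fin (N - 1)) : cartan i i = 2 := by
  simp [cartan, CartanMatrix.A]

/-- The reordered triple products of the currents `e_i`. -/
theorem tripleMul_e {A B C : PowerSeries ℂ} {i j k : Fin (N - 1)}
    (h₁₂ : A * expSeries (fun n => -thetaLog η (r - c) 0 (cartan i j) n) = 1)
    (h₁₃ : B * expSeries (fun n => -thetaLog η (r - c) 0 (cartan i k) n) = 1)
    (h₂₃ : C * expSeries (fun n => -thetaLog η (r - c) 0 (cartan j k) n) = 1) (k₁ k₂ k₃ : ℤ) :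
    tripleMul A B C (eDressed r i : Current N η c) (eDressed r j) (eDressed r k) k₁ k₂ k₃ =
      lop (expPlus hMode i (eExp η r c)) (-1, 0, 0) (lop (expPlus hMode j (eExp η r c)) (0, -1, 0)
        (lop (expPlus hMode k (eExp η r c)) (0, 0, -1) fun q => eDrinfeld 1 i q.1 *
          (eDrinfeld 1 j q.2.1 * eDrinfeld 1 k q.2.2))) (k₁, k₂, k₃) := by
  have dX := decays_eDrinfeld (η := η) (c := c) 1 i
  have dY := decays_eDrinfeld (η := η) (c := c) 1 j
  have dZ := decays_eDrinfeld (η := η) (c := c) 1 k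
  refine tripleMul_of_eq (decays_eDressed r i) (decays_eDressed r j) (decays_eDressed r k)
    ?_ h₁₂ h₁₃ h₂₃ ?_ k₁ k₂ k₃
  · have hC := salient_coneThree
    exact (((adm_coneThree_mul_left dX (adm_coneTwo_mul dY dZ)).lop hC (isDir_coneThree
      (by simp [mem_coneThree]) (by simp)) _).lop hC (isDir_coneThree
      (by simp [mem_coneThree]) (by simp)) _).lop hC (isDir_coneThree
      (by simp [mem_coneThree]) (by simp)) _
  · rw [← dressed_left_mul_mul dX dY dZ _ (leftExchange_e i j) (leftExchange_e i k)
      (leftExchange_e j k)]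
    simp only [eDressed_eq_lop, mul_assoc]

/-- The reordered triple products of the currents `f_i`. -/
theorem tripleMul_f {A B C : PowerSeries ℂ} {i j k : Fin (N - 1)}
    (h₁₂ : A * expSeries (fun n => thetaLog η r 0 (cartan i j) n) = 1)
    (h₁₃ : B * expSeries (fun n => thetaLog η r 0 (cartan i k) n) = 1)
    (h₂₃ : C * expSeries (fun n => thetaLog η r 0 (cartan j k) n) = 1) (k₁ k₂ k₃ : ℤ) :
    tripleMul A B C (fDressed r i : Current N η c) (fDressed r j) (fDressed r k) k₁ k₂ k₃ =
      rop (rop (rop (fun q => eDrinfeld (-1) i q.1 * eDrinfeld (-1) j q.2.1 *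
        eDrinfeld (-1) k q.2.2) (1, 0, 0) (expMinus hMode i (fExp η r c)))
          (0, 1, 0) (expMinus hMode j (fExp η r c)))
            (0, 0, 1) (expMinus hMode k (fExp η r c)) (k₁, k₂, k₃) := by
  have hH := isHeisenberg_hMode (N := N) (η := η) (c := c)
  have dX := decays_eDrinfeld (η := η) (c := c) (-1) i
  have dY := decays_eDrinfeld (η := η) (c := c) (-1) j
  have dZ := decays_eDrinfeld (η := η) (c := c) (-1) k
  refine tripleMul_of_eq (decays_fDressed r i) (decays_fDressed r j) (decays_fDressed r k)
    ?_ h₁₂ h₁₃ h₂₃ ?_ k₁ k₂ k₃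
  · exact (((adm_mul_mul dX dY dZ).rop (hH.null _ _) _).rop (hH.null _ _) _).rop (hH.null _ _) _
  · rw [← dressed_right_mul_mul dX dY dZ (hH.null _ _) (hH.null _ _) (hH.null _ _)
      (rightExchange_f i j) (rightExchange_f i k) (rightExchange_f j k)]
    simp only [fDressed_eq_rop]

theorem expSeries_inv_mul (s : ℕ → ℂ) : (expSeries s)⁻¹ * expSeries s = 1 := by
  rw [expSeries_inv, mul_comm]
  exact expSeries_mul_neg s

/-- The contraction of e_i and e_j is α, as a_{ij} = -1, and that of e_i with itself is β⁻¹, as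
a_{ii} = 2. The prefactors in the relation thus cancel all contractions, and each triple product
becomes the common dressing of a bare triple product. -/
theorem serreRelation_e (hη : η.re < 0) (hrc : 0 < r - c) {i j : Fin (N - 1)}
    (hij : cartan i j = -1) :
    SerreRelation (η := η) (c := c)
      (qPochSeries (qpow η (2 * (r - c))) (qpow η (2 * (r - c)) * qpow η 1) *
        (qPochSeries (qpow η (2 * (r - c))) (qpow η (2 * (r - c)) * qpow η (-1)))⁻¹)
      (qPochSeries (qpow η (2 * (r - c))) (qpow η (2 * (r - c)) * qpow η 2) *
        (qPochSeries (qpow η (2 * (r - c))) (qpow η (2 * (r - c)) * qpow η (-2)))⁻¹)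
      (eDressed r i) (eDressed r j) := by
  have hH := isHeisenberg_hMode (N := N) (η := η) (c := c)
  have hα := qPochSeries_div hη hrc 0 1
  have hβ := qPochSeries_div hη hrc 0 2
  simp only [zero_add, zero_sub] at hα hβ
  rw [hα, hβ]
  have hji : cartan j i = -1 := (cartan_comm j i).trans hij
  have a₁ : (expSeries (thetaLog η (r - c) 0 1))⁻¹ *
      expSeries (fun n => -thetaLog η (r - c) 0 (cartan i j) n) = 1 := by
    simp only [hij, Int.cast_neg, Int.cast_one, thetaLog_neg, neg_neg]
    exact expSeries_inv_mul _
  have a₂ : (expSeries (thetaLog η (r - c) 0 1))⁻¹ *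
      expSeries (fun n => -thetaLog η (r - c) 0 (cartan j i) n) = 1 := by
    rw [hji, ← hij]; exact a₁
  have b : expSeries (thetaLog η (r - c) 0 2) *
      expSeries (fun n => -thetaLog η (r - c) 0 (cartan i i) n) = 1 := by
    rw [cartan_self]
    exact expSeries_mul_neg _
  have dX := decays_eDressed (η := η) (c := c) r i
  have dY := decays_eDressed (η := η) (c := c) r j
  refine ⟨tripleMulConverges _ _ _ dY dX dX, tripleMulConverges _ _ _ dX dY dX,
    tripleMulConverges _ _ _ dX dX dY, fun k₁ k₂ l => ?_⟩
  rw [serreHalf, serreHalf, tripleMul_e a₂ a₂ b, tripleMul_e a₁ b a₂, tripleMul_e b a₁ a₁,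
    tripleMul_e a₂ a₂ b, tripleMul_e a₁ b a₂, tripleMul_e b a₁ a₁]
  exact serre_lop (decays_eDrinfeld 1 i) (decays_eDrinfeld 1 j) (serreSum_eDrinfeld 1 hij hη)
    (hH.commute_expPlus i i _ _) (hH.commute_expPlus i j _ _) _ _ _ rfl rfl rfl k₁ k₂ l

/-- The same argument with annihilation dressings and nome p: the contractions of the f currents
have the opposite sign in the exponent, hence the inverted forms of α and β. -/
theorem serreRelation_f (hη : η.re < 0) (hr : 0 < r) {i j : Fin (N - 1)}
    (hij : cartan i j = -1) :
    SerreRelation (η := η) (c := c)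
      (qPochSeries (qpow η (2 * r)) (qpow η (2 * r) * qpow η (-1)) *
        (qPochSeries (qpow η (2 * r)) (qpow η (2 * r) * qpow η 1))⁻¹)
      (qPochSeries (qpow η (2 * r)) (qpow η (2 * r) * qpow η (-2)) *
        (qPochSeries (qpow η (2 * r)) (qpow η (2 * r) * qpow η 2))⁻¹)
      (fDressed r i) (fDressed r j) := by
  have hH := isHeisenberg_hMode (N := N) (η := η) (c := c)
  have hα := qPochSeries_div hη hr 0 (-1)
  have hβ := qPochSeries_div hη hr 0 (-2)
  simp only [zero_add, zero_sub, neg_neg] at hα hβ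
  rw [hα, hβ]
  have hji : cartan j i = -1 := (cartan_comm j i).trans hij
  have a₁ : (expSeries (thetaLog η r 0 (-1)))⁻¹ *
      expSeries (fun n => thetaLog η r 0 (cartan i j) n) = 1 := by
    simp only [hij, Int.cast_neg, Int.cast_one]
    exact expSeries_inv_mul _
  have a₂ : (expSeries (thetaLog η r 0 (-1)))⁻¹ *
      expSeries (fun n => thetaLog η r 0 (cartan j i) n) = 1 := by
    rw [hji, ← hij]; exact a₁
  have b : expSeries (thetaLog η r 0 (-2)) *
      expSeries (fun n => thetaLog η r 0 (cartan i i) n) = 1 := by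
    rw [cartan_self, mul_comm, show thetaLog η r 0 (-2) = fun n => -thetaLog η r 0 2 n from
      funext fun n => thetaLog_neg _ _ _ _]
    exact expSeries_mul_neg _
  have dX := decays_fDressed (η := η) (c := c) r i
  have dY := decays_fDressed (η := η) (c := c) r j
  refine ⟨tripleMulConverges _ _ _ dY dX dX, tripleMulConverges _ _ _ dX dY dX,
    tripleMulConverges _ _ _ dX dX dY, fun k₁ k₂ l => ?_⟩
  rw [serreHalf, serreHalf, tripleMul_f a₂ a₂ b, tripleMul_f a₁ b a₂, tripleMul_f b a₁ a₁,
    tripleMul_f a₂ a₂ b, tripleMul_f a₁ b a₂, tripleMul_f b a₁ a₁]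
  exact serre_rop (serreSum_eDrinfeld (-1) hij hη) (hH.null _ _) (hH.null _ _)
    (hH.commute_expMinus i i _ _) (hH.commute_expMinus i j _ _) _ _ _ rfl rfl rfl k₁ k₂ l

end Serre

end EllipticSlN

end

/-! ### The theorem -/

open EllipticSlN

theorem proposition1 (N : ℕ) (η : ℂ) (hη : η.re < 0) (r c : ℝ) (hr : 0 < r) (hrc : 0 < r - c)
    (p ps : ℂ) (hp : p = qpow η (2 * r)) (hps : ps = qpow η (2 * (r - c))) :
    -- the dressed currents are well defined in the completion
    DressedConverge N η r c ∧
    -- `Ψ_i^±(z) Ψ_j^±(w)`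
    (∀ (s : ℤˣ) (i j : Fin (N - 1)),
      Exchange (η := η) (c := c)
        ⟨1, [(p, qpow η (-cartan i j)), (ps, qpow η (cartan i j))],
          [(p, qpow η (cartan i j)), (ps, qpow η (-cartan i j))]⟩
        (Psi r s i) (Psi r s j)) ∧
    -- `Ψ_i^+(z) Ψ_j^-(w)`
    (∀ i j : Fin (N - 1),
      Exchange (η := η) (c := c)
        ⟨1, [(p, p * qpow η (-cartan i j - c)), (ps, ps * qpow η (cartan i j + c))],
          [(p, p * qpow η (cartan i j - c)), (ps, ps * qpow η (-cartan i j + c))]⟩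
        (Psi r 1 i) (Psi r (-1) j)) ∧
    -- `Ψ_i^±(z) e_j(w)`
    (∀ (s : ℤˣ) (i j : Fin (N - 1)),
      Exchange (η := η) (c := c)
        ⟨qpow η (-cartan i j), [(ps, qpow η (sgn s * (c / 2) + cartan i j))],
          [(ps, qpow η (sgn s * (c / 2) - cartan i j))]⟩
        (Psi r s i) (eDressed r j)) ∧
    -- `Ψ_i^±(z) f_j(w)`
    (∀ (s : ℤˣ) (i j : Fin (N - 1)),
      Exchange (η := η) (c := c)
        ⟨qpow η (cartan i j), [(p, qpow η (-(sgn s * (c / 2)) - cartan i j))],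
          [(p, qpow η (-(sgn s * (c / 2)) + cartan i j))]⟩
        (Psi r s i) (fDressed r j)) ∧
    -- `[e_i(z), f_j(w)]`, the coefficient of `z ^ k w ^ l`
    (∀ (i j : Fin (N - 1)) (k l : ℤ),
      (eDressed r i k * fDressed r j l - fDressed r j l * eDressed r i k : UqHat N η c) =
        if i = j then
          ((qpow η 1 - qpow η (-1))⁻¹) •
            (deltaMul (qpow η (-c)) (Current.scale (qpow η (c / 2)) (Psi r 1 i)) (k + 1) (l + 1) -
              deltaMul (qpow η c) (Current.scale (qpow η (-(c / 2))) (Psi r (-1) i))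
                (k + 1) (l + 1))
        else 0) ∧
    -- `e_i(z) e_j(w)`
    (∀ i j : Fin (N - 1),
      Exchange (η := η) (c := c)
        ⟨qpow η (-cartan i j), [(ps, qpow η (cartan i j))], [(ps, qpow η (-cartan i j))]⟩
        (eDressed r i) (eDressed r j)) ∧
    -- `f_i(z) f_j(w)`
    (∀ i j : Fin (N - 1),
      Exchange (η := η) (c := c)
        ⟨qpow η (cartan i j), [(p, qpow η (-cartan i j))], [(p, qpow η (cartan i j))]⟩
        (fDressed r i) (fDressed r j)) ∧
    -- the elliptic Serre relations
    (∀ i j : Fin (N - 1), cartan i j = -1 →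
      SerreRelation (η := η) (c := c)
        (qPochSeries ps (ps * qpow η 1) * (qPochSeries ps (ps * qpow η (-1)))⁻¹)
        (qPochSeries ps (ps * qpow η 2) * (qPochSeries ps (ps * qpow η (-2)))⁻¹)
        (eDressed r i) (eDressed r j)) ∧
    (∀ i j : Fin (N - 1), cartan i j = -1 →
      SerreRelation (η := η) (c := c)
        (qPochSeries p (p * qpow η (-1)) * (qPochSeries p (p * qpow η 1))⁻¹)
        (qPochSeries p (p * qpow η (-2)) * (qPochSeries p (p * qpow η 2))⁻¹)
        (fDressed r i) (fDressed r j)) := by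
  subst hp hps
  refine ⟨dressedConverge hη hr, fun s i j => ?_, fun i j => ?_, exchange_psi_e hη hr hrc,
    exchange_psi_f hη hr hrc, commutator_dressed hη hr hrc, exchange_e_e hη hrc,
    exchange_f_f hη hr, fun i j hij => serreRelation_e hη hrc hij,
    fun i j hij => serreRelation_f hη hr hij⟩
  · have h := exchange_psi_psi (N := N) hη hr hrc s s i j (b := 0) (by simp)
    simpa only [zero_sub, zero_add] using h
  -- For opposite signs the common argument is b = 2(r - c/2) = 2r - c, and indeed p q^{-c} =
  -- q^{2r-c} = p* q^c.
  · have h := exchange_psi_psi (N := N) hη hr hrc 1 (-1) i j (b := 2 * r - c)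
      (by simp [sgn]; ring)
    have e : ∀ x : ℝ, qpow η (2 * r) * qpow η (x - c) = qpow η (2 * r - c + x) := fun x => by
      rw [← qpow_add]; ring_nf
    have e' : ∀ x : ℝ, qpow η (2 * (r - c)) * qpow η (x + c) = qpow η (2 * r - c + x) :=
      fun x => by rw [← qpow_add]; ring_nf
    simpa only [e, e', ← sub_eq_add_neg] using h
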